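/- Let $(X_i,Y_i)_{i\ge1}$ be i.i.d. random pairs in $\mathbb R^p\times\mathbb R$, where $X_i$ has density $g$, and let $\bar F(y|x)=\mathbb P(Y>y\mid X=x)$ (for a fixed version of the conditional law), $q(\alpha|x)=\inf\{t:\bar F(t|x)\le\alpha\}$, and $y_F(x)=q(0|x)\in(-\infty,\infty]$. For $z\in\mathbb R$ and $u>0$ put $K_z(u)=\int_1^u v^{z-1}\,dv$ and $K_z'(u)=\int_1^u v^{z-1}\log v\,dv$. Fix $x\in\mathbb R^p$ with $g(x)>0$ and suppose: (A.1) near (to the left of) $y_F(x)$, $\bar F(\cdot|x)$ is twice differentiable with non-vanishing first derivative, and $\bar F(y|x)\bar F''(y|x)/\bar F'(y|x)^2\to\gamma(x)+1$ as $y\uparrow y_F(x)$; (A.2) $g$ is Lipschitz continuous on $\mathbb R^p$; (A.3) $K$ is a bounded probability density on $\mathbb R^p$ vanishing outside the unit ball. Let $a(\cdot|x)$ be a positive auxiliary function, i.e. $\bar F(y+t\,a(y|x)|x)/\bar F(y|x)\to 1/K_{\gamma(x)}^{-1}(t)$ as $y\uparrow y_F(x)$ for every $t$ with $1+t\gamma(x)>0$,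 and set $b(t,\alpha|x)=\frac{q(t\alpha|x)-q(\alpha|x)}{a(q(\alpha|x)|x)}-K_{\gamma(x)}(1/t)$. Let $h=h_n>0$ with $h_n\to0$, and let $\alpha_n\in(0,1)$ with $\alpha_n\to0$. With $K_h(t)=K(t/h)/h^p$, let $$\hat{\bar F}_n(y|x)=\sum_{i=1}^nK_h(x-X_i)\mathbf 1\{Y_i>y\}\Big/\sum_{i=1}^nK_h(x-X_i),\qquad \hat q_n(\alpha|x)=\inf\{t:\hat{\bar F}_n(t|x)\le\alpha\}.$$ Let $J\ge3$, $r\in(0,1)$, $\tau_j=r^{j-1}$ for $j\ge 1$, and let $\pi_1,\dots,\pi_{J-2}$ be real weights with $\sum_{j=1}^{J-2}\pi_j=1$. Define $$\hat\gamma_n^{\rm RP}(x)=\frac1{\log r}\sum_{j=1}^{J-2}\pi_j\log\frac{\hat q_n(\tau_j\alpha_n|x)-\hat q_n(\tau_{j+1}\alpha_n|x)}{\hat q_n(\tau_{j+1}\alpha_n|x)-\hat q_n(\tau_{j+2}\alpha_n|x)},$$ $$\hat a_n^{\rm RP}(x)=\frac1{K_{\hat\gamma_n^{\rm RP}(x)}(r)}\sum_{j=1}^{J-2}\pi_j\,r^{\hat\gamma_n^{\rm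 RP}(x)j}\bigl(\hat q_n(\tau_j\alpha_n|x)-\hat q_n(\tau_{j+1}\alpha_n|x)\bigr).$$ Assume that $nh^p\alpha_n\to\infty$ and that for some $\kappa\in(0,\tau_J)$ and some $\lambda>1$, $$nh^p\alpha_n\Bigl(h\vee\Delta_{\kappa,\lambda}(x,\alpha_n)\vee\max_{1\le j\le J}|b(\tau_j,\alpha_n|x)|\Bigr)^2\to0,\qquad \Delta_{\kappa,\lambda}(x,\alpha)=\sup_{x'\in B(x,h),\ \beta\in[\kappa\alpha,\lambda\alpha]}\Bigl|\frac{\bar F(q(\beta|x)|x')}{\beta}-1\Bigr|.$$ Then $$\sqrt{nh^p\alpha_n}\Bigl(\hat\gamma_n^{\rm RP}(x)-\gamma(x),\ \frac{\hat a_n^{\rm RP}(x)}{a(q(\alpha_n|x)|x)}-1,\ \frac{\hat q_n(\alpha_n|x)-q(\alpha_n|x)}{a(q(\alpha_n|x)|x)}\Bigr)^t$$ converges in distribution to the centered Gaussian law on $\mathbb R^3$ with (positive semidefinite) covariance matrix $$S(x)=\frac{\|K\|_2^2}{g(x)\,K_{\gamma(x)}(r)^2}\,A\,\Sigma\,A^t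 .$$ Here, writing $\gamma=\gamma(x)$, $\Sigma_{j,j'}=(\tau_j\tau_{j'})^{-\gamma}\tau_{j\wedge j'}^{-1}$ for $1\le j,j'\le J$, and $A$ is the $3\times J$ matrix with, for $1\le j\le J$, $$A_{1,j}=\frac{r^{\gamma j}}{\log r}\bigl(\pi_j-(1+r^{-\gamma})\pi_{j-1}+r^{-\gamma}\pi_{j-2}\bigr),$$ $$A_{2,j}=r^{\gamma j}\bigl((1+s)\pi_j-(r^{-\gamma}+(1+r^{-\gamma})s)\pi_{j-1}+r^{-\gamma}s\,\pi_{j-2}\bigr),\qquad A_{3,j}=K_\gamma(r)\mathbf 1\{j=1\},$$ with $s=\sum_{j=1}^{J-2}j\pi_j-\frac{K_\gamma'(r)}{\log(r)K_\gamma(r)}$ and the convention $\pi_{-1}=\pi_0=\pi_{J-1}=\pi_J=0$. -/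

import Mathlib

open MeasureTheory ProbabilityTheory Filter Topology

noncomputable section

namespace ExtremeQuantile

/-! ### The functions `K_z`, their `z`-derivative and their inverse -/

/-- `K_z(u) = ∫_1^u v^(z-1) dv`. -/
def Kfun (z u : ℝ) : ℝ := ∫ v in (1 : ℝ)..u, v ^ (z - 1)

/-- `K'_z(u) = ∫_1^u v^(z-1) log v dv`, the derivative of `K_z(u)` in `z`. -/
def KfunDeriv (z u : ℝ) : ℝ := ∫ v in (1 : ℝ)..u, v ^ (z - 1) * Real.log v

/-- The inverse function of `K_z` on `(0, ∞)`, defined for `1 + z t > 0`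
(see `KfunInv_Kfun` and `Kfun_KfunInv`). -/
def KfunInv (z t : ℝ) : ℝ := if z = 0 then Real.exp t else (1 + z * t) ^ (1 / z)

theorem Kfun_eq {z u : ℝ} (hu : 0 < u) :
    Kfun z u = if z = 0 then Real.log u else (u ^ z - 1) / z := by
  have h0 : (0 : ℝ) ∉ Set.uIcc 1 u := by
    rw [Set.mem_uIcc]
    rintro (⟨h, -⟩ | ⟨h, -⟩) <;> linarith
  unfold Kfun
  split_ifs with hz
  · subst hz
    have h1 : (∫ v in (1 : ℝ)..u, v ^ ((0 : ℝ) - 1)) = ∫ v in (1 : ℝ)..u, v⁻¹ := by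
      refine intervalIntegral.integral_congr fun v _ => ?_
      simp only [zero_sub, Real.rpow_neg_one]
    rw [h1, integral_inv h0, div_one]
  · rw [integral_rpow (Or.inr ⟨fun h => hz (by linarith), h0⟩)]
    simp

theorem KfunInv_pos {z t : ℝ} (ht : 0 < 1 + z * t) : 0 < KfunInv z t := by
  unfold KfunInv
  split_ifs
  · exact Real.exp_pos t
  · exact Real.rpow_pos_of_pos ht _

theorem Kfun_KfunInv {z t : ℝ} (ht : 0 < 1 + z * t) : Kfun z (KfunInv z t) = t := by
  rw [Kfun_eq (KfunInv_pos ht)]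
  unfold KfunInv
  split_ifs with hz
  · exact Real.log_exp t
  · rw [← Real.rpow_mul ht.le, one_div, inv_mul_cancel₀ hz, Real.rpow_one]
    field_simp
    ring

theorem KfunInv_Kfun {z u : ℝ} (hu : 0 < u) : KfunInv z (Kfun z u) = u := by
  rw [Kfun_eq hu]
  unfold KfunInv
  split_ifs with hz
  · exact Real.exp_log hu
  · have h1 : 1 + z * ((u ^ z - 1) / z) = u ^ z := by field_simp; ring
    rw [h1, ← Real.rpow_mul hu.le, one_div, mul_inv_cancel₀ hz, Real.rpow_one]

/-! ### Survival functions, quantiles and the conditions on the tail -/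

/-- The generalized inverse `F^←(α) = inf {t : F(t) ≤ α}` of a survival function `F`. -/
def genInv (F : ℝ → ℝ) (α : ℝ) : ℝ := sInf {t : ℝ | F t ≤ α}

/-- The right endpoint `F^←(0) = inf {t : F(t) ≤ 0}`, with value `+∞` if `F` never vanishes. -/
def endpoint (F : ℝ → ℝ) : EReal := sInf ((fun t : ℝ => (t : EReal)) '' {t : ℝ | F t ≤ 0})

/-- The filter of real `y` with `y ↑ y_F`, where `y_F` is the (possibly infinite) endpoint. -/
def toEndpoint (F : ℝ → ℝ) : Filter ℝ :=
  Filter.comap (fun t : ℝ => (t : EReal)) (𝓝[<] (endpoint F))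

/-- Von Mises condition with index `γ`: near its endpoint, `F` is twice differentiable with
nonvanishing first derivative, and `F F'' / (F')² → γ + 1` at the endpoint. -/
def VonMises (F : ℝ → ℝ) (γ : ℝ) : Prop :=
  (∀ᶠ y in toEndpoint F,
    DifferentiableAt ℝ F y ∧ DifferentiableAt ℝ (deriv F) y ∧ deriv F y ≠ 0) ∧
  Tendsto (fun y => F y * deriv (deriv F) y / (deriv F y) ^ 2) (toEndpoint F) (𝓝 (γ + 1))

/-- `a` is a positive auxiliary function of the survival function `F` with index `γ`:
`F(y + t a(y)) / F(y) → 1 / K_γ^{-1}(t)` as `y` increases to the endpoint, for `1 + t γ > 0`. -/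
def IsAuxiliary (F : ℝ → ℝ) (γ : ℝ) (a : ℝ → ℝ) : Prop :=
  (∀ y : ℝ, (y : EReal) < endpoint F → 0 < a y) ∧
  ∀ t : ℝ, 0 < 1 + γ * t →
    Tendsto (fun y => F (y + t * a y) / F y) (toEndpoint F) (𝓝 (1 / KfunInv γ t))

/-- `b(t, α) = (q(tα) - q(α)) / a(q(α)) - K_γ(1/t)`, where `q = F^←`. -/
def bias (F : ℝ → ℝ) (γ : ℝ) (a : ℝ → ℝ) (t α : ℝ) : ℝ :=
  (genInv F (t * α) - genInv F α) / a (genInv F α) - Kfun γ (1 / t)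

/-! ### Conditional survival function, kernel estimators -/

/-- Conditional survival function `F̄(y|x)` attached to the conditional laws `Q x` of the
response given that the covariate equals `x`. -/
def condSurv {p : ℕ} (Q : Kernel (EuclideanSpace ℝ (Fin p)) ℝ) (x : EuclideanSpace ℝ (Fin p))
    (y : ℝ) : ℝ := (Q x).real (Set.Ioi y)

/-- Oscillation of the conditional survival function: the supremum of `|F̄(q(β|x)|x') / β - 1|`
over `x'` in the ball `B(x, h)` and `β ∈ [κ α, lam α]`. -/
def oscillation {p : ℕ} (Q : Kernel (EuclideanSpace ℝ (Fin p)) ℝ)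
    (x : EuclideanSpace ℝ (Fin p)) (h κ lam α : ℝ) : ℝ :=
  sSup ((fun z : EuclideanSpace ℝ (Fin p) × ℝ =>
      |condSurv Q z.1 (genInv (condSurv Q x) z.2) / z.2 - 1|) ''
    (Metric.ball x h ×ˢ Set.Icc (κ * α) (lam * α)))

/-- `K_h(t) = K(t/h) / h^p`. -/
def scaledKernel {p : ℕ} (K : EuclideanSpace ℝ (Fin p) → ℝ) (h : ℝ)
    (t : EuclideanSpace ℝ (Fin p)) : ℝ := K (h⁻¹ • t) / h ^ p

/-- Kernel estimator of the conditional survival function from the first `n` data points. -/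
def survEst {p : ℕ} (K : EuclideanSpace ℝ (Fin p) → ℝ) (h : ℝ) (n : ℕ)
    (X : ℕ → EuclideanSpace ℝ (Fin p)) (Y : ℕ → ℝ) (x : EuclideanSpace ℝ (Fin p)) (y : ℝ) : ℝ :=
  (∑ i ∈ Finset.range n, scaledKernel K h (x - X i) * (Set.Ioi y).indicator (fun _ => (1 : ℝ)) (Y i))
    / ∑ i ∈ Finset.range n, scaledKernel K h (x - X i)

/-- Kernel estimator of the conditional quantile of order `α`. -/
def quantEst {p : ℕ} (K : EuclideanSpace ℝ (Fin p) → ℝ) (h : ℝ) (n : ℕ)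
    (X : ℕ → EuclideanSpace ℝ (Fin p)) (Y : ℕ → ℝ) (x : EuclideanSpace ℝ (Fin p)) (α : ℝ) : ℝ :=
  genInv (survEst K h n X Y x) α

/-- `K` is a bounded probability density on `ℝ^p` vanishing outside the unit ball. -/
structure IsSmoothingKernel {p : ℕ} (K : EuclideanSpace ℝ (Fin p) → ℝ) : Prop where
  measurable : Measurable K
  nonneg : ∀ u, 0 ≤ K u
  integral_eq_one : ∫ u, K u = 1
  bounded : ∃ M : ℝ, ∀ u, K u ≤ M
  support_subset : Function.support K ⊆ Metric.closedBall 0 1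

/-! ### The refined Pickands estimators -/

/-- `τ_j = r^(j-1)` for `j ≥ 1`. -/
def tau (r : ℝ) (j : ℕ) : ℝ := r ^ (j - 1)

/-- Refined Pickands estimator of the tail index built on a quantile estimator `qh`, with
weights `π_1, …, π_{J-2}`. -/
def gammaRP (J : ℕ) (r : ℝ) (π : ℕ → ℝ) (qh : ℝ → ℝ) (α : ℝ) : ℝ :=
  1 / Real.log r * ∑ j ∈ Finset.Icc 1 (J - 2), π j *
    Real.log ((qh (tau r j * α) - qh (tau r (j + 1) * α)) /
      (qh (tau r (j + 1) * α) - qh (tau r (j + 2) * α)))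

/-- The associated estimator of the scale `a(q(α|x)|x)`. -/
def scaleRP (J : ℕ) (r : ℝ) (π : ℕ → ℝ) (qh : ℝ → ℝ) (α : ℝ) : ℝ :=
  1 / Kfun (gammaRP J r π qh α) r * ∑ j ∈ Finset.Icc 1 (J - 2), π j *
    r ^ (gammaRP J r π qh α * (j : ℝ)) * (qh (tau r j * α) - qh (tau r (j + 1) * α))

/-! ### The asymptotic covariance matrix -/

/-- The weights extended by `0` outside `{1, …, J-2}`. -/
def extWeight (J : ℕ) (π : ℕ → ℝ) (j : ℤ) : ℝ :=
  if 1 ≤ j ∧ j ≤ (J : ℤ) - 2 then π j.toNat else 0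

/-- `E(π) = ∑_j j π_j`. -/
def meanWeight (J : ℕ) (π : ℕ → ℝ) : ℝ := ∑ j ∈ Finset.Icc 1 (J - 2), (j : ℝ) * π j

/-- `E(π) - K'_γ(r) / (log r · K_γ(r))`. -/
def weightShift (J : ℕ) (r : ℝ) (π : ℕ → ℝ) (γ : ℝ) : ℝ :=
  meanWeight J π - KfunDeriv γ r / (Real.log r * Kfun γ r)

/-- The `3 × J` matrix `A`; the column with index `j : Fin J` is the column number `j + 1`. -/
def matA (J : ℕ) (r : ℝ) (π : ℕ → ℝ) (γ : ℝ) : Matrix (Fin 3) (Fin J) ℝ :=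
  Matrix.of ![
    fun j => r ^ (γ * ((j : ℝ) + 1)) *
      (1 / Real.log r * extWeight J π ((j : ℤ) + 1)
        + -((1 + r ^ (-γ)) / Real.log r) * extWeight J π (j : ℤ)
        + r ^ (-γ) / Real.log r * extWeight J π ((j : ℤ) - 1)),
    fun j => r ^ (γ * ((j : ℝ) + 1)) *
      ((1 + weightShift J r π γ) * extWeight J π ((j : ℤ) + 1)
        + (-r ^ (-γ) - (r ^ (-γ) + 1) * weightShift J r π γ) * extWeight J π (j : ℤ)
        + r ^ (-γ) * weightShift J r π γ * extWeight J π ((j : ℤ) - 1)),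
    fun j => if (j : ℕ) = 0 then Kfun γ r else 0]

/-- The `J × J` matrix `Σ_{j,j'} = (τ_j τ_{j'})^{-γ} / τ_{min(j,j')}`, indices shifted by one. -/
def matSigma (J : ℕ) (r γ : ℝ) : Matrix (Fin J) (Fin J) ℝ :=
  Matrix.of fun j j' =>
    (tau r ((j : ℕ) + 1) * tau r ((j' : ℕ) + 1)) ^ (-γ) *
      (tau r (min ((j : ℕ) + 1) ((j' : ℕ) + 1)))⁻¹

/-- The asymptotic covariance matrix `S = ‖K‖₂² / (g(x) K_γ(r)²) · A Σ Aᵗ`. -/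
def matS {p : ℕ} (K : EuclideanSpace ℝ (Fin p) → ℝ) (gx : ℝ) (J : ℕ) (r : ℝ) (π : ℕ → ℝ)
    (γ : ℝ) : Matrix (Fin 3) (Fin 3) ℝ :=
  ((∫ u, K u ^ 2) / (gx * Kfun γ r ^ 2)) • (matA J r π γ * matSigma J r γ * (matA J r π γ).transpose)

end ExtremeQuantile

end

/-! Write F for the conditional survival function at x, q for its quantile function, v = √(n h^p α)
and m = -F/F'. The von Mises condition says that m' → γ at the endpoint. Mean value arguments
against log F then give m(y')/m(y) → w^γ and (y' - y)/m(y) → K_γ(w) whenever F(y)/F(y') → w. Hence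
every auxiliary function is equivalent to m, and F is asymptotically linear at extreme quantiles:
for t = q(τα) + z a(q(α))/v one has v (F(t)/(τα) - 1) → -z τ^γ (`tendsto_linearization`).

The quantile estimator is treated by inversion. After clearing the random denominator, q̂(τα) ≤ t
means T(t) ≤ 0 for the row sum T(t) = v⁻¹ Σ K((x - X_i)/h) (1{Y_i > t} - τα), provided the kernel
weights have a positive sum, an event of probability tending to one. Kernel smoothing gives the
first two moments of T; the oscillation condition transfers the behaviour of F at x to the
neighbouring conditional laws. It follows that T(q(τα) + z a/v) - T(q(τα)) → -g(x) τ^(1+γ) z in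
probability, and Ghosh's criterion converts this into the Bahadur representation v (q̂(τα) -
q(τα))/a = T(q(τα))/(g(x) τ^(1+γ)) + o_P(1) (`tendsto_measureReal_quantEst_sub`). The bias condition
allows (q(τα) - q(α))/a to be replaced by K_γ(1/τ).

By invariance under location and scale, the Pickands estimators (the second one divided by a) are
smooth functions of the normalized quantiles (q̂(τ_j α) - q(α))/a, with values γ and 1 at the limits
K_γ(1/τ_j). The delta method linearizes them, and their gradients are the first two rows of A
divided by K_γ(r) (`sum_matA_zero`, `sum_matA_one`).

There remain linear combinations of row sums of independent variables, uniformly O(1/v), with total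
means tending to 0 and total second moments tending to the quadratic form of S. Characteristic
functions yield the Gaussian limit (`tendstoInDistribution_linear`), and Slutsky's lemma concludes.
-/

noncomputable section

namespace ExtremeQuantile

/-! ### Survival functions and their generalized inverses -/

/-- Survival functions of probability measures on the real line. -/
structure IsSurv (F : ℝ → ℝ) : Prop where
  anti : Antitone F
  nonneg : ∀ y, 0 ≤ F y
  rightCont : ∀ y, ContinuousWithinAt F (Set.Ici y) y
  atBot : Tendsto F atBot (𝓝 1)
  atTop : Tendsto F atTop (𝓝 0)

theorem measureReal_Ioi_eq (μ : Measure ℝ) [IsProbabilityMeasure μ] (y : ℝ) :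
    μ.real (Set.Ioi y) = 1 - cdf μ y := by
  rw [cdf_eq_real, ← Set.compl_Iic, probReal_compl_eq_one_sub measurableSet_Iic]

theorem isSurv_condSurv {p : ℕ} (Q : Kernel (EuclideanSpace ℝ (Fin p)) ℝ) [IsMarkovKernel Q]
    (x : EuclideanSpace ℝ (Fin p)) : IsSurv (condSurv Q x) := by
  have h : condSurv Q x = fun y => 1 - cdf (Q x) y := by
    funext y
    exact measureReal_Ioi_eq _ _
  rw [h]
  refine ⟨fun a b hab => sub_le_sub_left (monotone_cdf _ hab) _,
    fun y => sub_nonneg.2 (cdf_le_one _ _), fun y => ?_, ?_, ?_⟩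
  · exact continuousWithinAt_const.sub ((cdf (Q x)).right_continuous y)
  · simpa using (tendsto_cdf_atBot (Q x)).const_sub 1
  · simpa using (tendsto_cdf_atTop (Q x)).const_sub 1

section Surv

variable {F : ℝ → ℝ}

theorem IsSurv.le_one (hF : IsSurv F) (y : ℝ) : F y ≤ 1 :=
  ge_of_tendsto hF.atBot ((eventually_le_atBot y).mono fun _ h => hF.anti h)

theorem IsSurv.exists_lt_of_lt (hF : IsSurv F) {y c : ℝ} (h : c < F y) : ∃ z, y < z ∧ c < F z := by
  have h1 : ∀ᶠ z in 𝓝[>] y, c < F z :=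
    ((hF.rightCont y).mono Set.Ioi_subset_Ici_self).eventually_const_lt h
  obtain ⟨z, hz, hz'⟩ := (h1.and self_mem_nhdsWithin).exists
  exact ⟨z, hz', hz⟩

/-- Right continuity makes the infimum attained. For levels strictly between 0 and 1 the level set
is nonempty and bounded below, so the real `sInf` is a genuine infimum. -/
theorem IsSurv.genInv_le_iff (hF : IsSurv F) {β t : ℝ} (hβ : β ∈ Set.Ioo (0 : ℝ) 1) :
    genInv F β ≤ t ↔ F t ≤ β := by
  have hbdd : BddBelow {t : ℝ | F t ≤ β} := by
    obtain ⟨y, hy⟩ := (hF.atBot.eventually_const_lt hβ.2).exists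
    exact ⟨y, fun t ht => le_of_not_gt fun hlt => absurd (hF.anti hlt.le) (by
      have : F t ≤ β := ht
      linarith)⟩
  have hne : {t : ℝ | F t ≤ β}.Nonempty := by
    obtain ⟨y, hy⟩ := (hF.atTop.eventually_lt_const hβ.1).exists
    exact ⟨y, hy.le⟩
  constructor
  · intro h
    by_contra! hlt
    obtain ⟨z, hz, hz'⟩ := hF.exists_lt_of_lt hlt
    obtain ⟨s, hs, hs'⟩ := exists_lt_of_csInf_lt hne (lt_of_le_of_lt h hz)
    have := hF.anti hs'.le
    have h3 : F s ≤ β := hs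
    linarith
  · intro h
    exact csInf_le hbdd h

theorem IsSurv.lt_endpoint_iff (hF : IsSurv F) (y : ℝ) : (y : EReal) < endpoint F ↔ 0 < F y := by
  constructor
  · intro h
    refine lt_of_le_of_ne (hF.nonneg y) fun h0 => ?_
    exact absurd (sInf_le ⟨y, h0.symm.le, rfl⟩ : endpoint F ≤ y) (not_le.2 h)
  · intro h
    obtain ⟨z, hz, hz'⟩ := hF.exists_lt_of_lt h
    refine lt_of_lt_of_le (EReal.coe_lt_coe_iff.2 hz) (le_sInf ?_)
    rintro _ ⟨s, hs, rfl⟩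
    refine EReal.coe_le_coe_iff.2 (le_of_not_gt fun hlt => ?_)
    have := hF.anti hlt.le
    have h3 : F s ≤ 0 := hs
    linarith

/-- Removes the extended reals: a point lies to the left of the endpoint exactly when F is positive
there. -/
theorem IsSurv.eventually_toEndpoint (hF : IsSurv F) {p : ℝ → Prop} :
    (∀ᶠ y in toEndpoint F, p y) ↔ ∃ y0, 0 < F y0 ∧ ∀ y, y0 < y → 0 < F y → p y := by
  obtain ⟨y1, hy1⟩ := (hF.atBot.eventually_const_lt one_pos).exists
  have hy1' : (y1 : EReal) < endpoint F := (hF.lt_endpoint_iff y1).2 hy1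
  have hb := (nhdsLT_basis_of_exists_lt ⟨_, hy1'⟩).comap (fun t : ℝ => (t : EReal))
  unfold toEndpoint
  rw [hb.eventually_iff]
  constructor
  · rintro ⟨b, hbe, hb⟩
    obtain ⟨y0, h0, h0'⟩ := EReal.lt_iff_exists_real_btwn.1 hbe
    refine ⟨y0, (hF.lt_endpoint_iff y0).1 h0', fun y hy hy' => hb ?_⟩
    exact ⟨h0.trans (EReal.coe_lt_coe_iff.2 hy), (hF.lt_endpoint_iff y).2 hy'⟩
  · rintro ⟨y0, h0, hp⟩
    refine ⟨y0, (hF.lt_endpoint_iff y0).2 h0, fun y hy => ?_⟩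
    exact hp y (EReal.coe_lt_coe_iff.1 hy.1) ((hF.lt_endpoint_iff y).1 hy.2)

theorem IsSurv.toEndpoint_neBot (hF : IsSurv F) : (toEndpoint F).NeBot := by
  refine ⟨fun h => ?_⟩
  have h1 : ∀ᶠ y in toEndpoint F, False := by rw [h]; exact eventually_bot
  obtain ⟨y0, h0, hp⟩ := hF.eventually_toEndpoint.1 h1
  obtain ⟨z, hz, hz'⟩ := hF.exists_lt_of_lt h0
  exact hp z hz hz'

theorem IsSurv.eventually_pos (hF : IsSurv F) : ∀ᶠ y in toEndpoint F, 0 < F y := by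
  obtain ⟨y1, hy1⟩ := (hF.atBot.eventually_const_lt one_pos).exists
  exact hF.eventually_toEndpoint.2 ⟨y1, hy1, fun y _ h => h⟩

/-- A sequence along which a survival function is positive and vanishes asymptotically
increases to the endpoint. -/
theorem IsSurv.tendsto_toEndpoint (hF : IsSurv F) {ι : Type*} {l : Filter ι} {y : ι → ℝ}
    (h0 : Tendsto (fun i => F (y i)) l (𝓝 0)) (hpos : ∀ᶠ i in l, 0 < F (y i)) :
    Tendsto y l (toEndpoint F) := by
  intro s hs
  obtain ⟨y0, hy0, hp⟩ := hF.eventually_toEndpoint.1 hs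
  rw [mem_map]
  filter_upwards [hpos, h0.eventually_lt_const hy0] with i h1 h2
  exact hp _ (lt_of_not_ge fun hle => absurd (hF.anti hle) (not_le.2 h2)) h1

/-! ### The functions `K_z` -/

theorem hasDerivAt_Kfun {z u : ℝ} (hu : 0 < u) : HasDerivAt (Kfun z) (u ^ (z - 1)) u := by
  have hc : ContinuousOn (fun v : ℝ => v ^ (z - 1)) (Set.Ioi 0) := fun v hv =>
    (Real.continuousAt_rpow_const v _ (Or.inl (ne_of_gt hv))).continuousWithinAt
  have hsub : Set.uIcc 1 u ⊆ Set.Ioi 0 := by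
    intro v hv
    rw [Set.mem_uIcc] at hv
    rcases hv with h | h
    · exact lt_of_lt_of_le one_pos h.1
    · exact lt_of_lt_of_le hu h.1
  refine intervalIntegral.integral_hasDerivAt_right
    ((hc.mono hsub).intervalIntegrable) ?_ (hc.continuousAt (Ioi_mem_nhds hu))
  exact hc.stronglyMeasurableAtFilter isOpen_Ioi u hu

theorem Kfun_one (z : ℝ) : Kfun z 1 = 0 := intervalIntegral.integral_same

theorem strictMonoOn_Kfun (z : ℝ) : StrictMonoOn (Kfun z) (Set.Ioi 0) := by
  refine strictMonoOn_of_deriv_pos (convex_Ioi 0)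
    (fun u hu => (hasDerivAt_Kfun hu).continuousAt.continuousWithinAt) fun u hu => ?_
  rw [interior_Ioi] at hu
  rw [(hasDerivAt_Kfun hu).deriv]
  exact Real.rpow_pos_of_pos hu _

theorem Kfun_pos {z u : ℝ} (hu : 1 < u) : 0 < Kfun z u := by
  rw [← Kfun_one z]
  exact strictMonoOn_Kfun z (Set.mem_Ioi.2 one_pos) (Set.mem_Ioi.2 (one_pos.trans hu)) hu

theorem Kfun_neg {z u : ℝ} (h0 : 0 < u) (hu : u < 1) : Kfun z u < 0 := by
  rw [← Kfun_one z]
  exact strictMonoOn_Kfun z h0 (Set.mem_Ioi.2 one_pos) hu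

/-- A survival function with an auxiliary function is continuous at its endpoint. -/
theorem IsSurv.tendsto_zero_of_isAuxiliary (hF : IsSurv F) {γ : ℝ} {a : ℝ → ℝ}
    (ha : IsAuxiliary F γ a) : Tendsto F (toEndpoint F) (𝓝 0) := by
  have hne := hF.toEndpoint_neBot
  set I := sInf (F '' {y | 0 < F y}) with hI
  have hbdd : BddBelow (F '' {y | 0 < F y}) := ⟨0, by rintro _ ⟨y, hy, rfl⟩; exact hF.nonneg y⟩
  have hnon : (F '' {y | 0 < F y}).Nonempty := by
    obtain ⟨y1, hy1⟩ := (hF.atBot.eventually_const_lt one_pos).exists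
    exact ⟨_, y1, hy1, rfl⟩
  have hI0 : 0 ≤ I := le_csInf hnon (by rintro _ ⟨y, hy, rfl⟩; exact hF.nonneg y)
  have hIle : ∀ y, 0 < F y → I ≤ F y := fun y hy => csInf_le hbdd ⟨y, hy, rfl⟩
  have hlt : ∀ c, I < c → ∀ᶠ y in toEndpoint F, F y < c := by
    intro c hc
    obtain ⟨_, ⟨y0, hy0, rfl⟩, hy0'⟩ := exists_lt_of_csInf_lt hnon hc
    exact hF.eventually_toEndpoint.2 ⟨y0, hy0, fun y hy _ => (hF.anti hy.le).trans_lt hy0'⟩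
  have hFI : Tendsto F (toEndpoint F) (𝓝 I) := by
    refine tendsto_order.2 ⟨fun c hc => ?_, hlt⟩
    filter_upwards [hF.eventually_pos] with y hy using hc.trans_le (hIle y hy)
  rcases hI0.eq_or_lt with h0 | h0
  · rwa [← h0] at hFI
  exfalso
  -- This t is positive and satisfies |γ| t < 1, hence is admissible for either sign of γ.
  set t : ℝ := 1 / (1 + |γ|) with ht
  have ht0 : 0 < t := by positivity
  have h1t : 0 < 1 + γ * t := by
    rw [ht, mul_one_div, ← neg_lt_iff_pos_add', lt_div_iff₀ (by positivity)]
    linarith [neg_abs_le γ]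
  have hlim := ha.2 t h1t
  have hK1 : 1 < KfunInv γ t := by
    by_contra! hle
    have h2 := (strictMonoOn_Kfun γ).monotoneOn (KfunInv_pos h1t) (Set.mem_Ioi.2 one_pos) hle
    rw [Kfun_KfunInv h1t, Kfun_one] at h2
    linarith
  have hc0 : 0 < 1 / KfunInv γ t := by positivity
  have hc1 : 1 / KfunInv γ t < 1 := (div_lt_one (by positivity)).2 hK1
  -- The limit of the ratio is positive, so F(y + t a(y)) is eventually positive and therefore at
  -- least I. The ratio would then have a limit at least 1, while 1 / `KfunInv γ t` is below 1.
  have hlow : ∀ᶠ y in toEndpoint F, I / F y ≤ F (y + t * a y) / F y := by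
    filter_upwards [hF.eventually_pos, hlim.eventually_const_lt hc0] with y hy hy2
    have : 0 < F (y + t * a y) := by
      rcases (hF.nonneg (y + t * a y)).eq_or_lt with h | h
      · rw [← h, zero_div] at hy2
        exact absurd hy2 (lt_irrefl _)
      · exact h
    exact div_le_div_of_nonneg_right (hIle _ this) hy.le
  have hlim2 : Tendsto (fun y => I / F y) (toEndpoint F) (𝓝 (I / I)) :=
    tendsto_const_nhds.div hFI h0.ne'
  rw [div_self h0.ne'] at hlim2
  exact absurd (le_of_tendsto_of_tendsto hlim2 hlim hlow) (not_le.2 hc1)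

end Surv

/-! ### The von Mises condition -/

/-- The reciprocal hazard function `-F / F'`. -/
def recipHazard (F : ℝ → ℝ) (y : ℝ) : ℝ := -F y / deriv F y

/-- The derivative `F F'' / (F')² - 1` of the reciprocal hazard function. -/
def recipHazardDeriv (F : ℝ → ℝ) (y : ℝ) : ℝ := F y * deriv (deriv F) y / deriv F y ^ 2 - 1

/-- `F` is smooth with negative derivative between `y0` and its endpoint. -/
structure IsTailRegion (F : ℝ → ℝ) (y0 : ℝ) : Prop where
  pos : 0 < F y0
  hasDerivAt : ∀ y, y0 < y → 0 < F y → HasDerivAt F (deriv F y) y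
  deriv_neg : ∀ y, y0 < y → 0 < F y → deriv F y < 0
  hasDerivAt_recipHazard :
    ∀ y, y0 < y → 0 < F y → HasDerivAt (recipHazard F) (recipHazardDeriv F y) y

section

variable {F : ℝ → ℝ} {γ : ℝ}

/-- Monotonicity of F turns the nonvanishing derivative into a negative one. -/
theorem VonMises.exists_isTailRegion (hF : IsSurv F) (h : VonMises F γ) :
    ∃ y0, IsTailRegion F y0 := by
  obtain ⟨y0, h0, hp⟩ := hF.eventually_toEndpoint.1 h.1
  have hneg : ∀ y, y0 < y → 0 < F y → deriv F y < 0 := fun y hy hy' =>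
    lt_of_le_of_ne hF.anti.deriv_nonpos (hp y hy hy').2.2
  refine ⟨y0, h0, fun y hy hy' => (hp y hy hy').1.hasDerivAt, hneg, fun y hy hy' => ?_⟩
  have h1 := (hp y hy hy').1.hasDerivAt
  have h2 := (hp y hy hy').2.1.hasDerivAt
  have h3 := (hneg y hy hy').ne
  refine (h1.neg.div h2 h3).congr_deriv ?_
  unfold recipHazardDeriv
  rw [Pi.neg_apply]
  field_simp
  ring

theorem VonMises.tendsto_recipHazardDeriv (h : VonMises F γ) :
    Tendsto (recipHazardDeriv F) (toEndpoint F) (𝓝 γ) := by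
  have h1 := h.2.sub_const 1
  rwa [add_sub_cancel_right] at h1

/-! ### Mean value identities and inversion of quantiles in the tail region. -/

namespace IsTailRegion

variable {y0 : ℝ}

theorem recipHazard_pos (h : IsTailRegion F y0) {y : ℝ} (hy : y0 < y) (hy' : 0 < F y) :
    0 < recipHazard F y :=
  div_pos_of_neg_of_neg (neg_neg_of_pos hy') (h.deriv_neg y hy hy')

theorem of_mem_uIcc (hF : IsSurv F) {y y' z : ℝ} (hy : y0 < y) (hFy : 0 < F y)
    (hy' : y0 < y') (hFy' : 0 < F y') (hz : z ∈ Set.uIcc y y') :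
    y0 < z ∧ 0 < F z ∧ F z ∈ Set.uIcc (F y) (F y') := by
  rw [Set.mem_uIcc] at hz ⊢
  rcases hz with ⟨h1, h2⟩ | ⟨h1, h2⟩
  · exact ⟨hy.trans_le h1, hFy'.trans_le (hF.anti h2), Or.inr ⟨hF.anti h2, hF.anti h1⟩⟩
  · exact ⟨hy'.trans_le h1, hFy.trans_le (hF.anti h2), Or.inl ⟨hF.anti h2, hF.anti h1⟩⟩

/-- Cauchy's mean value theorem for log m against log F: their derivatives are m'/m and F'/F = -1/m,
with quotient -m'. -/
theorem exists_log_recipHazard_of_lt (hF : IsSurv F) (h : IsTailRegion F y0) {y y' : ℝ}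
    (hy : y0 < y) (hFy' : 0 < F y') (hlt : y < y') :
    ∃ z ∈ Set.Ioo y y', Real.log (recipHazard F y' / recipHazard F y) =
      recipHazardDeriv F z * Real.log (F y / F y') := by
  have hpos : ∀ z ∈ Set.Icc y y', 0 < F z := fun z hz => hFy'.trans_le (hF.anti hz.2)
  have hgt : ∀ z ∈ Set.Icc y y', y0 < z := fun z hz => hy.trans_le hz.1
  have hm : ∀ z ∈ Set.Icc y y', 0 < recipHazard F z := fun z hz =>
    h.recipHazard_pos (hgt z hz) (hpos z hz)
  have d1 : ∀ z ∈ Set.Icc y y', HasDerivAt (fun z => Real.log (recipHazard F z))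
      (recipHazardDeriv F z / recipHazard F z) z := fun z hz =>
    (h.hasDerivAt_recipHazard z (hgt z hz) (hpos z hz)).log (hm z hz).ne'
  have d2 : ∀ z ∈ Set.Icc y y', HasDerivAt (fun z => Real.log (F z)) (deriv F z / F z) z :=
    fun z hz => (h.hasDerivAt z (hgt z hz) (hpos z hz)).log (hpos z hz).ne'
  obtain ⟨z, hz, he⟩ := exists_ratio_hasDerivAt_eq_ratio_slope
    (fun z => Real.log (recipHazard F z)) (fun z => recipHazardDeriv F z / recipHazard F z) hlt
    (fun z hz => (d1 z hz).continuousAt.continuousWithinAt)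
    (fun z hz => d1 z (Set.Ioo_subset_Icc_self hz))
    (fun z => Real.log (F z)) (fun z => deriv F z / F z)
    (fun z hz => (d2 z hz).continuousAt.continuousWithinAt)
    (fun z hz => d2 z (Set.Ioo_subset_Icc_self hz))
  have hz' := Set.Ioo_subset_Icc_self hz
  refine ⟨z, hz, ?_⟩
  rw [Real.log_div (hm y' ⟨hlt.le, le_rfl⟩).ne' (hm y ⟨le_rfl, hlt.le⟩).ne',
    Real.log_div (hpos y ⟨le_rfl, hlt.le⟩).ne' (hpos y' ⟨hlt.le, le_rfl⟩).ne']
  have h1 := (hpos z hz').ne'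
  have h2 := (h.deriv_neg z (hgt z hz') (hpos z hz')).ne
  unfold recipHazard at he ⊢
  field_simp at he ⊢
  linarith

theorem exists_log_recipHazard (hF : IsSurv F) (h : IsTailRegion F y0) {y y' : ℝ}
    (hy : y0 < y) (hFy : 0 < F y) (hy' : y0 < y') (hFy' : 0 < F y') :
    ∃ z ∈ Set.uIcc y y', Real.log (recipHazard F y' / recipHazard F y) =
      recipHazardDeriv F z * Real.log (F y / F y') := by
  rcases lt_trichotomy y y' with hlt | rfl | hlt
  · obtain ⟨z, hz, he⟩ := exists_log_recipHazard_of_lt hF h hy hFy' hlt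
    exact ⟨z, Set.Icc_subset_uIcc (Set.Ioo_subset_Icc_self hz), he⟩
  · refine ⟨y, Set.left_mem_uIcc, ?_⟩
    rw [div_self hFy.ne', div_self (h.recipHazard_pos hy hFy).ne']
    simp
  · obtain ⟨z, hz, he⟩ := exists_log_recipHazard_of_lt hF h hy' hFy hlt
    refine ⟨z, Set.Icc_subset_uIcc' (Set.Ioo_subset_Icc_self hz), ?_⟩
    rw [← inv_div, Real.log_inv, he, ← inv_div (F y), Real.log_inv]
    ring

/-- Mean value theorem for z ↦ K_γ(F(y)/F(z)), which vanishes at z = y and has derivative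
(F(y)/F(z))^γ / m(z). -/
theorem exists_sub_mul_eq_Kfun (hF : IsSurv F) (h : IsTailRegion F y0) {y y' : ℝ}
    (hy : y0 < y) (hFy : 0 < F y) (hy' : y0 < y') (hFy' : 0 < F y') :
    ∃ z ∈ Set.uIcc y y', (y' - y) * ((F y / F z) ^ γ / recipHazard F z) = Kfun γ (F y / F y') := by
  have key : ∀ z ∈ Set.uIcc y y', HasDerivAt (fun z => Kfun γ (F y / F z))
      ((F y / F z) ^ γ / recipHazard F z) z := by
    intro z hz
    obtain ⟨hz0, hFz, -⟩ := of_mem_uIcc hF hy hFy hy' hFy' hz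
    have h2 := (h.deriv_neg z hz0 hFz).ne
    have h3 : 0 < F y / F z := div_pos hFy hFz
    refine ((hasDerivAt_Kfun h3).comp z
      ((hasDerivAt_const z (F y)).div (h.hasDerivAt z hz0 hFz) hFz.ne')).congr_deriv ?_
    rw [Real.rpow_sub_one h3.ne']
    unfold recipHazard
    field_simp
    ring
  rcases lt_trichotomy y y' with hlt | rfl | hlt
  · rw [Set.uIcc_of_le hlt.le] at key ⊢
    obtain ⟨z, hz, he⟩ := exists_ratio_hasDerivAt_eq_ratio_slope (fun z => z) (fun _ => 1) hlt
      continuousOn_id (fun z _ => hasDerivAt_id z) _ _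
      (fun z hz => (key z hz).continuousAt.continuousWithinAt)
      (fun z hz => key z (Set.Ioo_subset_Icc_self hz))
    refine ⟨z, Set.Ioo_subset_Icc_self hz, ?_⟩
    rw [div_self hFy.ne', Kfun_one] at he
    linarith
  · refine ⟨y, Set.left_mem_uIcc, ?_⟩
    rw [div_self hFy.ne', Kfun_one]
    simp
  · rw [Set.uIcc_of_ge hlt.le] at key ⊢
    obtain ⟨z, hz, he⟩ := exists_ratio_hasDerivAt_eq_ratio_slope (fun z => z) (fun _ => 1) hlt
      continuousOn_id (fun z _ => hasDerivAt_id z) _ _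
      (fun z hz => (key z hz).continuousAt.continuousWithinAt)
      (fun z hz => key z (Set.Ioo_subset_Icc_self hz))
    refine ⟨z, Set.Ioo_subset_Icc_self hz, ?_⟩
    rw [div_self hFy.ne', Kfun_one] at he
    linarith

theorem exists_sub_eq_neg_mul (hF : IsSurv F) (h : IsTailRegion F y0) {y y' : ℝ}
    (hy : y0 < y) (hFy : 0 < F y) (hy' : y0 < y') (hFy' : 0 < F y') :
    ∃ z ∈ Set.uIcc y y', F y' - F y = -(F z / recipHazard F z * (y' - y)) := by
  have key : ∀ z ∈ Set.uIcc y y', HasDerivAt F (-(F z / recipHazard F z)) z := by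
    intro z hz
    obtain ⟨hz0, hFz, -⟩ := of_mem_uIcc hF hy hFy hy' hFy' hz
    have h2 := (h.deriv_neg z hz0 hFz).ne
    refine (h.hasDerivAt z hz0 hFz).congr_deriv ?_
    unfold recipHazard
    field_simp
  rcases lt_trichotomy y y' with hlt | rfl | hlt
  · rw [Set.uIcc_of_le hlt.le] at key ⊢
    obtain ⟨z, hz, he⟩ := exists_hasDerivAt_eq_slope F _ hlt
      (fun z hz => (key z hz).continuousAt.continuousWithinAt)
      (fun z hz => key z (Set.Ioo_subset_Icc_self hz))
    refine ⟨z, Set.Ioo_subset_Icc_self hz, ?_⟩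
    rw [eq_div_iff (sub_ne_zero.2 hlt.ne')] at he
    linarith
  · exact ⟨y, Set.left_mem_uIcc, by simp⟩
  · rw [Set.uIcc_of_ge hlt.le] at key ⊢
    obtain ⟨z, hz, he⟩ := exists_hasDerivAt_eq_slope F _ hlt
      (fun z hz => (key z hz).continuousAt.continuousWithinAt)
      (fun z hz => key z (Set.Ioo_subset_Icc_self hz))
    refine ⟨z, Set.Ioo_subset_Icc_self hz, ?_⟩
    rw [eq_div_iff (sub_ne_zero.2 hlt.ne')] at he
    linarith

/-- Small levels are attained in the tail region when `F` is continuous at its endpoint. -/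
theorem F_genInv (hF : IsSurv F) (h : IsTailRegion F y0) (h0 : Tendsto F (toEndpoint F) (𝓝 0))
    {β : ℝ} (hβ : 0 < β) (hβ1 : β < 1) (hβ0 : β < F y0) : F (genInv F β) = β := by
  have hiff := fun t => hF.genInv_le_iff (t := t) ⟨hβ, hβ1⟩
  have hle : F (genInv F β) ≤ β := (hiff _).1 le_rfl
  have hgt : y0 < genInv F β := by
    rw [← not_le, hiff]
    exact not_le.2 hβ0
  -- A jump from above β down to 0 is excluded: near the endpoint F takes positive values below β,
  -- at points to the right of `genInv F β`.
  have hpos : 0 < F (genInv F β) := by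
    by_contra hcon
    have hz : F (genInv F β) ≤ 0 := not_lt.1 hcon
    have hne := hF.toEndpoint_neBot
    obtain ⟨y, hy, hy'⟩ := ((h0.eventually_lt_const hβ).and hF.eventually_pos).exists
    have h1 := (hiff y).2 hy.le
    exact absurd (hF.anti h1) (not_le.2 (hz.trans_lt hy'))
  refine le_antisymm hle (le_of_not_gt fun hlt => ?_)
  have hc := (h.hasDerivAt _ hgt hpos).continuousAt
  have h2 : ∀ᶠ y in 𝓝[<] (genInv F β), F y < β :=
    (hc.mono_left nhdsWithin_le_nhds).eventually_lt_const hlt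
  obtain ⟨y, hy, hy'⟩ := (h2.and self_mem_nhdsWithin).exists
  exact absurd ((hiff y).2 hy.le) (not_le.2 hy')

/-- F decreases strictly in the tail region, so no smaller point there reaches the same level. -/
theorem genInv_F (hF : IsSurv F) (h : IsTailRegion F y0) {y : ℝ} (hy : y0 < y)
    (hFy : 0 < F y) (hFy1 : F y < 1) : genInv F (F y) = y := by
  have hiff := fun t => hF.genInv_le_iff (t := t) ⟨hFy, hFy1⟩
  refine le_antisymm ((hiff y).2 le_rfl) (le_of_not_gt fun hlt => ?_)
  set w := max y0 (genInv F (F y)) with hw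
  have hwy : w < y := max_lt hy hlt
  obtain ⟨z, hz, hz'⟩ := exists_between hwy
  have hz0 : y0 < z := (le_max_left _ _).trans_lt hz
  have hFz : F z ≤ F y := (hiff z).1 ((le_max_right _ _).trans hz.le)
  have hFzpos : 0 < F z := hFy.trans_le (hF.anti hz'.le)
  obtain ⟨x, hx, he⟩ := h.exists_sub_eq_neg_mul hF hz0 hFzpos hy hFy
  obtain ⟨hx0, hFx, -⟩ := of_mem_uIcc hF hz0 hFzpos hy hFy hx
  have := mul_pos (div_pos hFx (h.recipHazard_pos hx0 hFx)) (sub_pos.2 hz')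
  linarith

end IsTailRegion

end

/-- A survival function which is regular above `y0`, is continuous at its endpoint, and satisfies
the von Mises condition with index `γ`. -/
structure IsVonMisesTail (F : ℝ → ℝ) (γ y0 : ℝ) : Prop where
  surv : IsSurv F
  region : IsTailRegion F y0
  tendsto_zero : Tendsto F (toEndpoint F) (𝓝 0)
  tendsto_deriv : Tendsto (recipHazardDeriv F) (toEndpoint F) (𝓝 γ)

theorem VonMises.exists_isVonMisesTail {F : ℝ → ℝ} {γ : ℝ} {a : ℝ → ℝ} (hF : IsSurv F)
    (h : VonMises F γ) (ha : IsAuxiliary F γ a) : ∃ y0, IsVonMisesTail F γ y0 := by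
  obtain ⟨y0, hy0⟩ := h.exists_isTailRegion hF
  exact ⟨y0, hF, hy0, hF.tendsto_zero_of_isAuxiliary ha, h.tendsto_recipHazardDeriv⟩

/-- Selects the intermediate points of mean value theorems as one function of the index, so that
their limits can be taken. -/
theorem exists_forall_eventually {ι : Type*} {l : Filter ι} {p : ι → ℝ → Prop}
    (h : ∀ᶠ i in l, ∃ z, p i z) : ∃ ξ : ι → ℝ, ∀ᶠ i in l, p i (ξ i) := by
  classical
  exact ⟨fun i => if hi : ∃ z, p i z then hi.choose else 0,
    h.mono fun i hi => by simpa only [dif_pos hi] using hi.choose_spec⟩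

/-! ### Limits along families increasing to the endpoint. -/

namespace IsVonMisesTail

variable {F : ℝ → ℝ} {γ y0 : ℝ} {ι : Type*} {l : Filter ι} {y y' ξ : ι → ℝ}

theorem eventually_mem (h : IsVonMisesTail F γ y0) (hy : Tendsto y l (toEndpoint F)) :
    ∀ᶠ i in l, y0 < y i ∧ 0 < F (y i) :=
  hy.eventually (p := fun y => y0 < y ∧ 0 < F y)
    (h.surv.eventually_toEndpoint.2 ⟨y0, h.region.pos, fun _ h1 h2 => ⟨h1, h2⟩⟩)

/-- Reaching the endpoint amounts to F being positive and tending to 0, and F(ξ) is squeezed between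
0 and the larger of the two end values. -/
theorem tendsto_of_mem_uIcc (h : IsVonMisesTail F γ y0) (hy : Tendsto y l (toEndpoint F))
    (hy' : Tendsto y' l (toEndpoint F)) (hξ : ∀ᶠ i in l, ξ i ∈ Set.uIcc (y i) (y' i)) :
    Tendsto ξ l (toEndpoint F) := by
  have hmax : Tendsto (fun i => max (F (y i)) (F (y' i))) l (𝓝 0) := by
    simpa using (h.tendsto_zero.comp hy).max (h.tendsto_zero.comp hy')
  have key : ∀ᶠ i in l, 0 < F (ξ i) ∧ F (ξ i) ≤ max (F (y i)) (F (y' i)) := by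
    filter_upwards [h.eventually_mem hy, h.eventually_mem hy', hξ] with i h1 h2 h3
    obtain ⟨-, h4, h5⟩ := IsTailRegion.of_mem_uIcc h.surv h1.1 h1.2 h2.1 h2.2 h3
    exact ⟨h4, h5.2⟩
  exact h.surv.tendsto_toEndpoint
    (tendsto_of_tendsto_of_tendsto_of_le_of_le' tendsto_const_nhds hmax
      (key.mono fun i hi => hi.1.le) (key.mono fun i hi => hi.2)) (key.mono fun i hi => hi.1)

theorem tendsto_recipHazard_div (h : IsVonMisesTail F γ y0) (hy : Tendsto y l (toEndpoint F))
    (hy' : Tendsto y' l (toEndpoint F)) {w : ℝ} (hw : 0 < w)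
    (hlim : Tendsto (fun i => F (y i) / F (y' i)) l (𝓝 w)) :
    Tendsto (fun i => recipHazard F (y' i) / recipHazard F (y i)) l (𝓝 (w ^ γ)) := by
  have hex : ∀ᶠ i in l, ∃ z, z ∈ Set.uIcc (y i) (y' i) ∧
      Real.log (recipHazard F (y' i) / recipHazard F (y i)) =
        recipHazardDeriv F z * Real.log (F (y i) / F (y' i)) := by
    filter_upwards [h.eventually_mem hy, h.eventually_mem hy'] with i h1 h2
    exact h.region.exists_log_recipHazard h.surv h1.1 h1.2 h2.1 h2.2
  obtain ⟨ξ, hξ⟩ := exists_forall_eventually hex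
  have hξt := h.tendsto_of_mem_uIcc hy hy' (hξ.mono fun i hi => hi.1)
  have h1 := ((h.tendsto_deriv.comp hξt).mul (hlim.log hw.ne')).rexp
  rw [Real.rpow_def_of_pos hw, mul_comm]
  refine h1.congr' ?_
  filter_upwards [hξ, h.eventually_mem hy, h.eventually_mem hy'] with i hi h1 h2
  simp only [Function.comp]
  rw [← hi.2, Real.exp_log (div_pos (h.region.recipHazard_pos h2.1 h2.2)
    (h.region.recipHazard_pos h1.1 h1.2))]

theorem abs_log_div_le {a b c : ℝ} (ha : 0 < a) (hb : 0 < b) (hc : 0 < c)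
    (h : c ∈ Set.uIcc a b) : |Real.log (a / c)| ≤ |Real.log (a / b)| := by
  rw [Real.log_div ha.ne' hc.ne', Real.log_div ha.ne' hb.ne', abs_sub_comm,
    abs_sub_comm (Real.log a) (Real.log b)]
  refine Set.abs_sub_left_of_mem_uIcc ?_
  rw [Set.mem_uIcc] at h ⊢
  rcases h with ⟨h1, h2⟩ | ⟨h1, h2⟩
  · exact Or.inl ⟨Real.log_le_log ha h1, Real.log_le_log hc h2⟩
  · exact Or.inr ⟨Real.log_le_log hb h1, Real.log_le_log hc h2⟩

/-- The two mean value identities combine into (y' - y)/m(y) = K_γ(F(y)/F(y')) · exp((m'(ζ) - γ)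
log(F(y)/F(ξ))) with intermediate points ξ and ζ. The ratio F(y)/F(ξ) need not converge, but its
logarithm stays bounded because ξ lies between y and y', so the exponential tends to 1. -/
theorem tendsto_sub_div_recipHazard (h : IsVonMisesTail F γ y0)
    (hy : Tendsto y l (toEndpoint F)) (hy' : Tendsto y' l (toEndpoint F)) {w : ℝ} (hw : 0 < w)
    (hlim : Tendsto (fun i => F (y i) / F (y' i)) l (𝓝 w)) :
    Tendsto (fun i => (y' i - y i) / recipHazard F (y i)) l (𝓝 (Kfun γ w)) := by
  have hex : ∀ᶠ i in l, ∃ z, z ∈ Set.uIcc (y i) (y' i) ∧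
      (y' i - y i) * ((F (y i) / F z) ^ γ / recipHazard F z) = Kfun γ (F (y i) / F (y' i)) := by
    filter_upwards [h.eventually_mem hy, h.eventually_mem hy'] with i h1 h2
    exact h.region.exists_sub_mul_eq_Kfun h.surv h1.1 h1.2 h2.1 h2.2
  obtain ⟨ξ, hξ⟩ := exists_forall_eventually hex
  have hξt := h.tendsto_of_mem_uIcc hy hy' (hξ.mono fun i hi => hi.1)
  have hex2 : ∀ᶠ i in l, ∃ z, z ∈ Set.uIcc (y i) (ξ i) ∧
      Real.log (recipHazard F (ξ i) / recipHazard F (y i)) =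
        recipHazardDeriv F z * Real.log (F (y i) / F (ξ i)) := by
    filter_upwards [h.eventually_mem hy, h.eventually_mem hξt] with i h1 h2
    exact h.region.exists_log_recipHazard h.surv h1.1 h1.2 h2.1 h2.2
  obtain ⟨ζ, hζ⟩ := exists_forall_eventually hex2
  have hζt := h.tendsto_of_mem_uIcc hy hξt (hζ.mono fun i hi => hi.1)
  have hexp : Tendsto
      (fun i => (recipHazardDeriv F (ζ i) - γ) * Real.log (F (y i) / F (ξ i))) l (𝓝 0) := by
    have h1 : Tendsto (fun i => |recipHazardDeriv F (ζ i) - γ| *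
        |Real.log (F (y i) / F (y' i))|) l (𝓝 0) := by
      have h2 := ((h.tendsto_deriv.comp hζt).sub_const γ).abs.mul (hlim.log hw.ne').abs
      simpa using h2
    refine squeeze_zero_norm' ?_ h1
    filter_upwards [h.eventually_mem hy, h.eventually_mem hy', hξ] with i h2 h3 h4
    obtain ⟨-, h5, h6⟩ := IsTailRegion.of_mem_uIcc h.surv h2.1 h2.2 h3.1 h3.2 h4.1
    rw [Real.norm_eq_abs, abs_mul]
    exact mul_le_mul_of_nonneg_left (abs_log_div_le h2.2 h3.2 h5 h6) (abs_nonneg _)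
  have hK := ((hasDerivAt_Kfun (z := γ) hw).continuousAt.tendsto.comp hlim).mul hexp.rexp
  rw [Real.exp_zero, mul_one] at hK
  refine hK.congr' ?_
  filter_upwards [hξ, hζ, h.eventually_mem hy, h.eventually_mem hξt] with i h1 h2 h3 h4
  have m1 := h.region.recipHazard_pos h3.1 h3.2
  have m2 := h.region.recipHazard_pos h4.1 h4.2
  have hq : 0 < F (y i) / F (ξ i) := div_pos h3.2 h4.2
  have hqp : 0 < (F (y i) / F (ξ i)) ^ γ := Real.rpow_pos_of_pos hq _
  simp only [Function.comp]
  rw [sub_mul, ← h2.2, ← h1.2, Real.exp_sub, Real.exp_log (div_pos m2 m1), mul_comm γ,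
    ← Real.rpow_def_of_pos hq]
  field_simp

/-- With y' = y + t a(y), the quotient (y' - y)/m(y) = t a(y)/m(y) tends to K_γ(K_γ⁻¹(t)) = t. One
admissible t > 0 is enough. -/
theorem tendsto_auxiliary_div (h : IsVonMisesTail F γ y0) {a : ℝ → ℝ} (ha : IsAuxiliary F γ a)
    (hy : Tendsto y l (toEndpoint F)) :
    Tendsto (fun i => a (y i) / recipHazard F (y i)) l (𝓝 1) := by
  set t : ℝ := 1 / (1 + |γ|) with ht
  have ht0 : 0 < t := by positivity
  have h1t : 0 < 1 + γ * t := by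
    rw [ht, mul_one_div, ← neg_lt_iff_pos_add', lt_div_iff₀ (by positivity)]
    linarith [neg_abs_le γ]
  have hw := KfunInv_pos h1t
  have hlim := (ha.2 t h1t).comp hy
  have hpos := h.eventually_mem hy
  have hpos' : ∀ᶠ i in l, 0 < F (y i + t * a (y i)) := by
    filter_upwards [hpos, hlim.eventually_const_lt (by positivity : 0 < 1 / KfunInv γ t)]
      with i h1 h2
    rcases (h.surv.nonneg (y i + t * a (y i))).eq_or_lt with h3 | h3
    · simp only [Function.comp, ← h3, zero_div, lt_irrefl] at h2
    · exact h3
  have hy' : Tendsto (fun i => y i + t * a (y i)) l (toEndpoint F) := by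
    refine h.surv.tendsto_toEndpoint ?_ hpos'
    have h1 := hlim.mul (h.tendsto_zero.comp hy)
    rw [mul_zero] at h1
    refine h1.congr' ?_
    filter_upwards [hpos] with i hi
    exact div_mul_cancel₀ _ hi.2.ne'
  have hlim' : Tendsto (fun i => F (y i) / F (y i + t * a (y i))) l (𝓝 (KfunInv γ t)) := by
    have h1 := hlim.inv₀ (by positivity)
    rw [one_div, inv_inv] at h1
    exact h1.congr fun i => inv_div _ _
  have h2 := (h.tendsto_sub_div_recipHazard hy hy' hw hlim').div_const t
  rw [Kfun_KfunInv h1t, div_self ht0.ne'] at h2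
  refine h2.congr fun i => ?_
  field_simp
  ring

theorem tendsto_genInv (h : IsVonMisesTail F γ y0) {β : ι → ℝ} (hβ : Tendsto β l (𝓝 0))
    (hpos : ∀ᶠ i in l, 0 < β i) :
    (∀ᶠ i in l, F (genInv F (β i)) = β i) ∧
      Tendsto (fun i => genInv F (β i)) l (toEndpoint F) := by
  have h1 : ∀ᶠ i in l, F (genInv F (β i)) = β i := by
    filter_upwards [hpos, hβ.eventually_lt_const one_pos,
      hβ.eventually_lt_const h.region.pos] with i h1 h2 h3
    exact h.region.F_genInv h.surv h.tendsto_zero h1 h2 h3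
  refine ⟨h1, h.surv.tendsto_toEndpoint (hβ.congr' (h1.mono fun i hi => hi.symm)) ?_⟩
  filter_upwards [h1, hpos] with i h2 h3
  rwa [h2]

/-- Nothing ensures beforehand that t stays in the regular region, so the mean value theorem is not
available. Instead t is compared with the points u where F(u) = F(y)/w: there (u - y)/m(y) → K_γ(w),
which has the sign of w - 1, and monotonicity of F bounds F(t) by F(y)/w on the appropriate side. -/
theorem tendsto_div_of_sub_div (h : IsVonMisesTail F γ y0) (hy : Tendsto y l (toEndpoint F))
    {t : ι → ℝ} (ht : Tendsto (fun i => (t i - y i) / recipHazard F (y i)) l (𝓝 0)) :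
    Tendsto (fun i => F (t i) / F (y i)) l (𝓝 1) := by
  have hmem := h.eventually_mem hy
  have key : ∀ w : ℝ, 0 < w → ∃ u : ι → ℝ, (∀ᶠ i in l, F (u i) = F (y i) / w) ∧
      Tendsto (fun i => (u i - y i) / recipHazard F (y i)) l (𝓝 (Kfun γ w)) := by
    intro w hw
    have h0 : Tendsto (fun i => F (y i) / w) l (𝓝 0) := by
      simpa using (h.tendsto_zero.comp hy).div_const w
    obtain ⟨h1, h2⟩ := h.tendsto_genInv h0 (hmem.mono fun i hi => div_pos hi.2 hw)
    refine ⟨_, h1, h.tendsto_sub_div_recipHazard hy h2 hw ?_⟩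
    refine tendsto_const_nhds.congr' ?_
    filter_upwards [h1, hmem] with i h3 h4
    have := h4.2.ne'
    rw [h3]
    field_simp
  have hcont : Tendsto (fun w : ℝ => 1 / w) (𝓝 1) (𝓝 1) := by
    simpa using (tendsto_inv₀ (one_ne_zero (α := ℝ)))
  refine tendsto_order.2 ⟨fun c hc => ?_, fun c hc => ?_⟩
  · obtain ⟨w, hw, hw1⟩ := (((hcont.mono_left nhdsWithin_le_nhds).eventually_const_lt hc).and
      (self_mem_nhdsWithin (s := Set.Ioi (1 : ℝ)))).exists
    have hw1 : 1 < w := hw1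
    obtain ⟨u, hu, hu'⟩ := key w (one_pos.trans hw1)
    filter_upwards [hmem, hu, ht.eventually_lt hu' (Kfun_pos hw1)] with i h1 h2 h3
    rw [div_lt_div_iff_of_pos_right (h.region.recipHazard_pos h1.1 h1.2)] at h3
    have h4 := h.surv.anti (sub_lt_sub_iff_right _ |>.1 h3).le
    rw [h2] at h4
    rw [lt_div_iff₀ h1.2]
    calc c * F (y i) < 1 / w * F (y i) := mul_lt_mul_of_pos_right hw h1.2
      _ = F (y i) / w := by ring
      _ ≤ _ := h4
  · obtain ⟨w, ⟨hw, hw0⟩, hw1⟩ := ((((hcont.mono_left nhdsWithin_le_nhds).eventually_lt_const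
      hc).and (nhdsWithin_le_nhds (lt_mem_nhds (zero_lt_one (α := ℝ))))).and
      (self_mem_nhdsWithin (s := Set.Iio (1 : ℝ)))).exists
    have hw1 : w < 1 := hw1
    have hw0 : 0 < w := hw0
    obtain ⟨u, hu, hu'⟩ := key w hw0
    filter_upwards [hmem, hu, hu'.eventually_lt ht (Kfun_neg hw0 hw1)] with i h1 h2 h3
    rw [div_lt_div_iff_of_pos_right (h.region.recipHazard_pos h1.1 h1.2)] at h3
    have h4 := h.surv.anti (sub_lt_sub_iff_right _ |>.1 h3).le
    rw [h2] at h4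
    rw [div_lt_iff₀ h1.2]
    calc F (t i) ≤ F (y i) / w := h4
      _ = 1 / w * F (y i) := by ring
      _ < _ := mul_lt_mul_of_pos_right hw h1.2

theorem tendsto_toEndpoint_of_div (h : IsVonMisesTail F γ y0) (hy : Tendsto y l (toEndpoint F))
    {t : ι → ℝ} (ht : Tendsto (fun i => F (t i) / F (y i)) l (𝓝 1)) :
    Tendsto t l (toEndpoint F) := by
  have hmem := h.eventually_mem hy
  refine h.surv.tendsto_toEndpoint ?_ ?_
  · have h1 := ht.mul (h.tendsto_zero.comp hy)
    rw [mul_zero] at h1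
    refine h1.congr' ?_
    filter_upwards [hmem] with i hi
    exact div_mul_cancel₀ _ hi.2.ne'
  · filter_upwards [hmem, ht.eventually_const_lt one_pos] with i h1 h2
    exact (div_pos_iff_of_pos_right h1.2).1 h2

/-- Once F(t)/F(y) → 1 is known, t is in the regular region and F(t) - F(y) = -(F(ξ)/m(ξ)) (t - y),
where F(ξ)/F(y) and m(y)/m(ξ) both tend to 1. -/
theorem tendsto_mul_div_sub_one (h : IsVonMisesTail F γ y0) (hy : Tendsto y l (toEndpoint F))
    {t v : ι → ℝ} (hv : Tendsto v l atTop) {d : ℝ}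
    (ht : Tendsto (fun i => v i * ((t i - y i) / recipHazard F (y i))) l (𝓝 d)) :
    Tendsto t l (toEndpoint F) ∧
      Tendsto (fun i => v i * (F (t i) / F (y i) - 1)) l (𝓝 (-d)) := by
  have hmem := h.eventually_mem hy
  have ht0 : Tendsto (fun i => (t i - y i) / recipHazard F (y i)) l (𝓝 0) := by
    have h1 := hv.inv_tendsto_atTop.mul ht
    rw [zero_mul] at h1
    refine h1.congr' ?_
    filter_upwards [hv.eventually_gt_atTop 0] with i hi
    simp only [Pi.inv_apply]
    field_simp
  have h1 := h.tendsto_div_of_sub_div hy ht0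
  have htt := h.tendsto_toEndpoint_of_div hy h1
  refine ⟨htt, ?_⟩
  have hex : ∀ᶠ i in l, ∃ z, z ∈ Set.uIcc (y i) (t i) ∧
      F (t i) - F (y i) = -(F z / recipHazard F z * (t i - y i)) := by
    filter_upwards [hmem, h.eventually_mem htt] with i h1 h2
    exact h.region.exists_sub_eq_neg_mul h.surv h1.1 h1.2 h2.1 h2.2
  obtain ⟨ξ, hξ⟩ := exists_forall_eventually hex
  have hξt := h.tendsto_of_mem_uIcc hy htt (hξ.mono fun i hi => hi.1)
  have hξF : Tendsto (fun i => F (ξ i) / F (y i)) l (𝓝 1) := by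
    have hmin : Tendsto (fun i => min 1 (F (t i) / F (y i))) l (𝓝 1) := by
      simpa using (tendsto_const_nhds (x := (1 : ℝ))).min h1
    have hmax : Tendsto (fun i => max 1 (F (t i) / F (y i))) l (𝓝 1) := by
      simpa using (tendsto_const_nhds (x := (1 : ℝ))).max h1
    have hin : ∀ᶠ i in l, F (ξ i) / F (y i) ∈ Set.uIcc 1 (F (t i) / F (y i)) := by
      filter_upwards [hmem, h.eventually_mem htt, hξ] with i h1 h2 h3
      obtain ⟨-, -, h6⟩ := IsTailRegion.of_mem_uIcc h.surv h1.1 h1.2 h2.1 h2.2 h3.1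
      rw [Set.mem_uIcc] at h6 ⊢
      rw [le_div_iff₀ h1.2, div_le_one h1.2, one_mul, div_le_div_iff_of_pos_right h1.2,
        div_le_div_iff_of_pos_right h1.2]
      exact h6
    exact tendsto_of_tendsto_of_tendsto_of_le_of_le' hmin hmax
      (hin.mono fun i hi => hi.1) (hin.mono fun i hi => hi.2)
  have hm : Tendsto (fun i => recipHazard F (y i) / recipHazard F (ξ i)) l (𝓝 1) := by
    simpa using h.tendsto_recipHazard_div hξt hy one_pos hξF
  have h2 := ((hξF.mul hm).mul ht).neg
  rw [one_mul, one_mul] at h2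
  refine h2.congr' ?_
  filter_upwards [hmem, hξ, h.eventually_mem hξt] with i h1 h3 h4
  have e : F (t i) / F (y i) - 1 = (F (t i) - F (y i)) / F (y i) := by
    rw [sub_div, div_self h1.2.ne']
  have m1 := (h.region.recipHazard_pos h1.1 h1.2).ne'
  have m2 := (h.region.recipHazard_pos h4.1 h4.2).ne'
  have m3 := h1.2.ne'
  rw [e, h3.2]
  field_simp

/-- Local linearization of `F` at an extreme quantile, on the scale of the auxiliary function. -/
theorem tendsto_linearization (h : IsVonMisesTail F γ y0) {a : ℝ → ℝ} (ha : IsAuxiliary F γ a)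
    {α v : ι → ℝ} (hα : Tendsto α l (𝓝 0)) (hαpos : ∀ᶠ i in l, 0 < α i)
    (hv : Tendsto v l atTop) {τ : ℝ} (hτ : 0 < τ) (z : ℝ) :
    Tendsto (fun i => genInv F (τ * α i) + z * (a (genInv F (α i)) / v i)) l (toEndpoint F) ∧
      Tendsto (fun i => v i *
        (F (genInv F (τ * α i) + z * (a (genInv F (α i)) / v i)) / (τ * α i) - 1)) l
        (𝓝 (-(z * τ ^ γ))) := by
  obtain ⟨e1, t1⟩ := h.tendsto_genInv hα hαpos
  have hτα : Tendsto (fun i => τ * α i) l (𝓝 0) := by simpa using hα.const_mul τ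
  obtain ⟨e2, t2⟩ := h.tendsto_genInv hτα (hαpos.mono fun i hi => mul_pos hτ hi)
  have hr : Tendsto (fun i => F (genInv F (τ * α i)) / F (genInv F (α i))) l (𝓝 τ) := by
    refine tendsto_const_nhds.congr' ?_
    filter_upwards [e1, e2, hαpos] with i h1 h2 h3
    rw [h1, h2, mul_div_cancel_right₀ _ h3.ne']
  -- Changing the scale from a(q(α)) to m(q(τα)) produces the factor m(q(α))/m(q(τα)) → τ^γ.
  have hd := ((h.tendsto_auxiliary_div ha t1).mul
    (h.tendsto_recipHazard_div t2 t1 hτ hr)).const_mul z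
  rw [one_mul] at hd
  obtain ⟨h1, h2⟩ := h.tendsto_mul_div_sub_one t2 hv
    (t := fun i => genInv F (τ * α i) + z * (a (genInv F (α i)) / v i)) (hd.congr' (by
      filter_upwards [h.eventually_mem t1, h.eventually_mem t2, hv.eventually_gt_atTop 0]
        with i h1 h2 h3
      have m1 := (h.region.recipHazard_pos h1.1 h1.2).ne'
      have m2 := (h.region.recipHazard_pos h2.1 h2.2).ne'
      field_simp
      ring))
  refine ⟨h1, h2.congr' ?_⟩
  filter_upwards [e2] with i hi
  rw [hi]

end IsVonMisesTail

/-! ### Row sums of triangular arrays -/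

/-- Independent random elements with common law `ν`. -/
structure IsIIDSample {Ω S : Type*} [MeasurableSpace Ω] [MeasurableSpace S] (P : Measure Ω)
    (ν : Measure S) (ζ : ℕ → Ω → S) : Prop where
  measurable : ∀ i, Measurable (ζ i)
  indep : iIndepFun ζ P
  map_eq : ∀ i, P.map (ζ i) = ν

namespace IsIIDSample

variable {Ω S : Type*} [MeasurableSpace Ω] [MeasurableSpace S] {P : Measure Ω}
  {ν : Measure S} {ζ : ℕ → Ω → S}

theorem integral_exp_sum (h : IsIIDSample P ν ζ) {f : S → ℝ} (hf : Measurable f) (n : ℕ) :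
    ∫ ω, Complex.exp (Complex.I * ((∑ i ∈ Finset.range n, f (ζ i ω) : ℝ) : ℂ)) ∂P =
      (∫ s, Complex.exp (Complex.I * f s) ∂ν) ^ n := by
  have hm : Measurable fun s => Complex.exp (Complex.I * (f s : ℂ)) := by fun_prop
  have h1 := (h.indep.precomp (Fin.val_injective (n := n))).integral_fun_prod_comp
    (f := fun _ s => Complex.exp (Complex.I * (f s : ℂ)))
    (fun i => (h.measurable i).aemeasurable) (fun i => hm.aestronglyMeasurable)
  have h2 : ∀ i : ℕ, ∫ ω, Complex.exp (Complex.I * (f (ζ i ω) : ℂ)) ∂P =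
      ∫ s, Complex.exp (Complex.I * f s) ∂ν := fun i => by
    rw [← h.map_eq i, integral_map (h.measurable i).aemeasurable hm.aestronglyMeasurable]
  simp only [h2, Finset.prod_const, Finset.card_univ, Fintype.card_fin] at h1
  rw [← h1]
  congr 1
  ext ω
  rw [← Complex.exp_sum, Finset.sum_range, ← Finset.mul_sum]
  push_cast
  rfl

variable [IsProbabilityMeasure P]

theorem isProbabilityMeasure (h : IsIIDSample P ν ζ) : IsProbabilityMeasure ν := by
  rw [← h.map_eq 0]
  exact Measure.isProbabilityMeasure_map (h.measurable 0).aemeasurable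

theorem memLp (h : IsIIDSample P ν ζ) {f : S → ℝ} (hf : Measurable f) {B : ℝ}
    (hB : ∀ s, |f s| ≤ B) (i : ℕ) : MemLp (fun ω => f (ζ i ω)) 2 P :=
  MemLp.of_bound (hf.comp (h.measurable i)).aestronglyMeasurable B
    (Eventually.of_forall fun _ => hB _)

theorem integral_sum (h : IsIIDSample P ν ζ) {f : S → ℝ} (hf : Measurable f) {B : ℝ}
    (hB : ∀ s, |f s| ≤ B) (n : ℕ) :
    ∫ ω, ∑ i ∈ Finset.range n, f (ζ i ω) ∂P = n * ∫ s, f s ∂ν := by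
  rw [integral_finsetSum _ fun i _ => (h.memLp hf hB i).integrable (by norm_num)]
  have : ∀ i, ∫ ω, f (ζ i ω) ∂P = ∫ s, f s ∂ν := fun i => by
    rw [← h.map_eq i, integral_map (h.measurable i).aemeasurable hf.aestronglyMeasurable]
  simp [this]

theorem variance_sum_le (h : IsIIDSample P ν ζ) {f : S → ℝ} (hf : Measurable f) {B : ℝ}
    (hB : ∀ s, |f s| ≤ B) (n : ℕ) :
    Var[fun ω => ∑ i ∈ Finset.range n, f (ζ i ω); P] ≤ n * ∫ s, f s ^ 2 ∂ν := by
  have h1 : (fun ω => ∑ i ∈ Finset.range n, f (ζ i ω)) =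
      ∑ i ∈ Finset.range n, fun ω => f (ζ i ω) := by
    ext ω
    simp
  rw [h1, IndepFun.variance_sum (fun i _ => h.memLp hf hB i)]
  · have h2 : ∀ i, Var[fun ω => f (ζ i ω); P] ≤ ∫ s, f s ^ 2 ∂ν := fun i => by
      refine (variance_le_expectation_sq (h.memLp hf hB i).aestronglyMeasurable).trans_eq ?_
      rw [← h.map_eq i, integral_map (h.measurable i).aemeasurable
        (hf.pow_const 2).aestronglyMeasurable]
      rfl
    refine (Finset.sum_le_sum fun i _ => h2 i).trans_eq ?_
    simp
  · intro i _ j _ hij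
    exact (h.indep.indepFun hij).comp hf hf

theorem chebyshev (h : IsIIDSample P ν ζ) {f : S → ℝ} (hf : Measurable f) {B : ℝ}
    (hB : ∀ s, |f s| ≤ B) (n : ℕ) {c : ℝ} (hc : 0 < c) :
    P.real {ω | c ≤ |∑ i ∈ Finset.range n, f (ζ i ω) - n * ∫ s, f s ∂ν|} ≤
      (n * ∫ s, f s ^ 2 ∂ν) / c ^ 2 := by
  have h1 : MemLp (fun ω => ∑ i ∈ Finset.range n, f (ζ i ω)) 2 P :=
    memLp_finsetSum _ fun i _ => h.memLp hf hB i
  have h2 := meas_ge_le_variance_div_sq h1 hc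
  rw [h.integral_sum hf hB] at h2
  refine (ENNReal.toReal_le_of_le_ofReal ?_ h2).trans ?_
  · exact div_nonneg (variance_nonneg _ _) (sq_nonneg _)
  · exact div_le_div_of_nonneg_right (h.variance_sum_le hf hB n) (sq_nonneg _)

/-- Row sums with converging means and vanishing second moments converge in probability. -/
theorem tendsto_measureReal_sum (h : IsIIDSample P ν ζ) {f : ℕ → S → ℝ}
    (hf : ∀ n, Measurable (f n)) {B : ℕ → ℝ} (hB : ∀ n s, |f n s| ≤ B n) {m : ℝ}
    (hm : Tendsto (fun n : ℕ => n * ∫ s, f n s ∂ν) atTop (𝓝 m))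
    (hs : Tendsto (fun n : ℕ => n * ∫ s, f n s ^ 2 ∂ν) atTop (𝓝 0)) {ε : ℝ} (hε : 0 < ε) :
    Tendsto (fun n => P.real {ω | ε ≤ |∑ i ∈ Finset.range n, f n (ζ i ω) - m|}) atTop (𝓝 0) := by
  have h1 := hs.div_const ((ε / 2) ^ 2)
  rw [zero_div] at h1
  refine squeeze_zero' (Eventually.of_forall fun n => measureReal_nonneg) ?_ h1
  have h2 : ∀ᶠ n : ℕ in atTop, |n * ∫ s, f n s ∂ν - m| < ε / 2 := by
    have := (hm.sub_const m).abs
    rw [sub_self, abs_zero] at this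
    exact this.eventually_lt_const (half_pos hε)
  filter_upwards [h2] with n hn
  refine (measureReal_mono fun ω hω => ?_).trans (h.chebyshev (hf n) (hB n) n (half_pos hε))
  have hω : ε ≤ |∑ i ∈ Finset.range n, f n (ζ i ω) - m| := hω
  have h3 := abs_sub_le (∑ i ∈ Finset.range n, f n (ζ i ω)) (n * ∫ s, f n s ∂ν) m
  show ε / 2 ≤ |∑ i ∈ Finset.range n, f n (ζ i ω) - n * ∫ s, f n s ∂ν|
  linarith

/-- Row sums with converging means and second moments are tight. -/
theorem exists_measureReal_sum_le (h : IsIIDSample P ν ζ) {f : ℕ → S → ℝ}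
    (hf : ∀ n, Measurable (f n)) {B : ℕ → ℝ} (hB : ∀ n s, |f n s| ≤ B n) {m σ : ℝ}
    (hm : Tendsto (fun n : ℕ => n * ∫ s, f n s ∂ν) atTop (𝓝 m))
    (hs : Tendsto (fun n : ℕ => n * ∫ s, f n s ^ 2 ∂ν) atTop (𝓝 σ)) {δ : ℝ} (hδ : 0 < δ) :
    ∃ M, ∀ᶠ n in atTop, P.real {ω | M ≤ |∑ i ∈ Finset.range n, f n (ζ i ω)|} ≤ δ := by
  -- Since c ≥ 1, c² ≥ c ≥ (|σ| + 1)/δ, which brings the Chebyshev bound below δ.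
  set c : ℝ := (|σ| + 1) / δ + 1 with hc
  have hc1 : 1 ≤ c := by
    have : 0 ≤ (|σ| + 1) / δ := by positivity
    linarith
  refine ⟨|m| + 1 + c, ?_⟩
  filter_upwards [hm.abs.eventually_lt_const (lt_add_one |m|),
    hs.eventually_lt_const (lt_of_le_of_lt (le_abs_self σ) (lt_add_one |σ|))] with n h1 h2
  refine (measureReal_mono fun ω hω => ?_).trans
    ((h.chebyshev (hf n) (hB n) n (c := c) (by linarith)).trans ?_)
  · have hω : |m| + 1 + c ≤ |∑ i ∈ Finset.range n, f n (ζ i ω)| := hω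
    have h3 := abs_sub_abs_le_abs_sub (∑ i ∈ Finset.range n, f n (ζ i ω)) (n * ∫ s, f n s ∂ν)
    show c ≤ |∑ i ∈ Finset.range n, f n (ζ i ω) - n * ∫ s, f n s ∂ν|
    linarith
  · rw [div_le_iff₀ (by positivity)]
    have h4 : |σ| + 1 ≤ δ * c := by
      rw [hc, mul_add, mul_div_cancel₀ _ hδ.ne']
      linarith
    have h5 : c ≤ c ^ 2 := by nlinarith
    nlinarith

/-- Second order Taylor bound for the characteristic function of a small random variable. -/
theorem norm_integral_exp_sub_le [IsProbabilityMeasure ν] {f : S → ℝ} (hf : Measurable f)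
    {B : ℝ} (hB1 : B ≤ 1) (hB : ∀ s, |f s| ≤ B) :
    ‖∫ s, Complex.exp (Complex.I * f s) ∂ν -
      (1 + Complex.I * ((∫ s, f s ∂ν : ℝ) : ℂ) - ((∫ s, f s ^ 2 ∂ν : ℝ) : ℂ) / 2)‖ ≤
      B * ∫ s, f s ^ 2 ∂ν := by
  have i1 : Integrable (fun s => (f s : ℂ)) ν :=
    Integrable.of_bound (Complex.measurable_ofReal.comp hf).aestronglyMeasurable B
      (Eventually.of_forall fun s => by simpa using hB s)
  have i2 : Integrable (fun s => f s ^ 2) ν :=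
    Integrable.of_bound (hf.pow_const 2).aestronglyMeasurable (B ^ 2)
      (Eventually.of_forall fun s => by
        rw [norm_pow, Real.norm_eq_abs]
        exact pow_le_pow_left₀ (abs_nonneg _) (hB s) 2)
  have i3 : Integrable (fun s => Complex.exp (Complex.I * f s)) ν :=
    Integrable.of_bound (by fun_prop) 1 (Eventually.of_forall fun s => by
      rw [mul_comm, Complex.norm_exp_ofReal_mul_I])
  have i4 : Integrable (fun s => ((f s ^ 2 : ℝ) : ℂ)) ν := i2.ofReal
  have e : ∫ s, Complex.exp (Complex.I * f s) ∂ν -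
      (1 + Complex.I * ((∫ s, f s ∂ν : ℝ) : ℂ) - ((∫ s, f s ^ 2 ∂ν : ℝ) : ℂ) / 2) =
      ∫ s, (Complex.exp (Complex.I * f s) -
        (1 + Complex.I * f s - ((f s ^ 2 : ℝ) : ℂ) / 2)) ∂ν := by
    have i5 : Integrable (fun s => 1 + Complex.I * (f s : ℂ)) ν :=
      (integrable_const _).add (i1.const_mul _)
    have i6 : Integrable (fun s => 1 + Complex.I * (f s : ℂ) - ((f s ^ 2 : ℝ) : ℂ) / 2) ν :=
      i5.sub (i4.div_const 2)
    rw [integral_sub i3 i6, integral_sub i5 (i4.div_const 2),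
      integral_add (integrable_const _) (i1.const_mul _), integral_const_mul, integral_div,
      integral_complex_ofReal, integral_complex_ofReal]
    simp
  rw [e, ← integral_const_mul]
  refine norm_integral_le_of_norm_le (i2.const_mul B) (Eventually.of_forall fun s => ?_)
  have hx : ‖Complex.I * (f s : ℂ)‖ = |f s| := by simp
  -- The third order remainder bound requires |f| ≤ 1. Its constant 4/(3!·3) is below 1, and one
  -- factor |f| is bounded by B.
  have hb := Complex.exp_bound (x := Complex.I * f s) (hx.trans_le ((hB s).trans hB1))
    (n := 3) (by norm_num)
  rw [hx] at hb
  have e2 : ∑ m ∈ Finset.range 3, (Complex.I * (f s : ℂ)) ^ m / (m.factorial : ℂ) =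
      1 + Complex.I * f s - ((f s ^ 2 : ℝ) : ℂ) / 2 := by
    simp [Finset.sum_range_succ, mul_pow, Nat.factorial]
    ring
  rw [e2] at hb
  refine hb.trans ?_
  norm_num [Nat.factorial]
  have h1 : |f s| ^ 3 = |f s| * f s ^ 2 := by rw [← sq_abs (f s)]; ring
  rw [h1]
  have h2 : |f s| * f s ^ 2 ≤ B * f s ^ 2 := mul_le_mul_of_nonneg_right (hB s) (sq_nonneg _)
  have h3 : 0 ≤ |f s| * f s ^ 2 := by positivity
  linarith

/-- Central limit theorem for row sums of uniformly small variables, in terms of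
characteristic functions. -/
theorem tendsto_integral_exp_sum (h : IsIIDSample P ν ζ) {f : ℕ → S → ℝ}
    (hf : ∀ n, Measurable (f n)) {B : ℕ → ℝ} (hB : ∀ n s, |f n s| ≤ B n)
    (hB0 : Tendsto B atTop (𝓝 0)) {m σ : ℝ}
    (hm : Tendsto (fun n : ℕ => n * ∫ s, f n s ∂ν) atTop (𝓝 m))
    (hs : Tendsto (fun n : ℕ => n * ∫ s, f n s ^ 2 ∂ν) atTop (𝓝 σ)) :
    Tendsto (fun n => ∫ ω, Complex.exp (Complex.I *
      ((∑ i ∈ Finset.range n, f n (ζ i ω) : ℝ) : ℂ)) ∂P) atTop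
      (𝓝 (Complex.exp (Complex.I * m - σ / 2))) := by
  have := h.isProbabilityMeasure
  -- With φ the characteristic function of one summand, n(φ - 1) differs from i n∫f - n∫f²/2 by at
  -- most B n∫f², a vanishing factor times a convergent one. Then φ^n = (1 + n(φ - 1)/n)^n tends to
  -- the exponential of the limit.
  have key : Tendsto (fun n : ℕ => (n : ℂ) * (∫ s, Complex.exp (Complex.I * f n s) ∂ν - 1))
      atTop (𝓝 (Complex.I * m - σ / 2)) := by
    have h1 : Tendsto (fun n : ℕ => Complex.I * ((n * ∫ s, f n s ∂ν : ℝ) : ℂ) -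
        ((n * ∫ s, f n s ^ 2 ∂ν : ℝ) : ℂ) / 2) atTop (𝓝 (Complex.I * m - σ / 2)) :=
      (((Complex.continuous_ofReal.tendsto _).comp hm).const_mul _).sub
        (((Complex.continuous_ofReal.tendsto _).comp hs).div_const 2)
    have h2 := hB0.mul hs
    rw [zero_mul] at h2
    have h3 : Tendsto (fun n : ℕ => (n : ℂ) * (∫ s, Complex.exp (Complex.I * f n s) ∂ν - 1) -
        (Complex.I * ((n * ∫ s, f n s ∂ν : ℝ) : ℂ) -
          ((n * ∫ s, f n s ^ 2 ∂ν : ℝ) : ℂ) / 2)) atTop (𝓝 0) := by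
      refine squeeze_zero_norm' ?_ h2
      filter_upwards [hB0.eventually_le_const one_pos] with n hn
      have h4 := norm_integral_exp_sub_le (ν := ν) (hf n) hn (hB n)
      calc _ = ‖(n : ℂ) * (∫ s, Complex.exp (Complex.I * f n s) ∂ν -
              (1 + Complex.I * ((∫ s, f n s ∂ν : ℝ) : ℂ) -
                ((∫ s, f n s ^ 2 ∂ν : ℝ) : ℂ) / 2))‖ := by
            congr 1
            push_cast
            ring
        _ ≤ n * (B n * ∫ s, f n s ^ 2 ∂ν) := by
            rw [norm_mul, Complex.norm_natCast]
            exact mul_le_mul_of_nonneg_left h4 (Nat.cast_nonneg n)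
        _ = _ := by ring
    simpa using h3.add h1
  refine (Complex.tendsto_one_add_pow_exp_of_tendsto key).congr fun n => ?_
  rw [h.integral_exp_sum (hf n)]
  congr 1
  ring

end IsIIDSample

/-! ### Local limits and kernel smoothing -/

section Local

variable {p : ℕ}

/-- The filter of pairs `(n, u)` with `n → ∞` and `u` in the ball of radius `h n` around `x`. -/
def localFilter (x : EuclideanSpace ℝ (Fin p)) (h : ℕ → ℝ) :
    Filter (ℕ × EuclideanSpace ℝ (Fin p)) :=
  comap Prod.fst atTop ⊓ 𝓟 {z | z.2 ∈ Metric.ball x (h z.1)}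

variable {x : EuclideanSpace ℝ (Fin p)} {h : ℕ → ℝ}

/-- Limits along this filter are limits in n that are uniform over the shrinking balls. -/
theorem eventually_localFilter {q : ℕ × EuclideanSpace ℝ (Fin p) → Prop} :
    (∀ᶠ z in localFilter x h, q z) ↔ ∀ᶠ n in atTop, ∀ u ∈ Metric.ball x (h n), q (n, u) := by
  rw [localFilter, eventually_inf_principal, eventually_comap]
  refine eventually_congr (Eventually.of_forall fun n => ⟨fun H u hu => H (n, u) rfl hu, ?_⟩)
  rintro H ⟨m, u⟩ rfl hu
  exact H u hu

theorem tendsto_fst_localFilter : Tendsto Prod.fst (localFilter x h) atTop :=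
  tendsto_comap.mono_left inf_le_left

theorem tendsto_snd_localFilter (hh : Tendsto h atTop (𝓝 0)) :
    Tendsto Prod.snd (localFilter x h) (𝓝 x) := by
  refine Metric.tendsto_nhds.2 fun ε hε => eventually_localFilter.2 ?_
  filter_upwards [hh.eventually_lt_const hε] with n hn u hu
  exact (Metric.mem_ball.1 hu).trans hn

theorem integral_scaled_mul (x : EuclideanSpace ℝ (Fin p)) {r : ℝ} (hr : 0 < r)
    (Ψ φ : EuclideanSpace ℝ (Fin p) → ℝ) :
    ∫ u, Ψ (r⁻¹ • (x - u)) * φ u = r ^ p * ∫ v, Ψ v * φ (x - r • v) := by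
  have h1 := integral_sub_left_eq_self (fun w => Ψ (r⁻¹ • w) * φ (x - w)) volume x
  simp only [sub_sub_cancel] at h1
  have h2 := Measure.integral_comp_inv_smul_of_nonneg (volume : Measure (EuclideanSpace ℝ (Fin p)))
    (fun v => Ψ v * φ (x - r • v)) hr.le
  simp only [smul_inv_smul₀ hr.ne', finrank_euclideanSpace, Fintype.card_fin, smul_eq_mul] at h2
  rw [h1, h2]

/-- Smoothing of locally converging functions by a nonnegative integrable weight. -/
theorem tendsto_integral_scaled_mul (hpos : ∀ n, 0 < h n)
    {Ψ : EuclideanSpace ℝ (Fin p) → ℝ} (hΨ : Integrable Ψ) (hΨ0 : ∀ u, 0 ≤ Ψ u)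
    (hsupp : Function.support Ψ ⊆ Metric.closedBall 0 1)
    {φ : ℕ → EuclideanSpace ℝ (Fin p) → ℝ} (hφ : ∀ n, Measurable (φ n)) {c : ℝ}
    (hlim : Tendsto (fun z => φ z.1 z.2) (localFilter x h) (𝓝 c)) :
    Tendsto (fun n => (h n ^ p)⁻¹ * ∫ u, Ψ ((h n)⁻¹ • (x - u)) * φ n u) atTop
      (𝓝 (c * ∫ u, Ψ u)) := by
  -- The weight is supported in the closed ball whereas the local limit concerns open balls; the
  -- sphere is a null set.
  have hball : ∀ᵐ v : EuclideanSpace ℝ (Fin p), Ψ v ≠ 0 → v ∈ Metric.ball 0 1 := by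
    have h0 := Measure.addHaar_sphere_of_ne_zero
      (volume : Measure (EuclideanSpace ℝ (Fin p))) 0 one_ne_zero
    filter_upwards [compl_mem_ae_iff.2 h0] with v hv hv0
    have h1 := hsupp hv0
    rw [← Metric.ball_union_sphere] at h1
    exact h1.resolve_right hv
  have e : ∀ n, (h n ^ p)⁻¹ * ∫ u, Ψ ((h n)⁻¹ • (x - u)) * φ n u =
      ∫ v, Ψ v * φ n (x - h n • v) := fun n => by
    rw [integral_scaled_mul x (hpos n), inv_mul_cancel_left₀ (pow_pos (hpos n) p).ne']
  simp only [e]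
  rw [Metric.tendsto_nhds]
  intro ε hε
  have hI0 : 0 ≤ ∫ u, Ψ u := integral_nonneg hΨ0
  set δ := ε / (2 * ((∫ u, Ψ u) + 1)) with hδ
  have hδ0 : 0 < δ := by positivity
  filter_upwards [eventually_localFilter.1 (Metric.tendsto_nhds.1 hlim δ hδ0)] with n hn
  have hb : ∀ᵐ v : EuclideanSpace ℝ (Fin p), |Ψ v * φ n (x - h n • v) - c * Ψ v| ≤ δ * Ψ v := by
    filter_upwards [hball] with v hv
    by_cases h0 : Ψ v = 0
    · simp [h0]
    · have h1 : x - h n • v ∈ Metric.ball x (h n) := by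
        have h2 := mem_ball_zero_iff.1 (hv h0)
        rw [mem_ball_iff_norm, sub_sub_cancel_left, norm_neg, norm_smul, Real.norm_eq_abs,
          abs_of_pos (hpos n)]
        exact mul_lt_of_lt_one_right (hpos n) h2
      have h3 := hn _ h1
      rw [Real.dist_eq] at h3
      rw [show Ψ v * φ n (x - h n • v) - c * Ψ v = (φ n (x - h n • v) - c) * Ψ v by ring, abs_mul,
        abs_of_nonneg (hΨ0 v)]
      exact mul_le_mul_of_nonneg_right h3.le (hΨ0 v)
  have hmeas : AEStronglyMeasurable (fun v => Ψ v * φ n (x - h n • v)) volume :=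
    hΨ.aestronglyMeasurable.mul ((hφ n).comp (by fun_prop)).aestronglyMeasurable
  -- Integrability is drawn from the pointwise bound, since φ is controlled only where the weight is
  -- nonzero.
  have hi2 : Integrable (fun v => Ψ v * φ n (x - h n • v) - c * Ψ v) :=
    (hΨ.const_mul δ).mono' (hmeas.sub (hΨ.aestronglyMeasurable.const_mul c)) hb
  have hi : Integrable (fun v => Ψ v * φ n (x - h n • v)) := by
    have := hi2.add (hΨ.const_mul c)
    refine this.congr (Eventually.of_forall fun v => ?_)
    simp
  rw [Real.dist_eq, ← integral_const_mul, ← integral_sub hi (hΨ.const_mul c)]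
  refine (norm_integral_le_of_norm_le (f := fun v => Ψ v * φ n (x - h n • v) - c * Ψ v)
    (hΨ.const_mul δ) hb).trans_lt ?_
  rw [integral_const_mul, hδ, div_mul_eq_mul_div, div_lt_iff₀ (by positivity)]
  nlinarith

namespace IsSmoothingKernel

variable {K : EuclideanSpace ℝ (Fin p) → ℝ}

theorem integrable (hK : IsSmoothingKernel K) : Integrable K := by
  by_contra hcon
  have := hK.integral_eq_one
  rw [integral_undef hcon] at this
  exact zero_ne_one this

theorem exists_bound (hK : IsSmoothingKernel K) : ∃ M : ℝ, 0 ≤ M ∧ ∀ u, |K u| ≤ M := by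
  obtain ⟨M, hM⟩ := hK.bounded
  exact ⟨M, (hK.nonneg 0).trans (hM 0), fun u => by rw [abs_of_nonneg (hK.nonneg u)]; exact hM u⟩

theorem integrable_sq (hK : IsSmoothingKernel K) : Integrable fun u => K u ^ 2 := by
  obtain ⟨M, -, hM⟩ := hK.exists_bound
  refine (hK.integrable.const_mul M).mono' (hK.measurable.pow_const 2).aestronglyMeasurable
    (Eventually.of_forall fun u => ?_)
  rw [norm_pow, Real.norm_eq_abs, sq, abs_of_nonneg (hK.nonneg u)]
  exact mul_le_mul_of_nonneg_right ((le_abs_self _).trans (hM u)) (hK.nonneg u)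

theorem tendsto_integral (hK : IsSmoothingKernel K) (hpos : ∀ n, 0 < h n)
    {φ : ℕ → EuclideanSpace ℝ (Fin p) → ℝ} (hφ : ∀ n, Measurable (φ n)) {c : ℝ}
    (hlim : Tendsto (fun z => φ z.1 z.2) (localFilter x h) (𝓝 c)) :
    Tendsto (fun n => (h n ^ p)⁻¹ * ∫ u, K ((h n)⁻¹ • (x - u)) * φ n u) atTop (𝓝 c) := by
  simpa [hK.integral_eq_one] using
    tendsto_integral_scaled_mul hpos hK.integrable hK.nonneg hK.support_subset hφ hlim

theorem tendsto_integral_sq (hK : IsSmoothingKernel K) (hpos : ∀ n, 0 < h n)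
    {φ : ℕ → EuclideanSpace ℝ (Fin p) → ℝ} (hφ : ∀ n, Measurable (φ n)) {c : ℝ}
    (hlim : Tendsto (fun z => φ z.1 z.2) (localFilter x h) (𝓝 c)) :
    Tendsto (fun n => (h n ^ p)⁻¹ * ∫ u, K ((h n)⁻¹ • (x - u)) ^ 2 * φ n u) atTop
      (𝓝 (c * ∫ u, K u ^ 2)) := by
  refine tendsto_integral_scaled_mul (Ψ := fun u => K u ^ 2) hpos hK.integrable_sq
    (fun u => sq_nonneg _) (fun u hu => hK.support_subset ?_) hφ hlim
  intro h0
  exact hu (by simp [h0])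

end IsSmoothingKernel

end Local

/-! ### Moments of kernel scores -/

section Score

variable {p : ℕ}

/-- The joint law of the covariate, with density `g`, and the response, with conditional
laws `Q`. -/
abbrev jointLaw (g : EuclideanSpace ℝ (Fin p) → ℝ) (Q : Kernel (EuclideanSpace ℝ (Fin p)) ℝ) :
    Measure (EuclideanSpace ℝ (Fin p) × ℝ) :=
  (volume.withDensity fun u => ENNReal.ofReal (g u)) ⊗ₘ Q

theorem integral_jointLaw {g : EuclideanSpace ℝ (Fin p) → ℝ} (hg : Measurable g)
    (hg0 : ∀ u, 0 ≤ g u) (Q : Kernel (EuclideanSpace ℝ (Fin p)) ℝ) [IsMarkovKernel Q]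
    {f : EuclideanSpace ℝ (Fin p) × ℝ → ℝ} (hf : Integrable f (jointLaw g Q)) :
    ∫ s, f s ∂(jointLaw g Q) = ∫ u, g u * ∫ y, f (u, y) ∂(Q u) := by
  rw [Measure.integral_compProd hf, integral_withDensity_eq_integral_toReal_smul
    (by fun_prop) (Eventually.of_forall fun u => ENNReal.ofReal_lt_top)]
  simp [ENNReal.toReal_ofReal (hg0 _)]

theorem measurable_condSurv (Q : Kernel (EuclideanSpace ℝ (Fin p)) ℝ) (t : ℝ) :
    Measurable fun u => condSurv Q u t :=
  (Q.measurable_coe measurableSet_Ioi).ennreal_toReal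

theorem integral_indicator_Ioi (Q : Kernel (EuclideanSpace ℝ (Fin p)) ℝ)
    (u : EuclideanSpace ℝ (Fin p)) (t : ℝ) :
    ∫ y, (Set.Ioi t).indicator (fun _ => (1 : ℝ)) y ∂(Q u) = condSurv Q u t :=
  integral_indicator_one measurableSet_Ioi

variable {ι : Type*} [Fintype ι]

/-- A linear combination of centered exceedance indicators. -/
def exceed (c t b : ι → ℝ) (y : ℝ) : ℝ :=
  ∑ j, c j * ((Set.Ioi (t j)).indicator (fun _ => (1 : ℝ)) y - b j)

theorem measurable_exceed (c t b : ι → ℝ) : Measurable (exceed c t b) :=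
  Finset.measurable_sum _ fun _ _ =>
    ((measurable_const.indicator measurableSet_Ioi).sub_const _).const_mul _

theorem abs_exceed_le (c t b : ι → ℝ) (y : ℝ) :
    |exceed c t b y| ≤ ∑ j, |c j| * (1 + |b j|) := by
  refine (Finset.abs_sum_le_sum_abs _ _).trans (Finset.sum_le_sum fun j _ => ?_)
  rw [abs_mul]
  refine mul_le_mul_of_nonneg_left ((abs_sub _ _).trans (add_le_add_left ?_ _)) (abs_nonneg _)
  by_cases hy : y ∈ Set.Ioi (t j) <;> simp [hy]

theorem integrable_indicator_Ioi (μ : Measure ℝ) [IsFiniteMeasure μ] (t : ℝ) :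
    Integrable (fun y => (Set.Ioi t).indicator (fun _ => (1 : ℝ)) y) μ :=
  (integrable_const 1).indicator measurableSet_Ioi

theorem integral_exceed (Q : Kernel (EuclideanSpace ℝ (Fin p)) ℝ) [IsMarkovKernel Q]
    (u : EuclideanSpace ℝ (Fin p)) (c t b : ι → ℝ) :
    ∫ y, exceed c t b y ∂(Q u) = ∑ j, c j * (condSurv Q u (t j) - b j) := by
  have hi : ∀ j, Integrable (fun y => (Set.Ioi (t j)).indicator (fun _ => (1 : ℝ)) y - b j)
      (Q u) := fun j => (integrable_indicator_Ioi _ _).sub (integrable_const _)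
  unfold exceed
  rw [integral_finsetSum _ fun j _ => (hi j).const_mul _]
  refine Finset.sum_congr rfl fun j _ => ?_
  rw [integral_const_mul, integral_sub (integrable_indicator_Ioi _ _) (integrable_const _),
    integral_indicator_Ioi]
  simp

/-- The product of two exceedance indicators is the indicator of exceeding the larger threshold, and
monotonicity turns survival at a maximum into a minimum of survivals. The covariance min(τ_j, τ_k)
originates here. -/
theorem integral_exceed_sq (Q : Kernel (EuclideanSpace ℝ (Fin p)) ℝ) [IsMarkovKernel Q]
    (u : EuclideanSpace ℝ (Fin p)) (c t b : ι → ℝ) :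
    ∫ y, exceed c t b y ^ 2 ∂(Q u) = ∑ j, ∑ k, c j * c k *
      (min (condSurv Q u (t j)) (condSurv Q u (t k)) - b j * condSurv Q u (t k)
        - b k * condSurv Q u (t j) + b j * b k) := by
  have hmul : ∀ s t y : ℝ, (Set.Ioi s).indicator (fun _ => (1 : ℝ)) y *
      (Set.Ioi t).indicator (fun _ => (1 : ℝ)) y =
      (Set.Ioi (max s t)).indicator (fun _ => (1 : ℝ)) y := by
    intro s t y
    by_cases h1 : s < y <;> by_cases h2 : t < y <;> simp [h1, h2]
  have hmin : ∀ s t, condSurv Q u (max s t) = min (condSurv Q u s) (condSurv Q u t) :=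
    fun s t => (isSurv_condSurv Q u).anti.map_max
  have hexp : ∀ y, exceed c t b y ^ 2 = ∑ j, ∑ k, c j * c k *
      ((Set.Ioi (max (t j) (t k))).indicator (fun _ => (1 : ℝ)) y
        - b j * (Set.Ioi (t k)).indicator (fun _ => (1 : ℝ)) y
        - b k * (Set.Ioi (t j)).indicator (fun _ => (1 : ℝ)) y + b j * b k) := by
    intro y
    rw [sq, exceed, Finset.sum_mul_sum]
    refine Finset.sum_congr rfl fun j _ => Finset.sum_congr rfl fun k _ => ?_
    rw [← hmul]
    ring
  simp only [hexp]
  have hi : ∀ j k, Integrable (fun y => (Set.Ioi (max (t j) (t k))).indicator (fun _ => (1 : ℝ)) y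
        - b j * (Set.Ioi (t k)).indicator (fun _ => (1 : ℝ)) y) (Q u) := fun j k =>
    (integrable_indicator_Ioi _ _).sub ((integrable_indicator_Ioi _ _).const_mul _)
  have hi2 : ∀ j k, Integrable (fun y =>
        (Set.Ioi (max (t j) (t k))).indicator (fun _ => (1 : ℝ)) y
        - b j * (Set.Ioi (t k)).indicator (fun _ => (1 : ℝ)) y
        - b k * (Set.Ioi (t j)).indicator (fun _ => (1 : ℝ)) y) (Q u) := fun j k =>
    (hi j k).sub ((integrable_indicator_Ioi _ _).const_mul _)
  have hi3 : ∀ j k, Integrable (fun y =>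
        (Set.Ioi (max (t j) (t k))).indicator (fun _ => (1 : ℝ)) y
        - b j * (Set.Ioi (t k)).indicator (fun _ => (1 : ℝ)) y
        - b k * (Set.Ioi (t j)).indicator (fun _ => (1 : ℝ)) y + b j * b k) (Q u) := fun j k =>
    (hi2 j k).add (integrable_const _)
  rw [integral_finsetSum _ fun j _ => integrable_finsetSum _ fun k _ => (hi3 j k).const_mul _]
  refine Finset.sum_congr rfl fun j _ => ?_
  rw [integral_finsetSum _ fun k _ => (hi3 j k).const_mul _]
  refine Finset.sum_congr rfl fun k _ => ?_
  rw [integral_const_mul, integral_add (hi2 j k) (integrable_const _),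
    integral_sub (hi j k) ((integrable_indicator_Ioi _ _).const_mul _),
    integral_sub (integrable_indicator_Ioi _ _) ((integrable_indicator_Ioi _ _).const_mul _),
    integral_const_mul, integral_const_mul, integral_indicator_Ioi, integral_indicator_Ioi,
    integral_indicator_Ioi, hmin]
  simp

end Score

/-- The effective rate `√(n h^p α)`. -/
def effRate (p : ℕ) (h α : ℕ → ℝ) (n : ℕ) : ℝ := Real.sqrt ((n : ℝ) * h n ^ p * α n)

/-- The regularity assumptions on the covariate density, the smoothing kernel, the bandwidth and
the order of the quantile. -/
structure IsSmoothingScheme {p : ℕ} (g : EuclideanSpace ℝ (Fin p) → ℝ)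
    (K : EuclideanSpace ℝ (Fin p) → ℝ) (h α : ℕ → ℝ) : Prop where
  continuous : Continuous g
  nonneg : ∀ u, 0 ≤ g u
  kernel : IsSmoothingKernel K
  bandwidth_pos : ∀ n, 0 < h n
  bandwidth_lim : Tendsto h atTop (𝓝 0)
  level_mem : ∀ n, α n ∈ Set.Ioo (0 : ℝ) 1
  rate : Tendsto (effRate p h α) atTop atTop

/-! ### Limits of the first two moments of the scores. -/

section

variable {p : ℕ} {ι : Type*} [Fintype ι]

/-- Kernel weighted and normalized exceedances of the thresholds `t j` over the levels `τ j * α`. -/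
def score (x : EuclideanSpace ℝ (Fin p)) (K : EuclideanSpace ℝ (Fin p) → ℝ) (h α : ℕ → ℝ)
    (c τ : ι → ℝ) (t : ℕ → ι → ℝ) (n : ℕ) (s : EuclideanSpace ℝ (Fin p) × ℝ) : ℝ :=
  (effRate p h α n)⁻¹ * (K ((h n)⁻¹ • (x - s.1)) * exceed c (t n) (fun j => τ j * α n) s.2)

/-- The thresholds `t n j` have conditional exceedance probabilities
`α (τ j + θ j / v + o(1 / v))` locally uniformly around `x`, where `v` is the effective rate. -/
def IsTailThreshold (Q : Kernel (EuclideanSpace ℝ (Fin p)) ℝ) (x : EuclideanSpace ℝ (Fin p))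
    (h α : ℕ → ℝ) (τ θ : ℝ) (t : ℕ → ℝ) : Prop :=
  Tendsto (fun z : ℕ × EuclideanSpace ℝ (Fin p) =>
    effRate p h α z.1 * (condSurv Q z.2 (t z.1) / α z.1 - τ)) (localFilter x h) (𝓝 θ)

variable {g : EuclideanSpace ℝ (Fin p) → ℝ} {Q : Kernel (EuclideanSpace ℝ (Fin p)) ℝ}
  {x : EuclideanSpace ℝ (Fin p)} {K : EuclideanSpace ℝ (Fin p) → ℝ} {h α : ℕ → ℝ}
  {c τ θ : ι → ℝ} {t : ℕ → ι → ℝ}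

theorem effRate_nonneg (n : ℕ) : 0 ≤ effRate p h α n := Real.sqrt_nonneg _

namespace IsSmoothingScheme

theorem sq_effRate (H : IsSmoothingScheme g K h α) (n : ℕ) :
    effRate p h α n ^ 2 = (n : ℝ) * h n ^ p * α n := by
  have h1 := H.bandwidth_pos n
  have h2 := (H.level_mem n).1
  exact Real.sq_sqrt (by positivity)

theorem tendsto_div (H : IsSmoothingScheme g K h α) {τ θ : ℝ} {t : ℕ → ℝ}
    (ht : IsTailThreshold Q x h α τ θ t) :
    Tendsto (fun z : ℕ × EuclideanSpace ℝ (Fin p) => condSurv Q z.2 (t z.1) / α z.1)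
      (localFilter x h) (𝓝 τ) := by
  have hv := H.rate.comp (tendsto_fst_localFilter (x := x) (h := h))
  have h1 := (hv.inv_tendsto_atTop.mul ht).add_const τ
  rw [zero_mul, zero_add] at h1
  refine h1.congr' ?_
  filter_upwards [hv.eventually_gt_atTop 0] with z hz
  simp only [Pi.inv_apply, Function.comp] at hz ⊢
  field_simp
  ring

theorem tendsto_density (H : IsSmoothingScheme g K h α) (x : EuclideanSpace ℝ (Fin p)) :
    Tendsto (fun z : ℕ × EuclideanSpace ℝ (Fin p) => g z.2) (localFilter x h) (𝓝 (g x)) :=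
  (H.continuous.tendsto x).comp (tendsto_snd_localFilter H.bandwidth_lim)

theorem measurable_weight (H : IsSmoothingScheme g K h α) (x : EuclideanSpace ℝ (Fin p)) (r : ℝ) :
    Measurable fun u => K (r • (x - u)) :=
  H.kernel.measurable.comp (by fun_prop)

theorem measurable_score (H : IsSmoothingScheme g K h α) (x : EuclideanSpace ℝ (Fin p))
    (c τ : ι → ℝ) (t : ℕ → ι → ℝ) (n : ℕ) : Measurable (score x K h α c τ t n) :=
  (((H.measurable_weight x _).comp measurable_fst).mul
    ((measurable_exceed _ _ _).comp measurable_snd)).const_mul _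

/-- The kernel is bounded and α < 1 bounds the centering terms, so only the factor 1/v depends on n.
This is the uniform smallness needed for the central limit theorem. -/
theorem exists_bound_score (H : IsSmoothingScheme g K h α) (x : EuclideanSpace ℝ (Fin p))
    (c τ : ι → ℝ) (t : ℕ → ι → ℝ) :
    ∃ B : ℕ → ℝ, (∀ n s, |score x K h α c τ t n s| ≤ B n) ∧ Tendsto B atTop (𝓝 0) := by
  obtain ⟨M, hM0, hM⟩ := H.kernel.exists_bound
  refine ⟨fun n => (effRate p h α n)⁻¹ * (M * ∑ j, |c j| * (1 + |τ j|)), fun n s => ?_, ?_⟩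
  · rw [score, abs_mul, abs_mul, abs_of_nonneg (inv_nonneg.2 (effRate_nonneg n))]
    refine mul_le_mul_of_nonneg_left ?_ (inv_nonneg.2 (effRate_nonneg n))
    refine mul_le_mul (hM _) ((abs_exceed_le _ _ _ _).trans ?_) (abs_nonneg _) hM0
    refine Finset.sum_le_sum fun j _ => mul_le_mul_of_nonneg_left ?_ (abs_nonneg _)
    rw [abs_mul, abs_of_pos (H.level_mem n).1]
    have := mul_le_of_le_one_right (abs_nonneg (τ j)) (H.level_mem n).2.le
    linarith
  · simpa using H.rate.inv_tendsto_atTop.mul_const (M * ∑ j, |c j| * (1 + |τ j|))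

variable [IsMarkovKernel Q]

theorem integral_score (H : IsSmoothingScheme g K h α) [IsFiniteMeasure (jointLaw g Q)] (n : ℕ) :
    ∫ s, score x K h α c τ t n s ∂(jointLaw g Q) = (effRate p h α n)⁻¹ *
      ∫ u, K ((h n)⁻¹ • (x - u)) * (g u * ∑ j, c j * (condSurv Q u (t n j) - τ j * α n)) := by
  obtain ⟨B, hB, -⟩ := H.exists_bound_score x c τ t
  rw [integral_jointLaw H.continuous.measurable H.nonneg Q
    (Integrable.of_bound (H.measurable_score x c τ t n).aestronglyMeasurable (B n)
      (Eventually.of_forall fun s => hB n s)), ← integral_const_mul]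
  congr 1
  ext u
  simp only [score]
  rw [integral_const_mul, integral_const_mul, integral_exceed]
  ring

theorem integral_score_sq (H : IsSmoothingScheme g K h α) [IsFiniteMeasure (jointLaw g Q)]
    (n : ℕ) :
    ∫ s, score x K h α c τ t n s ^ 2 ∂(jointLaw g Q) = ((effRate p h α n) ^ 2)⁻¹ *
      ∫ u, K ((h n)⁻¹ • (x - u)) ^ 2 * (g u * ∑ j, ∑ k, c j * c k *
        (min (condSurv Q u (t n j)) (condSurv Q u (t n k)) - τ j * α n * condSurv Q u (t n k)
          - τ k * α n * condSurv Q u (t n j) + τ j * α n * (τ k * α n))) := by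
  obtain ⟨B, hB, -⟩ := H.exists_bound_score x c τ t
  rw [integral_jointLaw H.continuous.measurable H.nonneg Q
    (Integrable.of_bound ((H.measurable_score x c τ t n).pow_const 2).aestronglyMeasurable
      (B n ^ 2) (Eventually.of_forall fun s => by
        rw [norm_pow, Real.norm_eq_abs]
        exact pow_le_pow_left₀ (abs_nonneg _) (hB n s) 2)), ← integral_const_mul]
  congr 1
  ext u
  simp only [score, mul_pow]
  rw [integral_const_mul, integral_const_mul, integral_exceed_sq]
  ring

/-- As v² = n h^p α, the prefactor n/v equals h^(-p) · v/α, so that kernel smoothing applies to v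
(F(t_j|u)/α - τ_j). -/
theorem tendsto_mean_score (H : IsSmoothingScheme g K h α) [IsFiniteMeasure (jointLaw g Q)]
    (ht : ∀ j, IsTailThreshold Q x h α (τ j) (θ j) fun n => t n j) :
    Tendsto (fun n : ℕ => n * ∫ s, score x K h α c τ t n s ∂(jointLaw g Q)) atTop
      (𝓝 (g x * ∑ j, c j * θ j)) := by
  have hlim := (H.tendsto_density x).mul
    (tendsto_finsetSum Finset.univ fun j _ => (ht j).const_mul (c j))
  have hm : ∀ n, Measurable fun u => g u * ∑ j, c j *
      (effRate p h α n * (condSurv Q u (t n j) / α n - τ j)) := fun n =>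
    H.continuous.measurable.mul (Finset.measurable_sum _ fun j _ =>
      ((((measurable_condSurv Q _).div_const _).sub_const _).const_mul _).const_mul _)
  refine (H.kernel.tendsto_integral H.bandwidth_pos hm hlim).congr' ?_
  filter_upwards [H.rate.eventually_gt_atTop 0] with n hn
  have hα := (H.level_mem n).1
  have hh := H.bandwidth_pos n
  have hsq := H.sq_effRate n
  have e : ∀ u, K ((h n)⁻¹ • (x - u)) * (g u * ∑ j, c j *
      (effRate p h α n * (condSurv Q u (t n j) / α n - τ j))) =
      (effRate p h α n / α n) * (K ((h n)⁻¹ • (x - u)) *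
        (g u * ∑ j, c j * (condSurv Q u (t n j) - τ j * α n))) := by
    intro u
    have : ∑ j, c j * (effRate p h α n * (condSurv Q u (t n j) / α n - τ j)) =
        (effRate p h α n / α n) * ∑ j, c j * (condSurv Q u (t n j) - τ j * α n) := by
      rw [Finset.mul_sum]
      refine Finset.sum_congr rfl fun j _ => ?_
      field_simp
    rw [this]
    ring
  simp only [e]
  rw [integral_const_mul, H.integral_score]
  have : (h n ^ p)⁻¹ * (effRate p h α n / α n) = n * (effRate p h α n)⁻¹ := by
    field_simp
    linarith
  rw [← mul_assoc, ← mul_assoc, this]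

/-- Here n/v² = h^(-p)/α. Divided by α, the joint exceedance probabilities tend to min(τ_j, τ_k),
while the terms coming from the centering are α times bounded quantities. -/
theorem tendsto_sq_score (H : IsSmoothingScheme g K h α) [IsFiniteMeasure (jointLaw g Q)]
    (hα : Tendsto α atTop (𝓝 0))
    (ht : ∀ j, IsTailThreshold Q x h α (τ j) (θ j) fun n => t n j) :
    Tendsto (fun n : ℕ => n * ∫ s, score x K h α c τ t n s ^ 2 ∂(jointLaw g Q)) atTop
      (𝓝 (g x * (∑ j, ∑ k, c j * c k * min (τ j) (τ k)) * ∫ u, K u ^ 2)) := by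
  have hd := fun j => H.tendsto_div (ht j)
  have hα' : Tendsto (fun z : ℕ × EuclideanSpace ℝ (Fin p) => α z.1) (localFilter x h) (𝓝 0) :=
    hα.comp tendsto_fst_localFilter
  have hterm : ∀ j k, Tendsto (fun z : ℕ × EuclideanSpace ℝ (Fin p) => c j * c k *
      (min (condSurv Q z.2 (t z.1 j) / α z.1) (condSurv Q z.2 (t z.1 k) / α z.1)
        - α z.1 * (τ j * (condSurv Q z.2 (t z.1 k) / α z.1)
          + τ k * (condSurv Q z.2 (t z.1 j) / α z.1) - τ j * τ k))) (localFilter x h)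
      (𝓝 (c j * c k * min (τ j) (τ k))) := by
    intro j k
    have := (((hd j).min (hd k)).sub (hα'.mul ((((hd k).const_mul (τ j)).add
      ((hd j).const_mul (τ k))).sub_const (τ j * τ k)))).const_mul (c j * c k)
    rwa [zero_mul, sub_zero] at this
  have hlim := (H.tendsto_density x).mul (tendsto_finsetSum Finset.univ fun j _ =>
    tendsto_finsetSum Finset.univ fun k _ => hterm j k)
  have hm : ∀ n, Measurable fun u => g u * ∑ j, ∑ k, c j * c k *
      (min (condSurv Q u (t n j) / α n) (condSurv Q u (t n k) / α n)
        - α n * (τ j * (condSurv Q u (t n k) / α n)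
          + τ k * (condSurv Q u (t n j) / α n) - τ j * τ k)) := by
    intro n
    have hF : ∀ j, Measurable fun u => condSurv Q u (t n j) / α n := fun j =>
      (measurable_condSurv Q _).div_const _
    refine H.continuous.measurable.mul (Finset.measurable_sum _ fun j _ =>
      Finset.measurable_sum _ fun k _ => Measurable.const_mul ?_ _)
    exact ((hF j).min (hF k)).sub (((((hF k).const_mul _).add
      ((hF j).const_mul _)).sub_const _).const_mul _)
  refine (H.kernel.tendsto_integral_sq H.bandwidth_pos hm hlim).congr' ?_
  filter_upwards [H.rate.eventually_gt_atTop 0] with n hn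
  have hα := (H.level_mem n).1
  have hh := H.bandwidth_pos n
  have hsq := H.sq_effRate n
  have e : ∀ u, K ((h n)⁻¹ • (x - u)) ^ 2 * (g u * ∑ j, ∑ k, c j * c k *
      (min (condSurv Q u (t n j) / α n) (condSurv Q u (t n k) / α n)
        - α n * (τ j * (condSurv Q u (t n k) / α n)
          + τ k * (condSurv Q u (t n j) / α n) - τ j * τ k))) =
      (α n)⁻¹ * (K ((h n)⁻¹ • (x - u)) ^ 2 * (g u * ∑ j, ∑ k, c j * c k *
        (min (condSurv Q u (t n j)) (condSurv Q u (t n k)) - τ j * α n * condSurv Q u (t n k)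
          - τ k * α n * condSurv Q u (t n j) + τ j * α n * (τ k * α n)))) := by
    intro u
    have : ∑ j, ∑ k, c j * c k *
      (min (condSurv Q u (t n j) / α n) (condSurv Q u (t n k) / α n)
        - α n * (τ j * (condSurv Q u (t n k) / α n)
          + τ k * (condSurv Q u (t n j) / α n) - τ j * τ k)) = (α n)⁻¹ * ∑ j, ∑ k, c j * c k *
        (min (condSurv Q u (t n j)) (condSurv Q u (t n k)) - τ j * α n * condSurv Q u (t n k)
          - τ k * α n * condSurv Q u (t n j) + τ j * α n * (τ k * α n)) := by
      rw [Finset.mul_sum]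
      refine Finset.sum_congr rfl fun j _ => ?_
      rw [Finset.mul_sum]
      refine Finset.sum_congr rfl fun k _ => ?_
      rw [min_div_div_right hα.le]
      field_simp
      ring
    rw [this]
    ring
  simp only [e]
  rw [integral_const_mul, H.integral_score_sq]
  have : (h n ^ p)⁻¹ * (α n)⁻¹ = n * (effRate p h α n ^ 2)⁻¹ := by
    have hn0 : (n : ℝ) ≠ 0 := by
      rintro h0
      rw [h0] at hsq
      have := pow_pos hn 2
      linarith [hsq]
    rw [hsq]
    field_simp
  rw [← mul_assoc, ← mul_assoc, this]

end IsSmoothingScheme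

end

/-! ### Convergence in probability by comparison of events -/

section Ghosh

variable {Ω : Type*} [MeasurableSpace Ω] {P : Measure Ω} [IsProbabilityMeasure P]

/-- Ghosh's criterion for the asymptotic equivalence of two sequences of random variables. -/
theorem tendsto_measureReal_sub_of_events {V U : ℕ → Ω → ℝ}
    (htight : ∀ δ > 0, ∃ M : ℝ, ∀ᶠ n in atTop, P.real {ω | M ≤ |U n ω|} ≤ δ)
    (h1 : ∀ z : ℝ, ∀ ε > 0,
      Tendsto (fun n => P.real {ω | V n ω < z ∧ z + ε ≤ U n ω}) atTop (𝓝 0))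
    (h2 : ∀ z : ℝ, ∀ ε > 0,
      Tendsto (fun n => P.real {ω | z < V n ω ∧ U n ω ≤ z - ε}) atTop (𝓝 0))
    {ε : ℝ} (hε : 0 < ε) :
    Tendsto (fun n => P.real {ω | ε ≤ |V n ω - U n ω|}) atTop (𝓝 0) := by
  refine tendsto_order.2 ⟨fun c hc => Eventually.of_forall fun n => hc.trans_le measureReal_nonneg,
    fun c hc => ?_⟩
  obtain ⟨M, hM⟩ := htight (c / 2) (half_pos hc)
  -- If U lies in the cell [-M + kη, -M + (k+1)η) and |V - U| ≥ 3η, then V is below -M + kη - η or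
  -- above -M + (k+2)η. The N cells cover the range |U| < M.
  set η := ε / 3 with hη
  have hη0 : 0 < η := by positivity
  set N := ⌊2 * M / η⌋₊ + 1 with hN
  have hsum : Tendsto (fun n => ∑ k ∈ Finset.range N,
      (P.real {ω | V n ω < -M + k * η - η ∧ (-M + k * η - η) + η ≤ U n ω} +
        P.real {ω | -M + (k + 2) * η < V n ω ∧ U n ω ≤ (-M + (k + 2) * η) - η})) atTop (𝓝 0) := by
    have := tendsto_finsetSum (Finset.range N) fun k _ =>
      (h1 (-M + k * η - η) η hη0).add (h2 (-M + (k + 2) * η) η hη0)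
    simpa using this
  filter_upwards [hM, hsum.eventually_lt_const (half_pos hc)] with n hn hn2
  have hsub : {ω | ε ≤ |V n ω - U n ω|} ⊆ {ω | M ≤ |U n ω|} ∪ ⋃ k ∈ Finset.range N,
      ({ω | V n ω < -M + k * η - η ∧ (-M + k * η - η) + η ≤ U n ω} ∪
        {ω | -M + (k + 2) * η < V n ω ∧ U n ω ≤ (-M + (k + 2) * η) - η}) := by
    intro ω hω
    have hω : ε ≤ |V n ω - U n ω| := hω
    by_cases hU : M ≤ |U n ω|
    · exact Or.inl hU
    right
    rw [not_le, abs_lt] at hU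
    have hk0 : 0 ≤ (U n ω + M) / η := div_nonneg (by linarith) hη0.le
    have hk1 := Nat.floor_le hk0
    have hk2 := Nat.lt_floor_add_one ((U n ω + M) / η)
    set k := ⌊(U n ω + M) / η⌋₊ with hk
    rw [le_div_iff₀ hη0] at hk1
    rw [div_lt_iff₀ hη0] at hk2
    have hkN : k ∈ Finset.range N := by
      rw [Finset.mem_range, hN, Nat.lt_add_one_iff]
      refine Nat.floor_le_floor ?_
      rw [div_le_div_iff_of_pos_right hη0]
      linarith
    refine Set.mem_iUnion₂.2 ⟨k, hkN, ?_⟩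
    have e3 : ε = 3 * η := by rw [hη]; ring
    rcases le_abs.1 hω with h | h
    · right
      constructor <;> nlinarith
    · left
      constructor <;> nlinarith
  calc P.real {ω | ε ≤ |V n ω - U n ω|} ≤ _ := measureReal_mono hsub
    _ ≤ _ := measureReal_union_le _ _
    _ ≤ c / 2 + _ := add_le_add hn ((measureReal_biUnion_finset_le _ _).trans
        (Finset.sum_le_sum fun k _ => measureReal_union_le _ _))
    _ < c / 2 + c / 2 := by linarith
    _ = c := add_halves c

end Ghosh

/-! ### The kernel estimator of the conditional survival function -/

theorem isSurv_indicator (y0 : ℝ) :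
    IsSurv fun y => (Set.Ioi y).indicator (fun _ => (1 : ℝ)) y0 := by
  have e : ∀ y, (Set.Ioi y).indicator (fun _ => (1 : ℝ)) y0 = if y < y0 then 1 else 0 := fun y => by
    simp [Set.indicator_apply]
  simp only [e]
  refine ⟨fun a b hab => ?_, fun y => by positivity, fun y => ?_, ?_, ?_⟩
  · by_cases h : b < y0
    · simp [h, hab.trans_lt h]
    · simp only [h, if_false]
      positivity
  · by_cases h : y < y0
    · refine (continuousAt_const (y := (1 : ℝ))).congr ?_ |>.continuousWithinAt
      filter_upwards [gt_mem_nhds h] with z hz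
      rw [if_pos hz]
    · refine (continuousWithinAt_const (b := (0 : ℝ))).congr (fun z hz => ?_) (by rw [if_neg h])
      rw [if_neg]
      exact not_lt.2 ((not_lt.1 h).trans hz)
  · refine tendsto_const_nhds.congr' ?_
    filter_upwards [eventually_lt_atBot y0] with z hz
    rw [if_pos hz]
  · refine tendsto_const_nhds.congr' ?_
    filter_upwards [eventually_ge_atTop y0] with z hz
    rw [if_neg (not_lt.2 hz)]

theorem isSurv_weighted_average {n : ℕ} {w y : ℕ → ℝ} (hw : ∀ i, 0 ≤ w i)
    (hpos : 0 < ∑ i ∈ Finset.range n, w i) :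
    IsSurv fun t => (∑ i ∈ Finset.range n, w i * (Set.Ioi t).indicator (fun _ => (1 : ℝ)) (y i)) /
      ∑ i ∈ Finset.range n, w i := by
  have hs := fun i => isSurv_indicator (y i)
  refine ⟨fun a b hab => ?_, fun t => ?_, fun t => ?_, ?_, ?_⟩
  · exact div_le_div_of_nonneg_right (Finset.sum_le_sum fun i _ =>
      mul_le_mul_of_nonneg_left ((hs i).anti hab) (hw i)) hpos.le
  · exact div_nonneg (Finset.sum_nonneg fun i _ => mul_nonneg (hw i) ((hs i).nonneg t)) hpos.le
  · exact ContinuousWithinAt.div_const (tendsto_finsetSum _ fun i _ =>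
      ((hs i).rightCont t).const_mul (w i)) _
  · have := (tendsto_finsetSum (Finset.range n) fun i _ =>
      (hs i).atBot.const_mul (w i)).div_const (∑ i ∈ Finset.range n, w i)
    simpa [div_self hpos.ne'] using this
  · have := (tendsto_finsetSum (Finset.range n) fun i _ =>
      (hs i).atTop.const_mul (w i)).div_const (∑ i ∈ Finset.range n, w i)
    simpa using this

section

variable {p : ℕ} {K : EuclideanSpace ℝ (Fin p) → ℝ} {x : EuclideanSpace ℝ (Fin p)}
  {X : ℕ → EuclideanSpace ℝ (Fin p)} {Y : ℕ → ℝ} {n : ℕ} {h : ℝ}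

theorem scaledKernel_nonneg (hK : IsSmoothingKernel K) (hh : 0 < h)
    (u : EuclideanSpace ℝ (Fin p)) : 0 ≤ scaledKernel K h u :=
  div_nonneg (hK.nonneg _) (pow_pos hh p).le

theorem isSurv_survEst (hK : IsSmoothingKernel K) (hh : 0 < h)
    (hpos : 0 < ∑ i ∈ Finset.range n, scaledKernel K h (x - X i)) :
    IsSurv (survEst K h n X Y x) :=
  isSurv_weighted_average (fun i => scaledKernel_nonneg hK hh (x - X i)) hpos

theorem sum_scaledKernel :
    ∑ i ∈ Finset.range n, scaledKernel K h (x - X i) =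
      (h ^ p)⁻¹ * ∑ i ∈ Finset.range n, K (h⁻¹ • (x - X i)) := by
  rw [Finset.mul_sum]
  refine Finset.sum_congr rfl fun i _ => ?_
  rw [scaledKernel, div_eq_inv_mul]

/-- Multiplication by the positive total weight removes the random denominator: the event concerns a
single sum over the sample, and no limit theorem for a ratio is needed. -/
theorem quantEst_le_iff (hK : IsSmoothingKernel K) (hh : 0 < h)
    (hpos : 0 < ∑ i ∈ Finset.range n, K (h⁻¹ • (x - X i))) {β t : ℝ}
    (hβ : β ∈ Set.Ioo (0 : ℝ) 1) :
    quantEst K h n X Y x β ≤ t ↔ ∑ i ∈ Finset.range n, K (h⁻¹ • (x - X i)) *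
      ((Set.Ioi t).indicator (fun _ => (1 : ℝ)) (Y i) - β) ≤ 0 := by
  have hhp : 0 < (h ^ p)⁻¹ := inv_pos.2 (pow_pos hh p)
  have hpos' : 0 < ∑ i ∈ Finset.range n, scaledKernel K h (x - X i) := by
    rw [sum_scaledKernel]
    exact mul_pos hhp hpos
  rw [quantEst, (isSurv_survEst hK hh hpos').genInv_le_iff hβ, survEst, div_le_iff₀ hpos',
    sum_scaledKernel]
  have e : ∑ i ∈ Finset.range n, scaledKernel K h (x - X i) *
      (Set.Ioi t).indicator (fun _ => (1 : ℝ)) (Y i) = (h ^ p)⁻¹ * ∑ i ∈ Finset.range n,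
        K (h⁻¹ • (x - X i)) * (Set.Ioi t).indicator (fun _ => (1 : ℝ)) (Y i) := by
    rw [Finset.mul_sum]
    refine Finset.sum_congr rfl fun i _ => ?_
    rw [scaledKernel, div_eq_inv_mul, mul_assoc]
  rw [e, mul_left_comm, mul_le_mul_iff_right₀ hhp]
  simp only [mul_sub, Finset.sum_sub_distrib]
  rw [← Finset.sum_mul, sub_nonpos, mul_comm β]

end

/-! ### Thresholds close to extreme conditional quantiles -/

section

theorem oscillation_nonneg {p : ℕ} (Q : Kernel (EuclideanSpace ℝ (Fin p)) ℝ)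
    (x : EuclideanSpace ℝ (Fin p)) (h κ lam α : ℝ) : 0 ≤ oscillation Q x h κ lam α := by
  refine Real.sSup_nonneg ?_
  rintro _ ⟨z, -, rfl⟩
  exact abs_nonneg _

variable {p : ℕ} {Q : Kernel (EuclideanSpace ℝ (Fin p)) ℝ} [IsMarkovKernel Q]
  {x : EuclideanSpace ℝ (Fin p)}

/-- Since β ≥ κα > 0, the quotients are bounded by 1/(κα), so the real `sSup` is a genuine supremum.
-/
theorem abs_le_oscillation {h κ lam α β : ℝ} (hκ : 0 < κ) (hα : 0 < α)
    (hβ : β ∈ Set.Icc (κ * α) (lam * α)) {u : EuclideanSpace ℝ (Fin p)}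
    (hu : u ∈ Metric.ball x h) :
    |condSurv Q u (genInv (condSurv Q x) β) / β - 1| ≤ oscillation Q x h κ lam α := by
  refine le_csSup ⟨1 / (κ * α) + 1, ?_⟩ ⟨(u, β), ⟨hu, hβ⟩, rfl⟩
  rintro _ ⟨⟨w, b⟩, ⟨-, hb⟩, rfl⟩
  have h0 : 0 < κ * α := mul_pos hκ hα
  have hb0 : 0 < b := h0.trans_le hb.1
  refine (abs_sub _ _).trans (add_le_add ?_ abs_one.le)
  have hs := isSurv_condSurv Q w
  rw [abs_of_nonneg (div_nonneg (hs.nonneg _) hb0.le)]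
  exact div_le_div₀ zero_le_one (hs.le_one _) h0 hb.1

/-- A threshold t in the tail is the quantile of its own order F(t|x), which eventually lies in [κα,
λα] because κ < τ < λ. The oscillation thus controls F(t|u)/F(t|x) = 1 + o(1/v) uniformly over the
ball, and the expansion at x carries over to u. -/
theorem isTailThreshold_of_oscillation {h α : ℕ → ℝ} {γ y0 κ lam τ d : ℝ} {t : ℕ → ℝ}
    (hF : IsVonMisesTail (condSurv Q x) γ y0) (hα : ∀ n, 0 < α n)
    (hrate : Tendsto (effRate p h α) atTop atTop) (hκ : 0 < κ) (hκτ : κ < τ) (hτ : τ < lam)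
    (hosc : Tendsto (fun n => effRate p h α n * oscillation Q x (h n) κ lam (α n)) atTop (𝓝 0))
    (ht : Tendsto t atTop (toEndpoint (condSurv Q x)))
    (hd : Tendsto (fun n => effRate p h α n * (condSurv Q x (t n) / (τ * α n) - 1)) atTop (𝓝 d)) :
    IsTailThreshold Q x h α τ (τ * d) t := by
  have hτ0 : 0 < τ := hκ.trans hκτ
  have h1 : Tendsto (fun n => condSurv Q x (t n) / α n) atTop (𝓝 τ) := by
    have := ((hrate.inv_tendsto_atTop.mul hd).add_const 1).const_mul τ
    rw [zero_mul, zero_add, mul_one] at this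
    refine this.congr' ?_
    filter_upwards [hrate.eventually_gt_atTop 0] with n hn
    have := hα n
    simp only [Pi.inv_apply]
    field_simp
    ring
  have h2 : Tendsto (fun n => effRate p h α n * (condSurv Q x (t n) / α n - τ)) atTop
      (𝓝 (τ * d)) := by
    refine (hd.const_mul τ).congr fun n => ?_
    have := hα n
    field_simp
  have h3 : Tendsto (fun z : ℕ × EuclideanSpace ℝ (Fin p) => effRate p h α z.1 *
      (condSurv Q z.2 (t z.1) / condSurv Q x (t z.1) - 1)) (localFilter x h) (𝓝 0) := by
    refine squeeze_zero_norm' ?_ (hosc.comp tendsto_fst_localFilter)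
    rw [eventually_localFilter]
    filter_upwards [h1.eventually_const_le hκτ, h1.eventually_le_const hτ, hF.eventually_mem ht,
      (hF.tendsto_zero.comp ht).eventually_lt_const one_pos] with n h4 h5 h6 h7 u hu
    have hmem : condSurv Q x (t n) ∈ Set.Icc (κ * α n) (lam * α n) :=
      ⟨(le_div_iff₀ (hα n)).1 h4, (div_le_iff₀ (hα n)).1 h5⟩
    have h8 := abs_le_oscillation (Q := Q) (x := x) hκ (hα n) hmem hu
    rw [hF.region.genInv_F hF.surv h6.1 h6.2 h7] at h8
    rw [Real.norm_eq_abs, abs_mul, abs_of_nonneg (effRate_nonneg n)]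
    exact mul_le_mul_of_nonneg_left h8 (effRate_nonneg n)
  have h4 := (h3.mul (h1.comp tendsto_fst_localFilter)).add (h2.comp tendsto_fst_localFilter)
  rw [zero_mul, zero_add] at h4
  refine h4.congr' ?_
  have h5 : ∀ᶠ z in localFilter x h, y0 < t z.1 ∧ 0 < condSurv Q x (t z.1) :=
    tendsto_fst_localFilter.eventually (hF.eventually_mem ht)
  filter_upwards [h5] with z hz
  have h6 := hα z.1
  have h7 := hz.2
  simp only [Function.comp]
  field_simp
  ring

end

/-! ### Asymptotic representation of the quantile estimator -/

section

variable {p : ℕ} {Ω : Type*} [MeasurableSpace Ω] {P : Measure Ω} [IsProbabilityMeasure P]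
  {X : ℕ → Ω → EuclideanSpace ℝ (Fin p)} {Y : ℕ → Ω → ℝ}
  {g : EuclideanSpace ℝ (Fin p) → ℝ} {Q : Kernel (EuclideanSpace ℝ (Fin p)) ℝ} [IsMarkovKernel Q]
  {x : EuclideanSpace ℝ (Fin p)} {K : EuclideanSpace ℝ (Fin p) → ℝ} {h α : ℕ → ℝ}

/-- The normalized weight (n h^p)⁻¹ Σ K((x - X_i)/h) has mean tending to g(x) > 0 and variance
O(1/(n h^p)), which vanishes because n h^p ≥ v². -/
theorem tendsto_measureReal_weights_nonpos
    (S : IsIIDSample P (jointLaw g Q) fun i ω => (X i ω, Y i ω)) (H : IsSmoothingScheme g K h α)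
    (hgx : 0 < g x) :
    Tendsto (fun n => P.real {ω | ∑ i ∈ Finset.range n, K ((h n)⁻¹ • (x - X i ω)) ≤ 0}) atTop
      (𝓝 0) := by
  have := S.isProbabilityMeasure
  obtain ⟨M, hM0, hM⟩ := H.kernel.exists_bound
  set f : ℕ → EuclideanSpace ℝ (Fin p) × ℝ → ℝ :=
    fun n s => ((n : ℝ) * h n ^ p)⁻¹ * K ((h n)⁻¹ • (x - s.1)) with hf
  have hc : ∀ n : ℕ, 0 ≤ ((n : ℝ) * h n ^ p)⁻¹ := fun n => by
    have := H.bandwidth_pos n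
    positivity
  have hfm : ∀ n, Measurable (f n) := fun n =>
    ((H.measurable_weight x _).comp measurable_fst).const_mul _
  have hfB : ∀ n s, |f n s| ≤ ((n : ℝ) * h n ^ p)⁻¹ * M := fun n s => by
    rw [hf, abs_mul, abs_of_nonneg (hc n)]
    exact mul_le_mul_of_nonneg_left (hM _) (hc n)
  have e1 : ∀ n, ∫ s, f n s ∂(jointLaw g Q) =
      ((n : ℝ) * h n ^ p)⁻¹ * ∫ u, K ((h n)⁻¹ • (x - u)) * g u := fun n => by
    rw [integral_jointLaw H.continuous.measurable H.nonneg Q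
      (Integrable.of_bound (hfm n).aestronglyMeasurable _
        (Eventually.of_forall fun s => hfB n s)), ← integral_const_mul]
    congr 1
    ext u
    simp [hf]
    ring
  have e2 : ∀ n, ∫ s, f n s ^ 2 ∂(jointLaw g Q) =
      (((n : ℝ) * h n ^ p)⁻¹) ^ 2 * ∫ u, K ((h n)⁻¹ • (x - u)) ^ 2 * g u := fun n => by
    rw [integral_jointLaw H.continuous.measurable H.nonneg Q
      (Integrable.of_bound ((hfm n).pow_const 2).aestronglyMeasurable
        ((((n : ℝ) * h n ^ p)⁻¹ * M) ^ 2) (Eventually.of_forall fun s => by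
        rw [norm_pow, Real.norm_eq_abs]
        exact pow_le_pow_left₀ (abs_nonneg _) (hfB n s) 2)), ← integral_const_mul]
    congr 1
    ext u
    simp [hf]
    ring
  have hd := H.tendsto_density x
  have hm : Tendsto (fun n : ℕ => n * ∫ s, f n s ∂(jointLaw g Q)) atTop (𝓝 (g x)) := by
    refine (H.kernel.tendsto_integral H.bandwidth_pos (fun _ => H.continuous.measurable) hd).congr'
      ?_
    filter_upwards [eventually_gt_atTop 0] with n hn
    have hn' : (n : ℝ) ≠ 0 := Nat.cast_ne_zero.2 hn.ne'
    rw [e1, mul_inv, ← mul_assoc, mul_inv_cancel_left₀ hn']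
  have hinv : Tendsto (fun n : ℕ => ((n : ℝ) * h n ^ p)⁻¹) atTop (𝓝 0) := by
    refine Tendsto.inv_tendsto_atTop (tendsto_atTop_mono (fun n => ?_)
      ((tendsto_pow_atTop two_ne_zero).comp H.rate))
    have h1 := H.bandwidth_pos n
    show effRate p h α n ^ 2 ≤ _
    rw [H.sq_effRate]
    exact mul_le_of_le_one_right (by positivity) (H.level_mem n).2.le
  have hs : Tendsto (fun n : ℕ => n * ∫ s, f n s ^ 2 ∂(jointLaw g Q)) atTop (𝓝 0) := by
    have h1 := hinv.mul (H.kernel.tendsto_integral_sq H.bandwidth_pos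
      (fun _ => H.continuous.measurable) hd)
    rw [zero_mul] at h1
    refine h1.congr' ?_
    filter_upwards [eventually_gt_atTop 0] with n hn
    have hn' : (n : ℝ) ≠ 0 := Nat.cast_ne_zero.2 hn.ne'
    have hh' := (pow_pos (H.bandwidth_pos n) p).ne'
    rw [e2]
    field_simp
  refine squeeze_zero (fun n => measureReal_nonneg) (fun n => measureReal_mono fun ω hω => ?_)
    (S.tendsto_measureReal_sum hfm hfB hm hs hgx)
  have h1 : ∑ i ∈ Finset.range n, f n (X i ω, Y i ω) ≤ 0 := by
    simp only [hf, ← Finset.mul_sum]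
    exact mul_nonpos_of_nonneg_of_nonpos (hc n) hω
  show g x ≤ |∑ i ∈ Finset.range n, f n (X i ω, Y i ω) - g x|
  rw [abs_sub_comm]
  exact le_trans (by linarith) (le_abs_self _)

theorem score_fin_one (c τ : ℝ) (t : ℕ → ℝ) (n : ℕ) (s : EuclideanSpace ℝ (Fin p) × ℝ) :
    score x K h α (fun _ : Fin 1 => c) (fun _ => τ) (fun n _ => t n) n s =
      c * ((effRate p h α n)⁻¹ * (K ((h n)⁻¹ • (x - s.1)) *
        ((Set.Ioi (t n)).indicator (fun _ => (1 : ℝ)) s.2 - τ * α n))) := by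
  simp only [score, exceed, Finset.univ_unique, Finset.sum_singleton]
  ring

/-- Bahadur representation: the normalized quantile error is, up to o_P(1), the centered exceedance
sum at the true quantile divided by g(x) τ^(1+γ). The qualitative input is that the exceedance sum
is asymptotically affine in the threshold on the scale a/v. -/
theorem tendsto_measureReal_quantEst_sub
    (S : IsIIDSample P (jointLaw g Q) fun i ω => (X i ω, Y i ω)) (H : IsSmoothingScheme g K h α)
    (hα : Tendsto α atTop (𝓝 0)) (hgx : 0 < g x) {γ y0 κ lam τ : ℝ} {a : ℝ → ℝ}
    (hF : IsVonMisesTail (condSurv Q x) γ y0) (ha : IsAuxiliary (condSurv Q x) γ a)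
    (hκ : 0 < κ) (hκτ : κ < τ) (hτ1 : τ ≤ 1) (hlam : 1 < lam)
    (hosc : Tendsto (fun n => effRate p h α n * oscillation Q x (h n) κ lam (α n)) atTop (𝓝 0)) :
    IsTailThreshold Q x h α τ 0 (fun n => genInv (condSurv Q x) (τ * α n)) ∧
    ∀ ε > 0, Tendsto (fun n => P.real {ω | ε ≤ |effRate p h α n *
        ((quantEst K (h n) n (fun i => X i ω) (fun i => Y i ω) x (τ * α n) -
          genInv (condSurv Q x) (τ * α n)) / a (genInv (condSurv Q x) (α n))) -
        ∑ i ∈ Finset.range n, score x K h α (fun _ : Fin 1 => (g x * τ ^ (1 + γ))⁻¹) (fun _ => τ)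
          (fun n _ => genInv (condSurv Q x) (τ * α n)) n (X i ω, Y i ω)|}) atTop (𝓝 0) := by
  have := S.isProbabilityMeasure
  have hτ0 : 0 < τ := hκ.trans hκτ
  set q : ℕ → ℝ := fun n => genInv (condSurv Q x) (τ * α n) with hq
  set b : ℕ → ℝ := fun n => a (genInv (condSurv Q x) (α n)) with hb
  set v := effRate p h α with hv
  have hαpos : ∀ n, 0 < α n := fun n => (H.level_mem n).1
  set c0 := g x * τ ^ (1 + γ) with hc0
  have hc0pos : 0 < c0 := by positivity
  have hthr : ∀ z : ℝ, IsTailThreshold Q x h α τ (τ * -(z * τ ^ γ))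
      (fun n => q n + z * (b n / v n)) := fun z => by
    obtain ⟨h1, h2⟩ := hF.tendsto_linearization ha hα (Eventually.of_forall hαpos) H.rate hτ0 z
    exact isTailThreshold_of_oscillation hF hαpos H.rate hκ hκτ (hτ1.trans_lt hlam) hosc h1 h2
  have hthr0 : IsTailThreshold Q x h α τ 0 q := by
    simpa using hthr 0
  refine ⟨hthr0, ?_⟩
  have hbpos : ∀ᶠ n in atTop, 0 < b n := by
    have h1 := (hF.tendsto_genInv hα (Eventually.of_forall hαpos)).2
    filter_upwards [hF.eventually_mem h1] with n hn
    exact ha.1 _ ((hF.surv.lt_endpoint_iff _).2 hn.2)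
  set T : ℕ → (ℕ → ℝ) → Ω → ℝ := fun n t ω => ∑ i ∈ Finset.range n, (v n)⁻¹ *
    (K ((h n)⁻¹ • (x - X i ω)) *
      ((Set.Ioi (t n)).indicator (fun _ => (1 : ℝ)) (Y i ω) - τ * α n)) with hT
  have hU : ∀ n ω, ∑ i ∈ Finset.range n, score x K h α (fun _ : Fin 1 => c0⁻¹) (fun _ => τ)
      (fun n _ => q n) n (X i ω, Y i ω) = c0⁻¹ * T n q ω := fun n ω => by
    simp only [score_fin_one, hT, Finset.mul_sum, hv]
  -- The difference is a score with weights 1 and -1 at two thresholds of the same level τ. Its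
  -- limiting second moment is a multiple of τ - τ - τ + τ = 0, so only the mean -c0 z survives.
  have hdiff : ∀ z : ℝ, ∀ η > 0, Tendsto (fun n => P.real {ω | η ≤
      |T n (fun n => q n + z * (b n / v n)) ω - T n q ω + c0 * z|}) atTop (𝓝 0) := by
    intro z η hη
    set t2 : ℕ → Fin 2 → ℝ := fun n => ![q n + z * (b n / v n), q n] with ht2
    have hthr2 : ∀ j : Fin 2, IsTailThreshold Q x h α τ
        ((![τ * -(z * τ ^ γ), 0] : Fin 2 → ℝ) j) fun n => t2 n j := by
      intro j
      fin_cases j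
      · exact hthr z
      · exact hthr0
    have hm := H.tendsto_mean_score (c := ![1, -1]) (τ := fun _ => τ) hthr2
    have hs := H.tendsto_sq_score (c := ![1, -1]) (τ := fun _ => τ) hα hthr2
    have es : g x * (∑ j : Fin 2, ∑ k : Fin 2, (![1, -1] : Fin 2 → ℝ) j *
        (![1, -1] : Fin 2 → ℝ) k * min τ τ) * ∫ u, K u ^ 2 = 0 := by
      simp [Fin.sum_univ_two]
    have em : g x * (∑ j : Fin 2, (![1, -1] : Fin 2 → ℝ) j *
        (![τ * -(z * τ ^ γ), 0] : Fin 2 → ℝ) j) = -(c0 * z) := by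
      simp only [Fin.sum_univ_two, Matrix.cons_val_zero, Matrix.cons_val_one]
      rw [hc0, Real.rpow_add hτ0, Real.rpow_one]
      ring
    rw [es] at hs
    rw [em] at hm
    obtain ⟨B, hB, -⟩ := H.exists_bound_score x (![1, -1] : Fin 2 → ℝ) (fun _ => τ) t2
    refine (S.tendsto_measureReal_sum (H.measurable_score x _ _ t2) hB hm hs hη).congr fun n => ?_
    congr 1
    ext ω
    have : ∑ i ∈ Finset.range n, score x K h α ![1, -1] (fun _ => τ) t2 n (X i ω, Y i ω) =
        T n (fun n => q n + z * (b n / v n)) ω - T n q ω := by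
      simp only [hT]
      rw [← Finset.sum_sub_distrib]
      refine Finset.sum_congr rfl fun i _ => ?_
      simp only [score, exceed, Fin.sum_univ_two, Matrix.cons_val_zero, Matrix.cons_val_one, ht2]
      rw [← hv]
      ring
    simp only [Set.mem_ofPred_eq]
    rw [this, sub_neg_eq_add]
  -- Inversion: the normalized quantile error is at most z exactly when the exceedance sum at q + z
  -- b/v is nonpositive.
  have hsub : ∀ᶠ n in atTop, ∀ z ω, 0 < ∑ i ∈ Finset.range n, K ((h n)⁻¹ • (x - X i ω)) →
      (v n * ((quantEst K (h n) n (fun i => X i ω) (fun i => Y i ω) x (τ * α n) - q n) / b n) ≤ z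
        ↔ T n (fun n => q n + z * (b n / v n)) ω ≤ 0) := by
    filter_upwards [hbpos, H.rate.eventually_gt_atTop 0] with n hbn hvn z ω hpos
    have hvn : 0 < v n := hvn
    have hlev : τ * α n ∈ Set.Ioo (0 : ℝ) 1 := ⟨mul_pos hτ0 (hαpos n),
      (mul_le_of_le_one_left (hαpos n).le hτ1).trans_lt (H.level_mem n).2⟩
    have h1 := quantEst_le_iff (t := q n + z * (b n / v n)) (Y := fun i => Y i ω) H.kernel
      (H.bandwidth_pos n) hpos hlev
    have h2 : T n (fun n => q n + z * (b n / v n)) ω ≤ 0 ↔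
        ∑ i ∈ Finset.range n, K ((h n)⁻¹ • (x - X i ω)) *
          ((Set.Ioi (q n + z * (b n / v n))).indicator (fun _ => (1 : ℝ)) (Y i ω) - τ * α n) ≤
            0 := by
      simp only [hT]
      rw [← Finset.mul_sum]
      exact ⟨fun h3 => le_of_mul_le_mul_left (by simpa using h3) (inv_pos.2 hvn),
        fun h3 => mul_nonpos_of_nonneg_of_nonpos (inv_pos.2 hvn).le h3⟩
    rw [h2, ← h1, ← sub_le_iff_le_add', ← mul_div_assoc, div_le_iff₀ hbn, ← mul_div_assoc,
      le_div_iff₀ hvn, mul_comm (v n)]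
  have hden := tendsto_measureReal_weights_nonpos S H hgx
  intro ε hε
  change Tendsto (fun n => P.real {ω | ε ≤ |v n * ((quantEst K (h n) n (fun i => X i ω)
    (fun i => Y i ω) x (τ * α n) - q n) / b n) - ∑ i ∈ Finset.range n,
      score x K h α (fun _ : Fin 1 => c0⁻¹) (fun _ => τ) (fun n _ => q n) n (X i ω, Y i ω)|})
    atTop (𝓝 0)
  simp only [hU]
  refine tendsto_measureReal_sub_of_events (fun δ hδ => ?_) (fun z η hη => ?_) (fun z η hη => ?_) hε
  · have hm := H.tendsto_mean_score (c := fun _ : Fin 1 => c0⁻¹) (τ := fun _ => τ)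
      (t := fun n _ => q n) (fun _ => hthr0)
    have hs := H.tendsto_sq_score (c := fun _ : Fin 1 => c0⁻¹) (τ := fun _ => τ)
      (t := fun n _ => q n) hα (fun _ => hthr0)
    obtain ⟨B, hB, -⟩ := H.exists_bound_score x (fun _ : Fin 1 => c0⁻¹) (fun _ => τ)
      (fun n _ => q n)
    obtain ⟨M, hM⟩ := S.exists_measureReal_sum_le (H.measurable_score x _ _ _) hB hm hs hδ
    refine ⟨M, hM.mono fun n hn => ?_⟩
    simpa only [hU] using hn
  · have h1 := hden.add (hdiff z (c0 * η) (by positivity))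
    rw [add_zero] at h1
    refine squeeze_zero' (Eventually.of_forall fun n => measureReal_nonneg) ?_ h1
    filter_upwards [hsub] with n hn
    refine (measureReal_mono fun ω hω => ?_).trans (measureReal_union_le _ _)
    by_cases hpos : 0 < ∑ i ∈ Finset.range n, K ((h n)⁻¹ • (x - X i ω))
    · right
      have h2 := (hn z ω hpos).1 hω.1.le
      have h3 : c0 * (z + η) ≤ T n q ω := by
        have := hω.2
        rwa [le_inv_mul_iff₀ hc0pos] at this
      show c0 * η ≤ |_|
      refine le_trans ?_ (neg_le_abs _)
      linarith
    · exact Or.inl (not_lt.1 hpos)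
  · have h1 := hden.add (hdiff z (c0 * η) (by positivity))
    rw [add_zero] at h1
    refine squeeze_zero' (Eventually.of_forall fun n => measureReal_nonneg) ?_ h1
    filter_upwards [hsub] with n hn
    refine (measureReal_mono fun ω hω => ?_).trans (measureReal_union_le _ _)
    by_cases hpos : 0 < ∑ i ∈ Finset.range n, K ((h n)⁻¹ • (x - X i ω))
    · right
      have h2 := not_le.1 (mt (hn z ω hpos).2 (not_le.2 hω.1))
      have h3 : T n q ω ≤ c0 * (z - η) := by
        have := hω.2
        rwa [inv_mul_le_iff₀ hc0pos] at this
      show c0 * η ≤ |_|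
      refine le_trans ?_ (le_abs_self _)
      linarith
    · exact Or.inl (not_lt.1 hpos)

end

/-! ### The delta method in probability -/

section Delta

variable {Ω : Type*} [MeasurableSpace Ω] {P : Measure Ω} [IsProbabilityMeasure P]

/-- Where ‖U‖ < M and v(w - μ) is close to U, the point w is within (M + 1)/v of μ. The
differentiability remainder then costs at most η(M + 1) = ε/2, and replacing v(w - μ) by U under L
costs less than ε/2. -/
theorem tendsto_measureReal_delta {V : Type*} [NormedAddCommGroup V] [NormedSpace ℝ V]
    {G : V → ℝ} {L : V →L[ℝ] ℝ} {μ : V} (hG : HasFDerivAt G L μ) {v : ℕ → ℝ}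
    (hv : Tendsto v atTop atTop) {w U : ℕ → Ω → V}
    (htight : ∀ δ > 0, ∃ M : ℝ, ∀ᶠ n in atTop, P.real {ω | M ≤ ‖U n ω‖} ≤ δ)
    (hwU : ∀ ε > 0, Tendsto (fun n => P.real {ω | ε ≤ ‖v n • (w n ω - μ) - U n ω‖}) atTop (𝓝 0))
    {ε : ℝ} (hε : 0 < ε) :
    Tendsto (fun n => P.real {ω | ε ≤ |v n * (G (w n ω) - G μ) - L (U n ω)|}) atTop (𝓝 0) := by
  refine tendsto_order.2 ⟨fun c hc => Eventually.of_forall fun n => hc.trans_le measureReal_nonneg,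
    fun c hc => ?_⟩
  obtain ⟨M0, hM0⟩ := htight (c / 2) (half_pos hc)
  set M := max M0 0 + 1 with hM
  have hM1 : 1 ≤ M := by
    have := le_max_right M0 0
    linarith
  set η := ε / (2 * (M + 1)) with hη
  have hη0 : 0 < η := by positivity
  set η' := min 1 (ε / (2 * (‖L‖ + 1))) with hη'
  have hη'0 : 0 < η' := by positivity
  obtain ⟨ρ, hρ, hGρ⟩ := Metric.eventually_nhds_iff.1 (hG.isLittleO.def hη0)
  filter_upwards [hM0, (hwU η' hη'0).eventually_lt_const (half_pos hc),
    hv.eventually_gt_atTop ((M + 1) / ρ), hv.eventually_gt_atTop 0] with n h1 h2 h3 h4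
  have hsub : {ω | ε ≤ |v n * (G (w n ω) - G μ) - L (U n ω)|} ⊆
      {ω | M0 ≤ ‖U n ω‖} ∪ {ω | η' ≤ ‖v n • (w n ω - μ) - U n ω‖} := by
    intro ω hω
    by_contra hcon
    rw [Set.mem_union, not_or] at hcon
    have hU : ‖U n ω‖ < M0 := not_le.1 hcon.1
    have hZU : ‖v n • (w n ω - μ) - U n ω‖ < η' := not_le.1 hcon.2
    have hZ : ‖v n • (w n ω - μ)‖ < M + 1 := by
      have h5 := norm_le_norm_add_norm_sub' (v n • (w n ω - μ)) (U n ω)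
      have h6 : η' ≤ 1 := min_le_left _ _
      have h7 := le_max_left M0 0
      linarith
    have hd : v n * ‖w n ω - μ‖ < M + 1 := by
      rwa [norm_smul, Real.norm_eq_abs, abs_of_pos h4] at hZ
    have hlt : dist (w n ω) μ < ρ := by
      rw [dist_eq_norm]
      rw [div_lt_iff₀ hρ] at h3
      exact lt_of_mul_lt_mul_left (hd.trans h3) h4.le
    have h8 := hGρ hlt
    have h9 : |v n * (G (w n ω) - G μ) - L (v n • (w n ω - μ))| ≤ η * (M + 1) := by
      rw [map_smul, smul_eq_mul, ← mul_sub, abs_mul, abs_of_pos h4]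
      rw [Real.norm_eq_abs] at h8
      calc v n * |G (w n ω) - G μ - L (w n ω - μ)| ≤ v n * (η * ‖w n ω - μ‖) :=
            mul_le_mul_of_nonneg_left h8 h4.le
        _ = η * (v n * ‖w n ω - μ‖) := by ring
        _ ≤ _ := mul_le_mul_of_nonneg_left hd.le hη0.le
    have h10 : |L (v n • (w n ω - μ)) - L (U n ω)| ≤ ‖L‖ * η' := by
      rw [← map_sub]
      exact (L.le_opNorm _).trans (mul_le_mul_of_nonneg_left hZU.le (norm_nonneg _))
    have h11 : η * (M + 1) = ε / 2 := by
      rw [hη]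
      field_simp
    have h12 : ‖L‖ * η' < ε / 2 := by
      have h13 : η' ≤ ε / (2 * (‖L‖ + 1)) := min_le_right _ _
      calc ‖L‖ * η' < (‖L‖ + 1) * η' := by linarith
        _ ≤ (‖L‖ + 1) * (ε / (2 * (‖L‖ + 1))) :=
            mul_le_mul_of_nonneg_left h13 (by positivity)
        _ = ε / 2 := by
            have : ‖L‖ + 1 ≠ 0 := by positivity
            field_simp
    have h14 := abs_sub_le (v n * (G (w n ω) - G μ)) (L (v n • (w n ω - μ))) (L (U n ω))
    have hω : ε ≤ |v n * (G (w n ω) - G μ) - L (U n ω)| := hω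
    linarith
  calc _ ≤ _ := measureReal_mono hsub
    _ ≤ _ := measureReal_union_le _ _
    _ < c := by linarith

end Delta

/-! ### Derivatives of the refined Pickands functionals -/

/-- Differentiation under the integral sign. For |z - γ| < 1, v^(z-1) is at most v^γ when v ≥ 1 and
at most v^(γ-2) when v ≤ 1; the sum dominates both. -/
theorem hasDerivAt_Kfun_index (γ : ℝ) {u : ℝ} (hu : 0 < u) :
    HasDerivAt (fun z => Kfun z u) (KfunDeriv γ u) γ := by
  have hpos : ∀ v ∈ Set.uIcc 1 u, (0 : ℝ) < v := fun v hv => by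
    rw [Set.mem_uIcc] at hv
    rcases hv with h | h
    · exact lt_of_lt_of_le one_pos h.1
    · exact lt_of_lt_of_le hu h.1
  have hposι : ∀ v ∈ Set.uIoc 1 u, (0 : ℝ) < v := fun v hv => hpos v (Set.uIoc_subset_uIcc hv)
  have hc : ∀ z : ℝ, ContinuousOn (fun v : ℝ => v ^ z) (Set.uIcc 1 u) := fun z v hv =>
    (Real.continuousAt_rpow_const v _ (Or.inl (hpos v hv).ne')).continuousWithinAt
  have hl : ContinuousOn (fun v : ℝ => Real.log v) (Set.uIcc 1 u) := fun v hv =>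
    (Real.continuousAt_log (hpos v hv).ne').continuousWithinAt
  have hmeas : ∀ {f : ℝ → ℝ}, ContinuousOn f (Set.uIcc 1 u) →
      AEStronglyMeasurable f (volume.restrict (Set.uIoc 1 u)) := fun hf =>
    (hf.mono Set.uIoc_subset_uIcc).aestronglyMeasurable measurableSet_uIoc
  refine (intervalIntegral.hasDerivAt_integral_of_dominated_loc_of_deriv_le
    (F := fun z v => v ^ (z - 1)) (F' := fun z v => v ^ (z - 1) * Real.log v)
    (bound := fun v => (v ^ γ + v ^ (γ - 2)) * |Real.log v|) (Metric.ball_mem_nhds γ one_pos)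
    (Eventually.of_forall fun z => hmeas (hc _)) (hc _).intervalIntegrable
    (hmeas ((hc _).mul hl)) (Eventually.of_forall fun v hv z hz => ?_)
    (((hc _).add (hc _)).mul hl.abs).intervalIntegrable
    (Eventually.of_forall fun v hv z _ => ?_)).2
  · have hv0 := hposι v hv
    rw [norm_mul, Real.norm_eq_abs, Real.norm_eq_abs, abs_of_pos (Real.rpow_pos_of_pos hv0 _)]
    refine mul_le_mul_of_nonneg_right ?_ (abs_nonneg _)
    rw [Metric.mem_ball, Real.dist_eq, abs_lt] at hz
    rcases le_total 1 v with h1 | h1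
    · have := Real.rpow_le_rpow_of_exponent_le h1 (show z - 1 ≤ γ by linarith)
      have := Real.rpow_pos_of_pos hv0 (γ - 2)
      linarith
    · have := Real.rpow_le_rpow_of_exponent_ge hv0 h1 (show γ - 2 ≤ z - 1 by linarith)
      have := Real.rpow_pos_of_pos hv0 γ
      linarith
  · have h1 := ((hasDerivAt_id z).sub_const 1).const_rpow (hposι v hv)
    refine h1.congr_deriv ?_
    simp
    ring

section Pickands

variable {J : ℕ}

/-- The coordinate with number `j`, counted from `1`, of a vector indexed by `Fin J`. -/
def coord (J j : ℕ) : (Fin J → ℝ) →L[ℝ] ℝ :=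
  if hj : 1 ≤ j ∧ j ≤ J then ContinuousLinearMap.proj ⟨j - 1, by omega⟩ else 0

theorem coord_apply {j : ℕ} (hj : 1 ≤ j ∧ j ≤ J) (w : Fin J → ℝ) :
    coord J j w = w ⟨j - 1, by omega⟩ := by
  rw [coord, dif_pos hj]
  rfl

/-- The spacing of the coordinates with numbers `j` and `j + 1`. -/
def spacing (J j : ℕ) : (Fin J → ℝ) →L[ℝ] ℝ := coord J j - coord J (j + 1)

/-- The refined Pickands estimator of the tail index, as a function of `J` quantiles. -/
def gammaFun (J : ℕ) (r : ℝ) (π : ℕ → ℝ) (w : Fin J → ℝ) : ℝ :=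
  1 / Real.log r * ∑ j ∈ Finset.Icc 1 (J - 2), π j *
    Real.log (spacing J j w / spacing J (j + 1) w)

/-- The refined Pickands estimator of the scale, as a function of `J` quantiles. -/
def scaleFun (J : ℕ) (r : ℝ) (π : ℕ → ℝ) (w : Fin J → ℝ) : ℝ :=
  1 / Kfun (gammaFun J r π w) r * ∑ j ∈ Finset.Icc 1 (J - 2), π j *
    r ^ (gammaFun J r π w * (j : ℝ)) * spacing J j w

/-- Normalized limits of the quantiles of orders `τ_j α`. -/
def limitQuantiles (J : ℕ) (r γ : ℝ) (k : Fin J) : ℝ := Kfun γ (1 / tau r ((k : ℕ) + 1))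

/-- Location-scale normalization of the quantiles of orders `τ_j α`. -/
def normalizedQuantiles (J : ℕ) (r : ℝ) (qh : ℝ → ℝ) (α q a : ℝ) (k : Fin J) : ℝ :=
  (qh (tau r ((k : ℕ) + 1) * α) - q) / a

variable {r : ℝ} {π : ℕ → ℝ} {γ : ℝ}

theorem tau_pos (hr : r ∈ Set.Ioo (0 : ℝ) 1) (j : ℕ) : 0 < tau r j := pow_pos hr.1 _

theorem spacing_normalizedQuantiles {j : ℕ} (hj : 1 ≤ j ∧ j + 1 ≤ J) (qh : ℝ → ℝ) (α q a : ℝ) :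
    spacing J j (normalizedQuantiles J r qh α q a) =
      (qh (tau r j * α) - qh (tau r (j + 1) * α)) / a := by
  have h1 : j - 1 + 1 = j := by omega
  have h2 : j + 1 - 1 + 1 = j + 1 := by omega
  rw [spacing, sub_apply, coord_apply ⟨hj.1, by omega⟩, coord_apply ⟨by omega, hj.2⟩]
  simp only [normalizedQuantiles, h1, h2]
  ring

/-- Ratios of spacings are invariant under location and scale, so the unknown q and a can be
inserted freely. -/
theorem gammaRP_eq (r : ℝ) (π : ℕ → ℝ) (qh : ℝ → ℝ) (α q : ℝ) {a : ℝ} (ha : a ≠ 0) :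
    gammaRP J r π qh α = gammaFun J r π (normalizedQuantiles J r qh α q a) := by
  unfold gammaRP gammaFun
  congr 1
  refine Finset.sum_congr rfl fun j hj => ?_
  rw [Finset.mem_Icc] at hj
  rw [spacing_normalizedQuantiles (by omega), spacing_normalizedQuantiles (by omega),
    div_div_div_cancel_right₀ ha]

theorem scaleRP_div_eq (r : ℝ) (π : ℕ → ℝ) (qh : ℝ → ℝ) (α q : ℝ) {a : ℝ} (ha : a ≠ 0) :
    scaleRP J r π qh α / a = scaleFun J r π (normalizedQuantiles J r qh α q a) := by
  unfold scaleRP scaleFun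
  rw [gammaRP_eq r π qh α q ha, mul_div_assoc, Finset.sum_div]
  congr 1
  refine Finset.sum_congr rfl fun j hj => ?_
  rw [Finset.mem_Icc] at hj
  rw [spacing_normalizedQuantiles (by omega), mul_div_assoc]

/-- Substituting v = r^(-j) u in the defining integral explains the identity. The limit spacings
form a geometric progression of ratio r^(-γ), so consecutive ratios reveal γ. -/
theorem Kfun_sub (γ : ℝ) (hr : r ∈ Set.Ioo (0 : ℝ) 1) {j : ℕ} (hj : 1 ≤ j) :
    Kfun γ (1 / tau r j) - Kfun γ (1 / tau r (j + 1)) = (r ^ (γ * (j : ℝ)))⁻¹ * Kfun γ r := by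
  have h0 := hr.1
  have e : ∀ i, 1 / tau r i = (r ^ (i - 1))⁻¹ := fun i => one_div _
  rw [e, e, Kfun_eq (by positivity), Kfun_eq (by positivity), Kfun_eq h0]
  obtain ⟨i, rfl⟩ : ∃ i, j = i + 1 := ⟨j - 1, by omega⟩
  simp only [Nat.add_sub_cancel]
  split_ifs with hz
  · rw [hz, Real.log_inv, Real.log_inv, Real.log_pow, Real.log_pow]
    push_cast
    simp
    ring
  · have e2 : ∀ i : ℕ, ((r ^ i)⁻¹) ^ γ = (r ^ (γ * (i : ℝ)))⁻¹ := fun i => by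
      rw [Real.inv_rpow (by positivity), ← Real.rpow_natCast, ← Real.rpow_mul h0.le,
        mul_comm γ]
    rw [e2, e2]
    have h3 : r ^ (γ * ((i + 1 : ℕ) : ℝ)) = r ^ (γ * (i : ℝ)) * r ^ γ := by
      rw [← Real.rpow_add h0]
      congr 1
      push_cast
      ring
    rw [h3]
    have h4 := (Real.rpow_pos_of_pos h0 (γ * (i : ℝ))).ne'
    have h5 := (Real.rpow_pos_of_pos h0 γ).ne'
    field_simp
    ring

theorem spacing_limitQuantiles (hr : r ∈ Set.Ioo (0 : ℝ) 1) {j : ℕ} (hj : 1 ≤ j ∧ j + 1 ≤ J) :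
    spacing J j (limitQuantiles J r γ) = (r ^ (γ * (j : ℝ)))⁻¹ * Kfun γ r := by
  have h1 : j - 1 + 1 = j := by omega
  have h2 : j + 1 - 1 + 1 = j + 1 := by omega
  rw [spacing, sub_apply, coord_apply ⟨hj.1, by omega⟩, coord_apply ⟨by omega, hj.2⟩]
  simp only [limitQuantiles, h1, h2]
  exact Kfun_sub γ hr hj.1

theorem spacing_limitQuantiles_neg (hr : r ∈ Set.Ioo (0 : ℝ) 1) {j : ℕ}
    (hj : 1 ≤ j ∧ j + 1 ≤ J) : spacing J j (limitQuantiles J r γ) < 0 := by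
  rw [spacing_limitQuantiles hr hj]
  exact mul_neg_of_pos_of_neg (inv_pos.2 (Real.rpow_pos_of_pos hr.1 _)) (Kfun_neg hr.1 hr.2)

/-- The derivative of `gammaFun` at the limit quantiles. -/
def gammaFunDeriv (J : ℕ) (r : ℝ) (π : ℕ → ℝ) (γ : ℝ) : (Fin J → ℝ) →L[ℝ] ℝ :=
  (1 / Real.log r) • ∑ j ∈ Finset.Icc 1 (J - 2), π j •
    ((r ^ (γ * (j : ℝ)) / Kfun γ r) • spacing J j -
      (r ^ (γ * ((j : ℝ) + 1)) / Kfun γ r) • spacing J (j + 1))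

theorem hasFDerivAt_gammaFun (hr : r ∈ Set.Ioo (0 : ℝ) 1) :
    HasFDerivAt (gammaFun J r π) (gammaFunDeriv J r π γ) (limitQuantiles J r γ) := by
  unfold gammaFun gammaFunDeriv
  refine HasFDerivAt.const_mul (HasFDerivAt.fun_sum fun j hj => HasFDerivAt.const_mul ?_ _) _
  rw [Finset.mem_Icc] at hj
  have n1 := (spacing_limitQuantiles_neg (J := J) (γ := γ) hr (j := j) (by omega)).ne
  have n2 := (spacing_limitQuantiles_neg (J := J) (γ := γ) hr (j := j + 1) (by omega)).ne
  have h1 := ((spacing J j).hasFDerivAt (x := limitQuantiles J r γ)).log n1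
  have h2 := ((spacing J (j + 1)).hasFDerivAt (x := limitQuantiles J r γ)).log n2
  have e1 : (spacing J j (limitQuantiles J r γ))⁻¹ = r ^ (γ * (j : ℝ)) / Kfun γ r := by
    rw [spacing_limitQuantiles hr (by omega), mul_inv, inv_inv, div_eq_mul_inv]
  have e2 : (spacing J (j + 1) (limitQuantiles J r γ))⁻¹ =
      r ^ (γ * ((j : ℝ) + 1)) / Kfun γ r := by
    rw [spacing_limitQuantiles hr (by omega), mul_inv, inv_inv, div_eq_mul_inv]
    push_cast
    rfl
  rw [e1] at h1
  rw [e2] at h2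
  -- The logarithm of the quotient splits near the limit point, where both spacings stay nonzero.
  refine (h1.sub h2).congr_of_eventuallyEq ?_
  filter_upwards [(spacing J j).continuous.continuousAt.eventually_ne n1,
    (spacing J (j + 1)).continuous.continuousAt.eventually_ne n2] with w hw1 hw2
  rw [Real.log_div hw1 hw2]
  rfl

theorem gammaFun_limitQuantiles (hr : r ∈ Set.Ioo (0 : ℝ) 1)
    (hπ : ∑ j ∈ Finset.Icc 1 (J - 2), π j = 1) :
    gammaFun J r π (limitQuantiles J r γ) = γ := by
  have hl : Real.log r ≠ 0 := (Real.log_neg hr.1 hr.2).ne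
  have h1 : ∀ j ∈ Finset.Icc 1 (J - 2), π j * Real.log (spacing J j (limitQuantiles J r γ) /
      spacing J (j + 1) (limitQuantiles J r γ)) = π j * (γ * Real.log r) := by
    intro j hj
    rw [Finset.mem_Icc] at hj
    rw [spacing_limitQuantiles hr (by omega), spacing_limitQuantiles hr (by omega)]
    have h3 : r ^ (γ * ((j + 1 : ℕ) : ℝ)) = r ^ (γ * (j : ℝ)) * r ^ γ := by
      rw [← Real.rpow_add hr.1]
      congr 1
      push_cast
      ring
    have h4 := (Real.rpow_pos_of_pos hr.1 (γ * (j : ℝ))).ne'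
    have h5 := (Kfun_neg (z := γ) hr.1 hr.2).ne
    rw [h3, ← Real.log_rpow hr.1]
    congr 2
    field_simp
  rw [gammaFun, Finset.sum_congr rfl h1, ← Finset.sum_mul, hπ]
  field_simp

theorem sum_spacing_limitQuantiles (hr : r ∈ Set.Ioo (0 : ℝ) 1) (c : ℕ → ℝ) :
    ∑ j ∈ Finset.Icc 1 (J - 2), c j * r ^ (γ * (j : ℝ)) * spacing J j (limitQuantiles J r γ) =
      (∑ j ∈ Finset.Icc 1 (J - 2), c j) * Kfun γ r := by
  rw [Finset.sum_mul]
  refine Finset.sum_congr rfl fun j hj => ?_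
  rw [Finset.mem_Icc] at hj
  rw [spacing_limitQuantiles hr (by omega)]
  have h4 := (Real.rpow_pos_of_pos hr.1 (γ * (j : ℝ))).ne'
  field_simp

theorem scaleFun_limitQuantiles (hr : r ∈ Set.Ioo (0 : ℝ) 1)
    (hπ : ∑ j ∈ Finset.Icc 1 (J - 2), π j = 1) :
    scaleFun J r π (limitQuantiles J r γ) = 1 := by
  rw [scaleFun, gammaFun_limitQuantiles hr hπ, sum_spacing_limitQuantiles hr, hπ, one_mul,
    one_div, inv_mul_cancel₀ (Kfun_neg hr.1 hr.2).ne]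

/-- The derivative of `scaleFun` at the limit quantiles. -/
def scaleFunDeriv (J : ℕ) (r : ℝ) (π : ℕ → ℝ) (γ : ℝ) : (Fin J → ℝ) →L[ℝ] ℝ :=
  (Real.log r * weightShift J r π γ) • gammaFunDeriv J r π γ +
    (1 / Kfun γ r) • ∑ j ∈ Finset.Icc 1 (J - 2), (π j * r ^ (γ * (j : ℝ))) • spacing J j

/-- The index acts through 1/K_γ(r) and through the powers r^(γj). At the limit these contribute
-K'_γ(r)/K_γ(r) and log r · Σ j π_j, together log r · `weightShift`; the remaining term
differentiates the spacings. -/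
theorem hasFDerivAt_scaleFun (hr : r ∈ Set.Ioo (0 : ℝ) 1)
    (hπ : ∑ j ∈ Finset.Icc 1 (J - 2), π j = 1) :
    HasFDerivAt (scaleFun J r π) (scaleFunDeriv J r π γ) (limitQuantiles J r γ) := by
  have hK := (Kfun_neg (z := γ) hr.1 hr.2).ne
  have hl : Real.log r ≠ 0 := (Real.log_neg hr.1 hr.2).ne
  have hG := hasFDerivAt_gammaFun (J := J) (π := π) (γ := γ) hr
  have hGv := gammaFun_limitQuantiles (J := J) (π := π) (γ := γ) hr hπ
  have h1 : HasFDerivAt (fun w => (Kfun (gammaFun J r π w) r)⁻¹)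
      ((-(KfunDeriv γ r) / Kfun γ r ^ 2) • gammaFunDeriv J r π γ) (limitQuantiles J r γ) := by
    have h2 := (hasDerivAt_Kfun_index γ hr.1).fun_inv hK
    rw [← hGv] at h2
    have := h2.comp_hasFDerivAt (limitQuantiles J r γ) hG
    rw [hGv] at this
    exact this
  have h2 : HasFDerivAt (fun w => ∑ j ∈ Finset.Icc 1 (J - 2),
      π j * (r ^ (gammaFun J r π w * (j : ℝ)) * spacing J j w))
      (∑ j ∈ Finset.Icc 1 (J - 2), π j • (r ^ (γ * (j : ℝ)) • spacing J j +
        spacing J j (limitQuantiles J r γ) •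
          ((r ^ (γ * (j : ℝ)) * Real.log r) • ((j : ℝ) • gammaFunDeriv J r π γ))))
      (limitQuantiles J r γ) := by
    refine HasFDerivAt.fun_sum fun j _ => HasFDerivAt.const_mul ?_ _
    have h3 := ((hG.mul_const (j : ℝ)).const_rpow hr.1).mul
      ((spacing J j).hasFDerivAt (x := limitQuantiles J r γ))
    rw [hGv] at h3
    refine h3.congr_fderiv ?_
    rfl
  have h3 := h1.mul h2
  have e : scaleFun J r π = fun w => (Kfun (gammaFun J r π w) r)⁻¹ *
      ∑ j ∈ Finset.Icc 1 (J - 2), π j * (r ^ (gammaFun J r π w * (j : ℝ)) * spacing J j w) := by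
    funext w
    rw [scaleFun, one_div]
    simp only [mul_assoc]
  rw [e]
  refine h3.congr_fderiv ?_
  rw [hGv]
  have hs1 := sum_spacing_limitQuantiles (J := J) (γ := γ) hr π
  have hs2 := sum_spacing_limitQuantiles (J := J) (γ := γ) hr (fun j => (j : ℝ) * π j)
  rw [hπ, one_mul] at hs1
  have hs1' : ∑ j ∈ Finset.Icc 1 (J - 2), π j * (r ^ (γ * (j : ℝ)) *
      spacing J j (limitQuantiles J r γ)) = Kfun γ r := by
    rw [← hs1]
    exact Finset.sum_congr rfl fun j _ => by ring
  ext u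
  simp only [scaleFunDeriv, add_apply, smul_apply, sum_apply, smul_eq_mul]
  rw [hs1']
  set G := gammaFunDeriv J r π γ u
  have e2 : ∑ j ∈ Finset.Icc 1 (J - 2), π j * (r ^ (γ * (j : ℝ)) * spacing J j u +
      spacing J j (limitQuantiles J r γ) * (r ^ (γ * (j : ℝ)) * Real.log r * ((j : ℝ) * G))) =
      (∑ j ∈ Finset.Icc 1 (J - 2), π j * r ^ (γ * (j : ℝ)) * spacing J j u) +
        meanWeight J π * Kfun γ r * (Real.log r * G) := by
    rw [meanWeight, ← hs2, Finset.sum_mul, ← Finset.sum_add_distrib]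
    exact Finset.sum_congr rfl fun j _ => by ring
  rw [e2, weightShift]
  field_simp
  ring

end Pickands

/-! ### The matrix `A` and the asymptotic covariance -/

section Matrices

variable {J : ℕ} {r : ℝ} {π : ℕ → ℝ} {γ : ℝ}

/-- Reindexing by k + 1 = j + d: the zero extension of the weights discards the other columns, and d
≤ 2 keeps j + d within 1, …, J. -/
theorem sum_extWeight (hJ : 3 ≤ J) {d : ℕ} (hd : d ≤ 2) (φ : ℕ → ℝ) (u : Fin J → ℝ) :
    ∑ k : Fin J, φ ((k : ℕ) + 1) * extWeight J π ((k : ℤ) + 1 - d) * u k =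
      ∑ j ∈ Finset.Icc 1 (J - 2), φ (j + d) * π j * coord J (j + d) u := by
  symm
  -- The minimum only makes the map land in `Fin J` for every natural number; it is inactive for j ≤
  -- J - 2.
  refine Finset.sum_of_injOn (fun j => ⟨min (j + d - 1) (J - 1), by omega⟩) ?_
    (fun _ _ => Finset.mem_coe.2 (Finset.mem_univ _)) ?_ ?_
  · intro i hi j hj hij
    rw [Finset.mem_coe, Finset.mem_Icc] at hi hj
    simp only [Fin.mk.injEq] at hij
    omega
  · intro k _ hk
    have : extWeight J π ((k : ℤ) + 1 - d) = 0 := by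
      rw [extWeight, if_neg]
      rintro ⟨h1, h2⟩
      refine hk ⟨(k : ℕ) + 1 - d, ?_, ?_⟩
      · rw [Finset.mem_coe, Finset.mem_Icc]
        omega
      · ext
        simp only
        omega
    rw [this]
    ring
  · intro j hj
    rw [Finset.mem_Icc] at hj
    have e : min (j + d - 1) (J - 1) = j + d - 1 := by omega
    rw [coord_apply (by omega)]
    simp only [e]
    have e1 : j + d - 1 + 1 = j + d := by omega
    have e2 : ((j + d - 1 : ℕ) : ℤ) + 1 - d = j := by omega
    rw [e1, e2, extWeight, if_pos (by omega), Int.toNat_natCast]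

/-- The derivative involves consecutive spacings, hence three consecutive coordinates. Collecting
the coefficient of one coordinate brings in π_j, π_(j-1) and π_(j-2), and the factors r^(-γ)
compensate the shifts of the power r^(γj). -/
theorem sum_matA_zero (hJ : 3 ≤ J) (hr : r ∈ Set.Ioo (0 : ℝ) 1) (u : Fin J → ℝ) :
    ∑ k, matA J r π γ 0 k * u k = Kfun γ r * gammaFunDeriv J r π γ u := by
  have hK := (Kfun_neg (z := γ) hr.1 hr.2).ne
  have hl : Real.log r ≠ 0 := (Real.log_neg hr.1 hr.2).ne
  have h0 := sum_extWeight (π := π) hJ (d := 0) (by norm_num) (fun n => r ^ (γ * (n : ℝ))) u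
  have h1 := sum_extWeight (π := π) hJ (d := 1) (by norm_num) (fun n => r ^ (γ * (n : ℝ))) u
  have h2 := sum_extWeight (π := π) hJ (d := 2) (by norm_num) (fun n => r ^ (γ * (n : ℝ))) u
  have e : ∑ k, matA J r π γ 0 k * u k = 1 / Real.log r *
      ((∑ k : Fin J, r ^ (γ * (((k : ℕ) + 1 : ℕ) : ℝ)) *
          extWeight J π ((k : ℤ) + 1 - (0 : ℕ)) * u k)
        - (1 + r ^ (-γ)) * (∑ k : Fin J, r ^ (γ * (((k : ℕ) + 1 : ℕ) : ℝ)) *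
          extWeight J π ((k : ℤ) + 1 - (1 : ℕ)) * u k)
        + r ^ (-γ) * (∑ k : Fin J, r ^ (γ * (((k : ℕ) + 1 : ℕ) : ℝ)) *
          extWeight J π ((k : ℤ) + 1 - (2 : ℕ)) * u k)) := by
    rw [Finset.mul_sum, Finset.mul_sum, ← Finset.sum_sub_distrib, ← Finset.sum_add_distrib,
      Finset.mul_sum]
    refine Finset.sum_congr rfl fun k _ => ?_
    have i0 : (k : ℤ) + 1 - (0 : ℕ) = (k : ℤ) + 1 := by simp
    have i1 : (k : ℤ) + 1 - (1 : ℕ) = k := by simp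
    have i2 : (k : ℤ) + 1 - (2 : ℕ) = (k : ℤ) - 1 := by push_cast; ring
    rw [i0, i1, i2]
    simp only [matA, Matrix.of_apply, Matrix.cons_val_zero]
    push_cast
    ring
  rw [e, h0, h1, h2, Finset.mul_sum, Finset.mul_sum, ← Finset.sum_sub_distrib,
    ← Finset.sum_add_distrib]
  simp only [gammaFunDeriv, smul_apply, sum_apply, sub_apply, smul_eq_mul, spacing]
  rw [mul_left_comm (Kfun γ r)]
  congr 1
  rw [Finset.mul_sum]
  refine Finset.sum_congr rfl fun j _ => ?_
  have r1 : r ^ (γ * ((j : ℝ) + 1)) = r ^ (γ * (j : ℝ)) * r ^ γ := by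
    rw [← Real.rpow_add hr.1]
    ring_nf
  have r2 : r ^ (γ * ((j : ℝ) + 2)) = r ^ (γ * (j : ℝ)) * r ^ γ * r ^ γ := by
    rw [← Real.rpow_add hr.1, ← Real.rpow_add hr.1]
    ring_nf
  have hγ := (Real.rpow_pos_of_pos hr.1 γ).ne'
  push_cast
  rw [r1, r2, Real.rpow_neg hr.1.le, add_zero, add_zero]
  field_simp
  ring

/-- The row is log r · `weightShift` times the previous one plus r^(γj) (π_j - r^(-γ) π_(j-1)), the
direct contribution of the spacings. -/
theorem sum_matA_one (hJ : 3 ≤ J) (hr : r ∈ Set.Ioo (0 : ℝ) 1) (u : Fin J → ℝ) :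
    ∑ k, matA J r π γ 1 k * u k = Kfun γ r * scaleFunDeriv J r π γ u := by
  have hK := (Kfun_neg (z := γ) hr.1 hr.2).ne
  have hl : Real.log r ≠ 0 := (Real.log_neg hr.1 hr.2).ne
  have h0 := sum_extWeight (π := π) hJ (d := 0) (by norm_num) (fun n => r ^ (γ * (n : ℝ))) u
  have h1 := sum_extWeight (π := π) hJ (d := 1) (by norm_num) (fun n => r ^ (γ * (n : ℝ))) u
  have e : ∑ k, matA J r π γ 1 k * u k =
      (Real.log r * weightShift J r π γ) * (∑ k, matA J r π γ 0 k * u k) +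
      ((∑ k : Fin J, r ^ (γ * (((k : ℕ) + 1 : ℕ) : ℝ)) *
          extWeight J π ((k : ℤ) + 1 - (0 : ℕ)) * u k)
        - r ^ (-γ) * (∑ k : Fin J, r ^ (γ * (((k : ℕ) + 1 : ℕ) : ℝ)) *
          extWeight J π ((k : ℤ) + 1 - (1 : ℕ)) * u k)) := by
    rw [Finset.mul_sum, Finset.mul_sum, ← Finset.sum_sub_distrib, ← Finset.sum_add_distrib]
    refine Finset.sum_congr rfl fun k _ => ?_
    have i0 : (k : ℤ) + 1 - (0 : ℕ) = (k : ℤ) + 1 := by simp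
    have i1 : (k : ℤ) + 1 - (1 : ℕ) = k := by simp
    rw [i0, i1]
    simp only [matA, Matrix.of_apply, Matrix.cons_val_zero, Matrix.cons_val_one]
    push_cast
    field_simp
    ring
  rw [e, h0, h1, sum_matA_zero hJ hr, Finset.mul_sum, ← Finset.sum_sub_distrib]
  simp only [scaleFunDeriv, smul_apply, sum_apply, add_apply, smul_eq_mul, spacing, sub_apply]
  rw [mul_add, ← mul_assoc (Kfun γ r) (1 / Kfun γ r), mul_one_div_cancel hK, one_mul]
  congr 1
  · ring
  refine Finset.sum_congr rfl fun j _ => ?_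
  have r1 : r ^ (γ * ((j : ℝ) + 1)) = r ^ (γ * (j : ℝ)) * r ^ γ := by
    rw [← Real.rpow_add hr.1]
    ring_nf
  have hγ := (Real.rpow_pos_of_pos hr.1 γ).ne'
  push_cast
  rw [r1, Real.rpow_neg hr.1.le, add_zero, add_zero]
  field_simp

theorem sum_matA_two (hJ : 3 ≤ J) (u : Fin J → ℝ) :
    ∑ k, matA J r π γ 2 k * u k = Kfun γ r * coord J 1 u := by
  rw [coord_apply (by omega), Finset.sum_eq_single (⟨0, by omega⟩ : Fin J)]
  · simp [matA]
  · intro k _ hk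
    have : (k : ℕ) ≠ 0 := fun h0 => hk (Fin.ext h0)
    simp [matA, this]
  · intro hcon
    exact absurd (Finset.mem_univ _) hcon

theorem tau_anti (hr : r ∈ Set.Ioo (0 : ℝ) 1) {i j : ℕ} (hij : i ≤ j) : tau r j ≤ tau r i :=
  pow_le_pow_of_le_one hr.1.le hr.2.le (by omega)

/-- The minimum of two numbers is their product over their maximum, and the larger τ has the smaller
index. -/
theorem matSigma_apply_eq (hr : r ∈ Set.Ioo (0 : ℝ) 1) (k l : Fin J) :
    (tau r ((k : ℕ) + 1) ^ (1 + γ))⁻¹ * (tau r ((l : ℕ) + 1) ^ (1 + γ))⁻¹ *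
      min (tau r ((k : ℕ) + 1)) (tau r ((l : ℕ) + 1)) = matSigma J r γ k l := by
  have p1 := tau_pos hr ((k : ℕ) + 1)
  have p2 := tau_pos hr ((l : ℕ) + 1)
  have e : min (tau r ((k : ℕ) + 1)) (tau r ((l : ℕ) + 1)) =
      tau r ((k : ℕ) + 1) * tau r ((l : ℕ) + 1) *
        (tau r (min ((k : ℕ) + 1) ((l : ℕ) + 1)))⁻¹ := by
    rcases le_total (k : ℕ) (l : ℕ) with h | h
    · rw [min_eq_right (tau_anti hr (by omega)), min_eq_left (by omega)]
      field_simp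
    · rw [min_eq_left (tau_anti hr (by omega)), min_eq_right (by omega)]
      field_simp
  rw [e, matSigma, Matrix.of_apply, Real.mul_rpow p1.le p2.le, Real.rpow_neg p1.le,
    Real.rpow_neg p2.le, Real.rpow_add p1, Real.rpow_add p2, Real.rpow_one, Real.rpow_one]
  have q1 := (Real.rpow_pos_of_pos p1 γ).ne'
  have q2 := (Real.rpow_pos_of_pos p2 γ).ne'
  field_simp

theorem isHermitian_matS {p : ℕ} (K : EuclideanSpace ℝ (Fin p) → ℝ) (gx : ℝ) :
    (matS K gx J r π γ).IsHermitian := by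
  have h1 : (matSigma J r γ).transpose = matSigma J r γ := by
    ext i j
    simp only [matSigma, Matrix.transpose_apply, Matrix.of_apply]
    rw [mul_comm (tau r ((j : ℕ) + 1)), min_comm]
  rw [Matrix.IsHermitian, Matrix.conjTranspose_eq_transpose_of_trivial, matS,
    Matrix.transpose_smul, Matrix.transpose_mul, Matrix.transpose_mul, Matrix.transpose_transpose,
    h1, Matrix.mul_assoc]

/-- The c are the weights of the score obtained by projecting the linearized estimators on t, so the
limiting second moment of that score is the quadratic form of the covariance matrix. -/
theorem dotProduct_matS {p : ℕ} (K : EuclideanSpace ℝ (Fin p) → ℝ) {gx : ℝ} (hgx : 0 < gx)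
    (hr : r ∈ Set.Ioo (0 : ℝ) 1) {c : Fin J → ℝ} {t : Fin 3 → ℝ}
    (hc : ∀ k, c k = (∑ i, t i * matA J r π γ i k) / Kfun γ r *
      (gx * tau r ((k : ℕ) + 1) ^ (1 + γ))⁻¹) :
    t ⬝ᵥ (matS K gx J r π γ).mulVec t = gx * (∑ k, ∑ l, c k * c l *
      min (tau r ((k : ℕ) + 1)) (tau r ((l : ℕ) + 1))) * ∫ u, K u ^ 2 := by
  have hK := (Kfun_neg (z := γ) hr.1 hr.2).ne
  have h1 : ∀ k, (Matrix.vecMul t (matA J r π γ)) k = ∑ i, t i * matA J r π γ i k := fun k => rfl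
  rw [matS, Matrix.smul_mulVec, dotProduct_smul, ← Matrix.mulVec_mulVec, ← Matrix.mulVec_mulVec,
    Matrix.dotProduct_mulVec, Matrix.mulVec_transpose, smul_eq_mul]
  simp only [dotProduct, Matrix.mulVec, h1, hc]
  have e : ∀ k l : Fin J, (∑ i, t i * matA J r π γ i k) / Kfun γ r *
      (gx * tau r ((k : ℕ) + 1) ^ (1 + γ))⁻¹ * ((∑ i, t i * matA J r π γ i l) / Kfun γ r *
      (gx * tau r ((l : ℕ) + 1) ^ (1 + γ))⁻¹) *
      min (tau r ((k : ℕ) + 1)) (tau r ((l : ℕ) + 1)) = 1 / (gx ^ 2 * Kfun γ r ^ 2) *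
      ((∑ i, t i * matA J r π γ i k) *
        (matSigma J r γ k l * (∑ i, t i * matA J r π γ i l))) := by
    intro k l
    rw [← matSigma_apply_eq hr, mul_inv, mul_inv]
    field_simp
  simp only [e, ← Finset.mul_sum]
  field_simp

end Matrices

/-! ### Measurability of the estimators -/

section Measurability

variable {p : ℕ} {Ω : Type*} [MeasurableSpace Ω]
  {X : ℕ → Ω → EuclideanSpace ℝ (Fin p)} {Y : ℕ → Ω → ℝ}
  {x : EuclideanSpace ℝ (Fin p)} {K : EuclideanSpace ℝ (Fin p) → ℝ}

theorem measurable_quantEst (hK : IsSmoothingKernel K) (hX : ∀ i, Measurable (X i))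
    (hY : ∀ i, Measurable (Y i)) {h : ℝ} (hh : 0 < h) (n : ℕ) {β : ℝ}
    (hβ : β ∈ Set.Ioo (0 : ℝ) 1) :
    Measurable fun ω => quantEst K h n (fun i => X i ω) (fun i => Y i ω) x β := by
  have hw : ∀ i, Measurable fun ω => K (h⁻¹ • (x - X i ω)) := fun i =>
    hK.measurable.comp (by have := hX i; fun_prop)
  have hden : Measurable fun ω => ∑ i ∈ Finset.range n, K (h⁻¹ • (x - X i ω)) :=
    Finset.measurable_sum _ fun i _ => hw i
  refine measurable_of_Iic fun t => ?_
  have hnum : Measurable fun ω => ∑ i ∈ Finset.range n, K (h⁻¹ • (x - X i ω)) *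
      ((Set.Ioi t).indicator (fun _ => (1 : ℝ)) (Y i ω) - β) :=
    Finset.measurable_sum _ fun i _ => (hw i).mul
      (((measurable_const.indicator measurableSet_Ioi).comp (hY i)).sub_const _)
  have e : (fun ω => quantEst K h n (fun i => X i ω) (fun i => Y i ω) x β) ⁻¹' Set.Iic t =
      ({ω | 0 < ∑ i ∈ Finset.range n, K (h⁻¹ • (x - X i ω))} ∩
        {ω | ∑ i ∈ Finset.range n, K (h⁻¹ • (x - X i ω)) *
          ((Set.Ioi t).indicator (fun _ => (1 : ℝ)) (Y i ω) - β) ≤ 0}) ∪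
      ({ω | ∑ i ∈ Finset.range n, K (h⁻¹ • (x - X i ω)) ≤ 0} ∩ {_ω | 0 ≤ t}) := by
    ext ω
    simp only [Set.mem_preimage, Set.mem_Iic, Set.mem_union, Set.mem_inter_iff, Set.mem_ofPred_eq]
    by_cases hpos : 0 < ∑ i ∈ Finset.range n, K (h⁻¹ • (x - X i ω))
    · rw [quantEst_le_iff hK hh hpos hβ]
      simp [hpos, not_le.2 hpos]
    · have h0 : ∑ i ∈ Finset.range n, K (h⁻¹ • (x - X i ω)) = 0 :=
        le_antisymm (not_lt.1 hpos) (Finset.sum_nonneg fun i _ => hK.nonneg _)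
      -- With zero total weight the estimated survival function is 0/0 = 0, every real is in the
      -- level set, and `sInf` of the whole line is 0.
      have h1 : quantEst K h n (fun i => X i ω) (fun i => Y i ω) x β = 0 := by
        have h2 : {s | survEst K h n (fun i => X i ω) (fun i => Y i ω) x s ≤ β} = Set.univ := by
          ext s
          simp [survEst, sum_scaledKernel, h0, hβ.1.le]
        rw [quantEst, genInv, h2, Real.sInf_univ]
      simp [h0, h1]
  rw [e]
  exact ((measurableSet_lt measurable_const hden).inter
    (measurableSet_le hnum measurable_const)).union
    ((measurableSet_le hden measurable_const).inter (MeasurableSet.const _))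

theorem measurable_Kfun_index {r : ℝ} (hr : 0 < r) : Measurable fun z => Kfun z r :=
  (continuous_iff_continuousAt.2 fun z => (hasDerivAt_Kfun_index z hr).continuousAt).measurable

variable {J : ℕ} {r α : ℝ} {π : ℕ → ℝ} {qh : Ω → ℝ → ℝ}

theorem measurable_gammaRP (hq : ∀ j, Measurable fun ω => qh ω (tau r j * α)) :
    Measurable fun ω => gammaRP J r π (qh ω) α :=
  (Finset.measurable_sum _ fun j _ => ((((hq j).sub (hq (j + 1))).div
    ((hq (j + 1)).sub (hq (j + 2)))).log).const_mul _).const_mul _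

theorem measurable_scaleRP (hr : 0 < r) (hq : ∀ j, Measurable fun ω => qh ω (tau r j * α)) :
    Measurable fun ω => scaleRP J r π (qh ω) α := by
  have hγ := measurable_gammaRP (J := J) (π := π) hq
  refine (measurable_const.div ((measurable_Kfun_index hr).comp hγ)).mul
    (Finset.measurable_sum _ fun j _ => Measurable.mul (Measurable.const_mul ?_ _)
      ((hq j).sub (hq (j + 1))))
  exact measurable_const.pow (hγ.mul_const _)

end Measurability

/-! ### Asymptotic normality -/

section

variable {Ω : Type*} [MeasurableSpace Ω] {P : Measure Ω} [IsProbabilityMeasure P]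

theorem tendsto_mul_of_sq_mul_sq {v m y : ℕ → ℝ} (hv : ∀ n, 0 ≤ v n)
    (h : Tendsto (fun n => v n ^ 2 * m n ^ 2) atTop (𝓝 0)) (hy : ∀ n, |y n| ≤ m n) :
    Tendsto (fun n => v n * y n) atTop (𝓝 0) := by
  have h1 := h.sqrt
  rw [Real.sqrt_zero] at h1
  refine squeeze_zero_norm (fun n => ?_) h1
  have hm : 0 ≤ m n := (abs_nonneg _).trans (hy n)
  rw [← mul_pow, Real.sqrt_sq (mul_nonneg (hv n) hm), Real.norm_eq_abs, abs_mul,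
    abs_of_nonneg (hv n)]
  exact mul_le_mul_of_nonneg_left (hy n) (hv n)

theorem tendsto_measureReal_norm_pi {ι : Type*} [Fintype ι] {f : ℕ → Ω → ι → ℝ}
    (h : ∀ k, ∀ ε > 0, Tendsto (fun n => P.real {ω | ε ≤ |f n ω k|}) atTop (𝓝 0)) {ε : ℝ}
    (hε : 0 < ε) : Tendsto (fun n => P.real {ω | ε ≤ ‖f n ω‖}) atTop (𝓝 0) := by
  have h1 := tendsto_finsetSum Finset.univ fun k _ => h k ε hε
  rw [Finset.sum_const_zero] at h1
  refine squeeze_zero (fun n => measureReal_nonneg) (fun n => ?_) h1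
  refine (measureReal_mono (fun ω hω => ?_) (measure_ne_top _ _)).trans
    (measureReal_biUnion_finset_le Finset.univ fun k => {ω | ε ≤ |f n ω k|})
  by_contra hcon
  simp only [Set.mem_iUnion, Finset.mem_univ, exists_prop, true_and, not_exists] at hcon
  have hlt : ‖f n ω‖ < ε := (pi_norm_lt_iff hε).2 fun k => not_le.1 (hcon k)
  exact absurd hω (not_le.2 hlt)

theorem exists_measureReal_norm_pi_le {ι : Type*} [Fintype ι] [Nonempty ι] {f : ℕ → Ω → ι → ℝ}
    (h : ∀ k, ∀ δ > 0, ∃ M : ℝ, ∀ᶠ n in atTop, P.real {ω | M ≤ |f n ω k|} ≤ δ) {δ : ℝ}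
    (hδ : 0 < δ) : ∃ M : ℝ, ∀ᶠ n in atTop, P.real {ω | M ≤ ‖f n ω‖} ≤ δ := by
  have hc : (0 : ℝ) < Fintype.card ι := Nat.cast_pos.2 Fintype.card_pos
  choose M hM using fun k => h k (δ / Fintype.card ι) (div_pos hδ hc)
  refine ⟨1 + ∑ k, |M k|, ?_⟩
  filter_upwards [eventually_all.2 hM] with n hn
  have hpos : 0 < 1 + ∑ k, |M k| := by
    have : 0 ≤ ∑ k, |M k| := Finset.sum_nonneg fun k _ => abs_nonneg _
    linarith
  calc P.real {ω | 1 + ∑ k, |M k| ≤ ‖f n ω‖} ≤ P.real (⋃ k ∈ Finset.univ, {ω | M k ≤ |f n ω k|}) :=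
        measureReal_mono (h₂ := measure_ne_top _ _) fun ω hω => by
          by_contra hcon
          simp only [Set.mem_iUnion, Finset.mem_univ, exists_prop, true_and, not_exists] at hcon
          refine absurd hω (not_le.2 ((pi_norm_lt_iff hpos).2 fun k => ?_))
          have h1 : |f n ω k| < M k := not_le.1 (hcon k)
          have h2 := Finset.single_le_sum (f := fun k => |M k|) (fun k _ => abs_nonneg _)
            (Finset.mem_univ k)
          have h3 := le_abs_self (M k)
          rw [Real.norm_eq_abs]
          linarith
    _ ≤ ∑ k, P.real {ω | M k ≤ |f n ω k|} := measureReal_biUnion_finset_le _ _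
    _ ≤ ∑ _k : ι, δ / Fintype.card ι := Finset.sum_le_sum fun k _ => hn k
    _ = δ := by
        rw [Finset.sum_const, Finset.card_univ, nsmul_eq_mul, mul_div_cancel₀ _ hc.ne']

theorem tendstoInMeasure_euclidean {d : ℕ} {f : ℕ → Ω → EuclideanSpace ℝ (Fin d)}
    (h : ∀ k, ∀ ε > 0, Tendsto (fun n => P.real {ω | ε ≤ |f n ω k|}) atTop (𝓝 0)) :
    TendstoInMeasure P f atTop 0 := by
  rw [tendstoInMeasure_iff_measureReal_norm]
  intro ε hε
  have hc : (0 : ℝ) < d + 1 := by positivity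
  -- If the d coordinates are all below ε/(d+1), the squared norm is at most dε²/(d+1)² < ε².
  have h1 := tendsto_measureReal_norm_pi (f := fun n ω k => f n ω k) h
    (show 0 < ε / (d + 1) by positivity)
  refine squeeze_zero (fun n => measureReal_nonneg) (fun n => measureReal_mono fun ω hω => ?_) h1
  simp only [Pi.zero_apply, sub_zero, Set.mem_ofPred_eq] at hω ⊢
  by_contra hcon
  rw [not_le, pi_norm_lt_iff (by positivity)] at hcon
  have h2 : ‖f n ω‖ ^ 2 ≤ ∑ _k : Fin d, (ε / (d + 1)) ^ 2 := by
    rw [EuclideanSpace.norm_sq_eq]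
    exact Finset.sum_le_sum fun k _ => pow_le_pow_left₀ (norm_nonneg _) (hcon k).le 2
  rw [Finset.sum_const, Finset.card_univ, Fintype.card_fin, nsmul_eq_mul, div_pow] at h2
  have h3 : ε ^ 2 ≤ ‖f n ω‖ ^ 2 := pow_le_pow_left₀ hε.le hω 2
  have h4 : (d : ℝ) * (ε ^ 2 / (d + 1) ^ 2) < ε ^ 2 := by
    rw [← mul_div_assoc, div_lt_iff₀ (by positivity)]
    have : 0 < ε ^ 2 := by positivity
    have hd : (0 : ℝ) ≤ d := Nat.cast_nonneg d
    nlinarith [mul_nonneg this.le hd, mul_nonneg (mul_nonneg this.le hd) hd]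
  linarith

end

/-! ### The linear part of the estimators and its central limit theorem. -/

section

variable {p : ℕ} {Ω : Type*} [MeasurableSpace Ω] {P : Measure Ω} [IsProbabilityMeasure P]
  {X : ℕ → Ω → EuclideanSpace ℝ (Fin p)} {Y : ℕ → Ω → ℝ}
  {g : EuclideanSpace ℝ (Fin p) → ℝ} {Q : Kernel (EuclideanSpace ℝ (Fin p)) ℝ}
  {x : EuclideanSpace ℝ (Fin p)} {K : EuclideanSpace ℝ (Fin p) → ℝ} {h α : ℕ → ℝ}

/-- The linear approximation of the normalized quantile of order `τ_{k+1} α`. -/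
def quantileScore (g : EuclideanSpace ℝ (Fin p) → ℝ) (Q : Kernel (EuclideanSpace ℝ (Fin p)) ℝ)
    (x : EuclideanSpace ℝ (Fin p)) (K : EuclideanSpace ℝ (Fin p) → ℝ) (h α : ℕ → ℝ) (r γ : ℝ)
    (k n : ℕ) (s : EuclideanSpace ℝ (Fin p) × ℝ) : ℝ :=
  score x K h α (fun _ : Fin 1 => (g x * tau r (k + 1) ^ (1 + γ))⁻¹) (fun _ => tau r (k + 1))
    (fun n _ => genInv (condSurv Q x) (tau r (k + 1) * α n)) n s

theorem sum_mul_quantileScore {J : ℕ} (r γ : ℝ) (l : Fin J → ℝ) (n : ℕ)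
    (s : EuclideanSpace ℝ (Fin p) × ℝ) :
    ∑ k, l k * quantileScore g Q x K h α r γ k n s =
      score x K h α (fun k : Fin J => l k * (g x * tau r ((k : ℕ) + 1) ^ (1 + γ))⁻¹)
        (fun k => tau r ((k : ℕ) + 1))
        (fun n k => genInv (condSurv Q x) (tau r ((k : ℕ) + 1) * α n)) n s := by
  simp only [quantileScore, score_fin_one]
  rw [score, exceed, Finset.mul_sum, Finset.mul_sum]
  refine Finset.sum_congr rfl fun k _ => ?_
  ring

variable [IsMarkovKernel Q] {J : ℕ} {r γ : ℝ} {π : ℕ → ℝ}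

/-- Central limit theorem for the linear approximation of the refined Pickands estimators. -/
theorem tendstoInDistribution_linear
    (S : IsIIDSample P (jointLaw g Q) fun i ω => (X i ω, Y i ω)) (H : IsSmoothingScheme g K h α)
    (hα : Tendsto α atTop (𝓝 0)) (hgx : 0 < g x) (hr : r ∈ Set.Ioo (0 : ℝ) 1)
    (hthr : ∀ k : Fin J, IsTailThreshold Q x h α (tau r ((k : ℕ) + 1)) 0
      fun n => genInv (condSurv Q x) (tau r ((k : ℕ) + 1) * α n)) :
    (matS K (g x) J r π γ).PosSemidef ∧
    TendstoInDistribution (fun (n : ℕ) (ω : Ω) => WithLp.toLp 2 fun i : Fin 3 =>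
        (∑ k, matA J r π γ i k * ∑ m ∈ Finset.range n,
          quantileScore g Q x K h α r γ k n (X m ω, Y m ω)) / Kfun γ r)
      atTop (id : EuclideanSpace ℝ (Fin 3) → EuclideanSpace ℝ (Fin 3)) (fun _ => P)
      (multivariateGaussian 0 (matS K (g x) J r π γ)) := by
  have := S.isProbabilityMeasure
  set c : (Fin 3 → ℝ) → Fin J → ℝ := fun t k => (∑ i, t i * matA J r π γ i k) / Kfun γ r *
    (g x * tau r ((k : ℕ) + 1) ^ (1 + γ))⁻¹ with hc
  set f : (Fin 3 → ℝ) → ℕ → EuclideanSpace ℝ (Fin p) × ℝ → ℝ := fun t =>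
    score x K h α (c t) (fun k => tau r ((k : ℕ) + 1))
        (fun n k => genInv (condSurv Q x) (tau r ((k : ℕ) + 1) * α n)) with hf
  have hmean : ∀ t, Tendsto (fun n : ℕ => n * ∫ s, f t n s ∂(jointLaw g Q)) atTop (𝓝 0) := by
    intro t
    have := H.tendsto_mean_score (c := c t) hthr
    simpa using this
  have hsq : ∀ t, Tendsto (fun n : ℕ => n * ∫ s, f t n s ^ 2 ∂(jointLaw g Q)) atTop
      (𝓝 (t ⬝ᵥ (matS K (g x) J r π γ).mulVec t)) := by
    intro t
    rw [dotProduct_matS K hgx hr (c := c t) fun k => rfl]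
    exact H.tendsto_sq_score (c := c t) hα hthr
  -- The quadratic form is a limit of the nonnegative quantities n∫f².
  have hpsd : (matS K (g x) J r π γ).PosSemidef := by
    refine Matrix.PosSemidef.of_dotProduct_mulVec_nonneg (isHermitian_matS K (g x)) fun t => ?_
    rw [star_trivial]
    exact ge_of_tendsto' (hsq t) fun n => mul_nonneg (Nat.cast_nonneg n)
      (integral_nonneg fun s => sq_nonneg _)
  refine ⟨hpsd, ?_⟩
  have hqm : ∀ k n, Measurable (quantileScore g Q x K h α r γ k n) := fun k n =>
    H.measurable_score x _ _ _ n
  have hsum : ∀ n (k : Fin J), Measurable fun ω => ∑ m ∈ Finset.range n,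
      quantileScore g Q x K h α r γ k n (X m ω, Y m ω) := fun n k =>
    Finset.measurable_sum _ fun m _ => (hqm k n).comp (S.measurable m)
  have hmeas : ∀ n, Measurable fun ω : Ω => (WithLp.toLp 2 fun i : Fin 3 =>
        (∑ k : Fin J, matA J r π γ i k * ∑ m ∈ Finset.range n,
          quantileScore g Q x K h α r γ k n (X m ω, Y m ω)) / Kfun γ r :
      EuclideanSpace ℝ (Fin 3)) := fun n =>
    (WithLp.measurable_toLp 2 _).comp (measurable_pi_iff.2 fun i =>
      (Finset.measurable_sum _ fun k _ => (hsum n k).const_mul _).div_const _)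
  refine ⟨fun n => (hmeas n).aemeasurable, by fun_prop, ?_⟩
  -- Lévy's continuity theorem: at t, the characteristic function is that of one row sum of scores
  -- with weights `c t`.
  refine ProbabilityMeasure.tendsto_iff_tendsto_charFun.2 fun t => ?_
  simp only [ProbabilityMeasure.coe_mk, Measure.map_id]
  rw [charFun_multivariateGaussian hpsd]
  obtain ⟨B, hB, hB0⟩ := H.exists_bound_score x (c t.ofLp) (fun k : Fin J => tau r ((k : ℕ) + 1))
    (fun n k => genInv (condSurv Q x) (tau r ((k : ℕ) + 1) * α n))
  have key := S.tendsto_integral_exp_sum (H.measurable_score x (c t.ofLp) _ _) hB hB0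
    (hmean t.ofLp) (hsq t.ofLp)
  have e0 : Complex.I * ((0 : ℝ) : ℂ) -
      ((t.ofLp ⬝ᵥ (matS K (g x) J r π γ).mulVec t.ofLp : ℝ) : ℂ) / 2 =
      ((inner ℝ t (0 : EuclideanSpace ℝ (Fin 3)) : ℝ) : ℂ) * Complex.I -
      ((t.ofLp ⬝ᵥ (matS K (g x) J r π γ).mulVec t.ofLp : ℝ) : ℂ) / 2 := by
    rw [inner_zero_right]
    simp
  rw [e0] at key
  refine key.congr fun n => ?_
  rw [charFun_apply, integral_map (hmeas n).aemeasurable (by fun_prop)]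
  congr 1
  ext ω
  rw [mul_comm]
  congr 3
  rw [PiLp.inner_apply]
  have e1 : ∀ m, score x K h α (c t.ofLp) (fun k => tau r ((k : ℕ) + 1))
      (fun n k => genInv (condSurv Q x) (tau r ((k : ℕ) + 1) * α n)) n (X m ω, Y m ω) =
      ∑ k : Fin J, (∑ i, t.ofLp i * matA J r π γ i k) / Kfun γ r *
        quantileScore g Q x K h α r γ k n (X m ω, Y m ω) := fun m =>
    (sum_mul_quantileScore r γ (fun k => (∑ i, t.ofLp i * matA J r π γ i k) / Kfun γ r) n _).symm
  rw [Finset.sum_congr rfl fun m _ => e1 m]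
  rw [Finset.sum_comm]
  rw [Finset.sum_congr rfl fun k _ => (Finset.mul_sum _ _ _).symm]
  simp only [RCLike.inner_apply, conj_trivial, Finset.sum_div, Finset.sum_mul]
  rw [Finset.sum_comm]
  refine Finset.sum_congr rfl fun i _ => ?_
  rw [Finset.mul_sum]
  refine Finset.sum_congr rfl fun k _ => ?_
  ring

end

/-! ### Joint linearization and tightness of the quantile estimators. -/

section

variable {p : ℕ} {Ω : Type*} [MeasurableSpace Ω] {P : Measure Ω} [IsProbabilityMeasure P]
  {X : ℕ → Ω → EuclideanSpace ℝ (Fin p)} {Y : ℕ → Ω → ℝ}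
  {g : EuclideanSpace ℝ (Fin p) → ℝ} {Q : Kernel (EuclideanSpace ℝ (Fin p)) ℝ} [IsMarkovKernel Q]
  {x : EuclideanSpace ℝ (Fin p)} {K : EuclideanSpace ℝ (Fin p) → ℝ} {h α : ℕ → ℝ}
  {J : ℕ} {r γ : ℝ} {a : ℝ → ℝ}

/-- Joint linearization of the normalized quantile estimators. -/
theorem tendsto_measureReal_normalizedQuantiles_sub
    (S : IsIIDSample P (jointLaw g Q) fun i ω => (X i ω, Y i ω)) (H : IsSmoothingScheme g K h α)
    (hα : Tendsto α atTop (𝓝 0)) (hgx : 0 < g x) {y0 κ lam : ℝ}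
    (hF : IsVonMisesTail (condSurv Q x) γ y0) (ha : IsAuxiliary (condSurv Q x) γ a)
    (hr : r ∈ Set.Ioo (0 : ℝ) 1) (hκ : κ ∈ Set.Ioo 0 (tau r J)) (hlam : 1 < lam)
    (hosc : Tendsto (fun n => effRate p h α n * oscillation Q x (h n) κ lam (α n)) atTop (𝓝 0))
    (hbias : ∀ k : Fin J, Tendsto (fun n => effRate p h α n *
      bias (condSurv Q x) γ a (tau r ((k : ℕ) + 1)) (α n)) atTop (𝓝 0)) :
    (∀ k : Fin J, IsTailThreshold Q x h α (tau r ((k : ℕ) + 1)) 0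
      fun n => genInv (condSurv Q x) (tau r ((k : ℕ) + 1) * α n)) ∧
    ∀ ε > 0, Tendsto (fun n => P.real {ω | ε ≤ ‖effRate p h α n •
        (normalizedQuantiles J r
          (quantEst K (h n) n (fun i => X i ω) (fun i => Y i ω) x) (α n)
          (genInv (condSurv Q x) (α n)) (a (genInv (condSurv Q x) (α n))) -
        limitQuantiles J r γ) - fun k : Fin J => ∑ m ∈ Finset.range n,
          quantileScore g Q x K h α r γ k n (X m ω, Y m ω)‖}) atTop (𝓝 0) := by
  have hτ : ∀ k : Fin J, κ < tau r ((k : ℕ) + 1) ∧ tau r ((k : ℕ) + 1) ≤ 1 := fun k =>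
    ⟨hκ.2.trans_le (tau_anti hr k.2), by simpa [tau] using pow_le_one₀ hr.1.le hr.2.le⟩
  have key := fun k => tendsto_measureReal_quantEst_sub S H hα hgx hF ha hκ.1 (hτ k).1 (hτ k).2
    hlam hosc
  refine ⟨fun k => (key k).1, fun ε hε => tendsto_measureReal_norm_pi (fun k ε hε => ?_) hε⟩
  refine squeeze_zero' (Eventually.of_forall fun n => measureReal_nonneg) ?_
    ((key k).2 (ε / 2) (half_pos hε))
  have hb := (tendsto_zero_iff_abs_tendsto_zero _).1 (hbias k)
  filter_upwards [hb.eventually_lt_const (half_pos hε)] with n hn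
  refine measureReal_mono (fun ω hω => ?_) (measure_ne_top _ _)
  simp only [Function.comp_apply] at hn
  simp only [Set.mem_ofPred_eq, Pi.sub_apply, Pi.smul_apply, smul_eq_mul] at hω ⊢
  rw [show (ε : ℝ) = ε / 2 + ε / 2 by ring] at hω
  by_contra hcon
  rw [not_le] at hcon
  refine absurd hω (not_le.2 (lt_of_le_of_lt ?_ (add_lt_add hcon hn)))
  -- Inserting q(τα) splits the error into the linearization error of q̂(τα) and v times the bias.
  refine le_trans (le_of_eq ?_) (abs_add_le _ _)
  congr 1
  simp only [normalizedQuantiles, limitQuantiles, bias, quantileScore]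
  ring

theorem exists_measureReal_quantileScore_le
    (S : IsIIDSample P (jointLaw g Q) fun i ω => (X i ω, Y i ω)) (H : IsSmoothingScheme g K h α)
    (hα : Tendsto α atTop (𝓝 0)) (hJ : 0 < J)
    (hthr : ∀ k : Fin J, IsTailThreshold Q x h α (tau r ((k : ℕ) + 1)) 0
      fun n => genInv (condSurv Q x) (tau r ((k : ℕ) + 1) * α n)) {δ : ℝ} (hδ : 0 < δ) :
    ∃ M : ℝ, ∀ᶠ n in atTop, P.real {ω | M ≤ ‖fun k : Fin J => ∑ m ∈ Finset.range n,
      quantileScore g Q x K h α r γ k n (X m ω, Y m ω)‖} ≤ δ := by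
  have := S.isProbabilityMeasure
  have : Nonempty (Fin J) := ⟨⟨0, hJ⟩⟩
  refine exists_measureReal_norm_pi_le (fun k δ hδ => ?_) hδ
  obtain ⟨B, hB, -⟩ := H.exists_bound_score x
    (fun _ : Fin 1 => (g x * tau r ((k : ℕ) + 1) ^ (1 + γ))⁻¹) (fun _ => tau r ((k : ℕ) + 1))
    (fun n _ => genInv (condSurv Q x) (tau r ((k : ℕ) + 1) * α n))
  exact S.exists_measureReal_sum_le (f := fun n => quantileScore g Q x K h α r γ k n)
    (fun n => H.measurable_score x _ _ _ n) hB (H.tendsto_mean_score fun _ => hthr k)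
    (H.tendsto_sq_score hα fun _ => hthr k) hδ

end

end ExtremeQuantile

end

/-! ### Asymptotic normality of the refined Pickands estimators. -/

theorem theorem3 {p : ℕ} {Ω : Type*} [MeasurableSpace Ω] (P : Measure Ω) [IsProbabilityMeasure P]
    -- the sample: independent pairs with common law, `g` the density of the covariate,
    -- `Q` a version of the conditional law of the response given the covariate
    (X : ℕ → Ω → EuclideanSpace ℝ (Fin p)) (Y : ℕ → Ω → ℝ)
    (hX : ∀ i, Measurable (X i)) (hY : ∀ i, Measurable (Y i))
    (hindep : iIndepFun (fun i ω => (X i ω, Y i ω)) P)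
    (g : EuclideanSpace ℝ (Fin p) → ℝ) (hg_nonneg : ∀ u, 0 ≤ g u)
    (Q : Kernel (EuclideanSpace ℝ (Fin p)) ℝ) [IsMarkovKernel Q]
    (hlaw : ∀ i, P.map (fun ω => (X i ω, Y i ω)) =
      (volume.withDensity fun u => ENNReal.ofReal (g u)) ⊗ₘ Q)
    -- the point of estimation, the tail index and the auxiliary function there
    (x : EuclideanSpace ℝ (Fin p)) (γ : ℝ) (a : ℝ → ℝ)
    (hA1 : ExtremeQuantile.VonMises (ExtremeQuantile.condSurv Q x) γ)
    (ha : ExtremeQuantile.IsAuxiliary (ExtremeQuantile.condSurv Q x) γ a)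
    (hA2 : ∃ c : ℝ, 0 < c ∧ ∀ u v, |g u - g v| ≤ c * dist u v)
    (hgx : 0 < g x)
    (K : EuclideanSpace ℝ (Fin p) → ℝ) (hA3 : ExtremeQuantile.IsSmoothingKernel K)
    -- the bandwidth and the order of the quantile
    (h α : ℕ → ℝ) (hh_pos : ∀ n, 0 < h n) (hh : Tendsto h atTop (𝓝 0))
    (hα_mem : ∀ n, α n ∈ Set.Ioo (0 : ℝ) 1) (hα : Tendsto α atTop (𝓝 0))
    -- the parameters of the refined Pickands estimators
    (J : ℕ) (hJ : 3 ≤ J) (r : ℝ) (hr : r ∈ Set.Ioo (0 : ℝ) 1)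
    (π : ℕ → ℝ) (hπ : ∑ j ∈ Finset.Icc 1 (J - 2), π j = 1)
    -- the rate conditions
    (hrate : Tendsto (fun n : ℕ => (n : ℝ) * h n ^ p * α n) atTop atTop)
    (κ : ℝ) (hκ : κ ∈ Set.Ioo 0 (ExtremeQuantile.tau r J)) (lam : ℝ) (hlam : 1 < lam)
    (hbias : Tendsto (fun n : ℕ => (n : ℝ) * h n ^ p * α n *
      (max (max (h n) (ExtremeQuantile.oscillation Q x (h n) κ lam (α n)))
        (⨆ j : Fin J, |ExtremeQuantile.bias (ExtremeQuantile.condSurv Q x) γ a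
          (ExtremeQuantile.tau r ((j : ℕ) + 1)) (α n)|)) ^ 2) atTop (𝓝 0)) :
    (ExtremeQuantile.matS K (g x) J r π γ).PosSemidef ∧
    TendstoInDistribution
      (fun (n : ℕ) (ω : Ω) =>
        let qh : ℝ → ℝ :=
          ExtremeQuantile.quantEst K (h n) n (fun i => X i ω) (fun i => Y i ω) x
        let q : ℝ := ExtremeQuantile.genInv (ExtremeQuantile.condSurv Q x) (α n)
        Real.sqrt ((n : ℝ) * h n ^ p * α n) •
          !₂[ExtremeQuantile.gammaRP J r π qh (α n) - γ,
            ExtremeQuantile.scaleRP J r π qh (α n) / a q - 1,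
            (qh (α n) - q) / a q])
      atTop (id : EuclideanSpace ℝ (Fin 3) → EuclideanSpace ℝ (Fin 3)) (fun _ => P)
      (multivariateGaussian 0 (ExtremeQuantile.matS K (g x) J r π γ)) := by
  have S : ExtremeQuantile.IsIIDSample P (ExtremeQuantile.jointLaw g Q)
      fun i ω => (X i ω, Y i ω) := ⟨fun i => (hX i).prodMk (hY i), hindep, hlaw⟩
  have hgc : Continuous g := by
    obtain ⟨c, hc, hlip⟩ := hA2
    exact (LipschitzWith.of_dist_le_mul (K := ⟨c, hc.le⟩) fun u v => by
      rw [Real.dist_eq]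
      exact hlip u v).continuous
  have H : ExtremeQuantile.IsSmoothingScheme g K h α :=
    ⟨hgc, hg_nonneg, hA3, hh_pos, hh, hα_mem, Real.tendsto_sqrt_atTop.comp hrate⟩
  have hsurv := ExtremeQuantile.isSurv_condSurv Q x
  obtain ⟨y0, hF⟩ := hA1.exists_isVonMisesTail hsurv ha
  simp only [← H.sq_effRate] at hbias
  -- Taking square roots in the rate condition shows that every term below the maximum is o(1/v).
  have hosc := ExtremeQuantile.tendsto_mul_of_sq_mul_sq
    (fun n => ExtremeQuantile.effRate_nonneg (p := p) (h := h) (α := α) n) hbias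
    (y := fun n => ExtremeQuantile.oscillation Q x (h n) κ lam (α n)) fun n => by
      rw [abs_of_nonneg (ExtremeQuantile.oscillation_nonneg ..)]
      exact (le_max_right _ _).trans (le_max_left _ _)
  have hb : ∀ k : Fin J, Tendsto (fun n => ExtremeQuantile.effRate p h α n *
      ExtremeQuantile.bias (ExtremeQuantile.condSurv Q x) γ a
        (ExtremeQuantile.tau r ((k : ℕ) + 1)) (α n)) atTop (𝓝 0) := fun k =>
    ExtremeQuantile.tendsto_mul_of_sq_mul_sq
      (fun n => ExtremeQuantile.effRate_nonneg n) hbias fun n =>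
        (le_ciSup (f := fun j : Fin J => |ExtremeQuantile.bias (ExtremeQuantile.condSurv Q x) γ a
          (ExtremeQuantile.tau r ((j : ℕ) + 1)) (α n)|) (Set.finite_range _).bddAbove k).trans
          (le_max_right _ _)
  obtain ⟨hthr, hlin⟩ := ExtremeQuantile.tendsto_measureReal_normalizedQuantiles_sub S H hα hgx hF
    ha hr hκ hlam hosc hb
  obtain ⟨hpsd, hclt⟩ := ExtremeQuantile.tendstoInDistribution_linear (π := π) S H hα hgx hr hthr
  have htight := fun δ (hδ : 0 < δ) =>
    ExtremeQuantile.exists_measureReal_quantileScore_le (γ := γ) S H hα (by omega) hthr hδ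
  have hapos : ∀ᶠ n in atTop,
      0 < a (ExtremeQuantile.genInv (ExtremeQuantile.condSurv Q x) (α n)) := by
    have h1 := (hF.tendsto_genInv hα (Eventually.of_forall fun n => (hα_mem n).1)).1
    filter_upwards [h1] with n hn
    refine ha.1 _ ((hsurv.lt_endpoint_iff _).2 ?_)
    rw [hn]
    exact (hα_mem n).1
  have hKr := (ExtremeQuantile.Kfun_neg (z := γ) hr.1 hr.2).ne
  -- Slutsky: the estimators differ from their linear part by a term vanishing in probability, which
  -- is checked coordinate by coordinate with the delta method.
  refine ⟨hpsd, tendstoInDistribution_of_tendstoInMeasure_sub _ _ hclt ?_ fun n => ?_⟩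
  · refine ExtremeQuantile.tendstoInMeasure_euclidean fun i ε hε => ?_
    have hγ := ExtremeQuantile.tendsto_measureReal_delta
      (ExtremeQuantile.hasFDerivAt_gammaFun (J := J) (π := π) (γ := γ) hr) H.rate htight hlin hε
    have hs := ExtremeQuantile.tendsto_measureReal_delta
      (ExtremeQuantile.hasFDerivAt_scaleFun (J := J) (π := π) (γ := γ) hr hπ) H.rate htight hlin hε
    have hq := ExtremeQuantile.tendsto_measureReal_delta
      ((ExtremeQuantile.coord J 1).hasFDerivAt (x := ExtremeQuantile.limitQuantiles J r γ))
      H.rate htight hlin hε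
    -- Since τ_1 = 1, the first limit quantile is K_γ(1) = 0, and the third component is the first
    -- normalized quantile itself.
    have hl1 : ExtremeQuantile.limitQuantiles J r γ ⟨0, by omega⟩ = 0 := by
      simp [ExtremeQuantile.limitQuantiles, ExtremeQuantile.tau, ExtremeQuantile.Kfun_one]
    fin_cases i
    · refine hγ.congr' ?_
      filter_upwards [hapos] with n hn
      congr 1
      ext ω
      simp [← ExtremeQuantile.gammaRP_eq _ _ _ _ _ hn.ne',
        ExtremeQuantile.gammaFun_limitQuantiles hr hπ, ExtremeQuantile.sum_matA_zero hJ hr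
          (fun k : Fin J => ∑ m ∈ Finset.range n,
            ExtremeQuantile.quantileScore g Q x K h α r γ k n (X m ω, Y m ω)),
        mul_div_cancel_left₀ _ hKr, ExtremeQuantile.effRate]
    · refine hs.congr' ?_
      filter_upwards [hapos] with n hn
      congr 1
      ext ω
      simp [← ExtremeQuantile.scaleRP_div_eq _ _ _ _ _ hn.ne',
        ExtremeQuantile.scaleFun_limitQuantiles hr hπ, ExtremeQuantile.sum_matA_one hJ hr
          (fun k : Fin J => ∑ m ∈ Finset.range n,
            ExtremeQuantile.quantileScore g Q x K h α r γ k n (X m ω, Y m ω)),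
        mul_div_cancel_left₀ _ hKr, ExtremeQuantile.effRate]
    · refine hq.congr fun n => ?_
      congr 1
      ext ω
      simp [ExtremeQuantile.sum_matA_two hJ
          (fun k : Fin J => ∑ m ∈ Finset.range n,
            ExtremeQuantile.quantileScore g Q x K h α r γ k n (X m ω, Y m ω)),
        mul_div_cancel_left₀ _ hKr, ExtremeQuantile.effRate,
        ExtremeQuantile.coord_apply (J := J) (j := 1) (by omega), hl1,
        ExtremeQuantile.normalizedQuantiles, ExtremeQuantile.tau]
  -- The index j = 0 is included: truncated subtraction gives τ_0 = 1.
  · have hτ : ∀ j, ExtremeQuantile.tau r j * α n ∈ Set.Ioo (0 : ℝ) 1 := fun j =>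
      ⟨mul_pos (ExtremeQuantile.tau_pos hr j) (hα_mem n).1,
        mul_lt_one_of_nonneg_of_lt_one_right (pow_le_one₀ hr.1.le hr.2.le) (hα_mem n).1.le
          (hα_mem n).2⟩
    have hqm : ∀ β ∈ Set.Ioo (0 : ℝ) 1, Measurable fun ω =>
        ExtremeQuantile.quantEst K (h n) n (fun i => X i ω) (fun i => Y i ω) x β := fun β hβ =>
      ExtremeQuantile.measurable_quantEst hA3 hX hY (hh_pos n) n hβ
    have hγm := ExtremeQuantile.measurable_gammaRP (J := J) (π := π)
      (qh := fun ω => ExtremeQuantile.quantEst K (h n) n (fun i => X i ω) (fun i => Y i ω) x)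
      fun j => hqm _ (hτ j)
    have hsm := ExtremeQuantile.measurable_scaleRP (J := J) (π := π) hr.1
      (qh := fun ω => ExtremeQuantile.quantEst K (h n) n (fun i => X i ω) (fun i => Y i ω) x)
      fun j => hqm _ (hτ j)
    have hv : ∀ q b : ℝ, Measurable fun ω => WithLp.toLp 2 ![_, _, _] := fun q b =>
      (WithLp.measurable_toLp 2 _).comp (measurable_pi_iff.2 (Fin.forall_fin_succ.2
        ⟨hγm.sub_const γ, Fin.forall_fin_succ.2 ⟨(hsm.div_const b).sub_const 1,
          Fin.forall_fin_succ.2 ⟨((hqm _ (hα_mem n)).sub_const q).div_const b,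
            fun i => i.elim0⟩⟩⟩))
    exact ((hv _ _).const_smul (Real.sqrt ((n : ℝ) * h n ^ p * α n))).aemeasurable
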